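/- Let $\hbar>0$ and $N\in\{0,1,2,\dots\}$, put $E=\hbar(N+1)$, and let $\Pi_N$ be the orthogonal projector of $L^2(\mathbb R^2)$ onto the $\hbar(N+1)$-eigenspace of the isotropic harmonic oscillator $\widehat H_\hbar=-\frac{\hbar^2}{2}\Delta_{\mathbb R^2}+\frac{|x|^2}{2}$. Let $$\varphi_N^{\gamma_0}(x_1,x_2)=\frac{(N+1)^{\frac{N+1}{2}}}{E^{\frac{N+1}{2}}\sqrt{\pi N!}}\,(x_1+ix_2)^N e^{-\frac{N+1}{2E}|x|^2}$$ be the coherent state of the orbit $\gamma_0(t)=\sqrt E(\cos t,\sin t,-\sin t,\cos t)$ in $T^*\mathbb R^2$. Identify $(x,\xi)\in T^*\mathbb R^2$ with $x+i\xi\in\mathbb C^2$, so that $\operatorname{SU}(2)\subset\operatorname{Sp}(4,\mathbb R)$ acts on $T^*\mathbb R^2$ and the space of non-constant orbits $\{e^{-it}z\}$ of energy $E$ of the Hamiltonian $\frac12(|x|^2+|\xi|^2)$ is $\mathbb{CP}^1$, with $\gamma_0=[1:i]$. Let $\mu$ be the ($\hbar$-scaled) metaplectic representation on $L^2(\mathbb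 R^2)$, restricted to $\operatorname{SU}(2)$, and let $m$ be the Haar measure of $\operatorname{SU}(2)$ of total mass $1$. Write $\psi\otimes\psi^\dagger$ for the operator $f\mapsto\langle\psi,f\rangle\psi$, where the inner product is conjugate linear in the first argument. Then $$\Pi_N=(N+1)\int_{\operatorname{SU}(2)}\big(\mu(U)\varphi_N^{\gamma_0}\big)\otimes\big(\mu(U)\varphi_N^{\gamma_0}\big)^\dagger\,dm(U).$$ Moreover, let $\nu$ be the Fubini--Study measure of $\mathbb{CP}^1$ of total mass $1$, and for each $\gamma\in\mathbb{CP}^1$ let $\varphi_N^\gamma$ be, up to an arbitrary phase factor, $\mu(U)\varphi_N^{\gamma_0}$ for some $U\in\operatorname{SU}(2)$ with $U\cdot\gamma_0=\gamma$. Then $$\Pi_N=(N+1)\int_{\mathbb{CP}^1}\varphi_N^{\gamma}\otimes(\varphi_N^{\gamma})^\dagger\,d\nu(\gamma).$$ Both integrands are Bochner integrable with values in the bounded operators on $L^2(\mathbb R^2)$ with the operator norm, and the integrals are Bochner integrals. -/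

import Mathlib

open MeasureTheory
open scoped SchwartzMap Laplacian

namespace OrbitalCoherent

noncomputable section

/-! ### Configuration space, the Hilbert space `L²(ℝ²)`, and the harmonic oscillator -/

/-- The configuration space `ℝ²` with its Euclidean norm. -/
abbrev Plane : Type := EuclideanSpace ℝ (Fin 2)

/-- The Hilbert space `L²(ℝ²)` of complex valued functions. -/
abbrev L2 : Type := Lp ℂ 2 (volume : Measure Plane)

/-- The Hamiltonian `-(ħ²/2) Δ + |x|²/2`, acting on tempered distributions on `ℝ²`. -/
def oscillator (ħ : ℝ) : 𝓢'(Plane, ℂ) →L[ℂ] 𝓢'(Plane, ℂ) :=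
  ((-(ħ ^ 2 / 2) : ℝ) : ℂ) • LineDeriv.laplacianCLM ℂ Plane 𝓢'(Plane, ℂ)
    + TemperedDistribution.smulLeftCLM ℂ (fun x : Plane => ((‖x‖ ^ 2 / 2 : ℝ) : ℂ))

/-- The `ħ (N + 1)`-eigenspace of the oscillator in `L²(ℝ²)`: the `f ∈ L²(ℝ²)` such that
`-(ħ²/2) Δ f + (|x|²/2) f = ħ (N + 1) f`, all the terms being understood as tempered
distributions. Since the oscillator with domain `{f ∈ L² | -(ħ²/2) Δ f + (|x|²/2) f ∈ L²}` is
self-adjoint, this is the eigenspace of that self-adjoint operator. -/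
def eigenspace (ħ : ℝ) (N : ℕ) : Submodule ℂ L2 :=
  LinearMap.ker
    (((oscillator ħ - ((ħ * (N + 1) : ℝ) : ℂ) • ContinuousLinearMap.id ℂ 𝓢'(Plane, ℂ)) ∘L
      Lp.toTemperedDistributionCLM ℂ volume 2 : L2 →L[ℂ] 𝓢'(Plane, ℂ)) : L2 →ₗ[ℂ] 𝓢'(Plane, ℂ))

theorem mem_eigenspace_iff (ħ : ℝ) (N : ℕ) (f : L2) :
    f ∈ eigenspace ħ N ↔
      ((-(ħ ^ 2 / 2) : ℝ) : ℂ) • Δ (f : 𝓢'(Plane, ℂ))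
        + TemperedDistribution.smulLeftCLM ℂ (fun x : Plane => ((‖x‖ ^ 2 / 2 : ℝ) : ℂ))
            (f : 𝓢'(Plane, ℂ))
      = ((ħ * (N + 1) : ℝ) : ℂ) • (f : 𝓢'(Plane, ℂ)) := by
  rw [eigenspace, LinearMap.mem_ker]
  simp only [ContinuousLinearMap.coe_coe, ContinuousLinearMap.comp_apply,
    sub_eq_zero, oscillator, _root_.sub_apply, _root_.add_apply,
    _root_.smul_apply, TemperedDistribution.laplacianCLM_apply]
  rfl

instance (ħ : ℝ) (N : ℕ) : CompleteSpace (eigenspace ħ N) :=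
  (ContinuousLinearMap.isClosed_ker
    ((oscillator ħ - ((ħ * (N + 1) : ℝ) : ℂ) • ContinuousLinearMap.id ℂ 𝓢'(Plane, ℂ)) ∘L
      Lp.toTemperedDistributionCLM ℂ volume 2 : L2 →L[ℂ] 𝓢'(Plane, ℂ))).completeSpace_coe

/-- `Π_N`, the orthogonal projector of `L²(ℝ²)` onto the `ħ (N + 1)`-eigenspace. -/
def projector (ħ : ℝ) (N : ℕ) : L2 →L[ℂ] L2 := (eigenspace ħ N).starProjection

/-! ### The coherent state of the initial orbit -/

/-- The function
`(N+1)^((N+1)/2) / (E^((N+1)/2) √(π N!)) (x₁ + i x₂)^N exp (-(N+1)|x|²/(2E))`. -/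
def coherentFun (N : ℕ) (E : ℝ) (x : Plane) : ℂ :=
  (((N + 1 : ℝ) ^ ((N + 1 : ℝ) / 2) /
      (E ^ ((N + 1 : ℝ) / 2) * Real.sqrt (Real.pi * (N.factorial : ℝ))) : ℝ) : ℂ)
    * ((x 0 : ℂ) + Complex.I * (x 1 : ℂ)) ^ N
    * ((Real.exp (-((N + 1 : ℝ) / (2 * E)) * ‖x‖ ^ 2) : ℝ) : ℂ)

theorem memLp_coherentFun (N : ℕ) {E : ℝ} (hE : 0 < E) :
    MemLp (coherentFun N E) 2 (volume : Measure Plane) := by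
  have hcont : Continuous (coherentFun N E) := by
    unfold coherentFun
    fun_prop
  rw [memLp_two_iff_integrable_sq_norm hcont.aestronglyMeasurable]
  set K : ℝ := (N + 1 : ℝ) ^ ((N + 1 : ℝ) / 2) /
      (E ^ ((N + 1 : ℝ) / 2) * Real.sqrt (Real.pi * (N.factorial : ℝ))) with hK
  set c : ℝ := (N + 1 : ℝ) / (2 * E) with hc
  have hc0 : 0 < c := by positivity
  have hg : Integrable (fun x : Plane => Real.exp (-c * ‖x‖ ^ 2)) volume := by
    have h := (GaussianFourier.integrable_cexp_neg_mul_sq_norm_add (V := Plane) (b := (c : ℂ))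
      (by simpa using hc0) 0 0).norm
    refine h.congr (Filter.Eventually.of_forall fun x => ?_)
    simp only [Complex.norm_exp]
    congr 1
    simp [← Complex.ofReal_pow, ← Complex.ofReal_neg, ← Complex.ofReal_mul]
  have hf : (fun x : Plane => ‖coherentFun N E x‖ ^ 2)
      = fun x : Plane => K ^ 2 * (‖x‖ ^ 2) ^ N * Real.exp (-(2 * c) * ‖x‖ ^ 2) := by
    funext x
    have h1 : ‖(x 0 : ℂ) + Complex.I * (x 1 : ℂ)‖ ^ 2 = ‖x‖ ^ 2 := by
      rw [← Complex.normSq_eq_norm_sq, Complex.normSq_apply, EuclideanSpace.real_norm_sq_eq]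
      simp
      ring
    rw [coherentFun, ← hK, ← hc, norm_mul, norm_mul, norm_pow, Complex.norm_real,
      Complex.norm_real, mul_pow, mul_pow, ← pow_mul, mul_comm N 2, pow_mul, h1,
      Real.norm_of_nonneg (Real.exp_pos _).le, ← Real.exp_nat_mul, Real.norm_eq_abs, sq_abs]
    congr 2
    push_cast
    ring
  rw [hf]
  refine Integrable.mono' (hg.const_mul (K ^ 2 * (N.factorial / c ^ N)))
    (by fun_prop) (Filter.Eventually.of_forall fun x => ?_)
  rw [Real.norm_of_nonneg (by positivity)]
  have h2 := Real.pow_div_factorial_le_exp (x := c * ‖x‖ ^ 2) (by positivity) N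
  have h3 : (‖x‖ ^ 2) ^ N ≤ N.factorial / c ^ N * Real.exp (c * ‖x‖ ^ 2) := by
    rw [mul_pow, div_le_iff₀ (by positivity)] at h2
    rw [div_mul_eq_mul_div, le_div_iff₀ (by positivity)]
    linarith
  have h4 : Real.exp (c * ‖x‖ ^ 2) * Real.exp (-(2 * c) * ‖x‖ ^ 2)
      = Real.exp (-c * ‖x‖ ^ 2) := by
    rw [← Real.exp_add]
    congr 1
    ring
  calc K ^ 2 * (‖x‖ ^ 2) ^ N * Real.exp (-(2 * c) * ‖x‖ ^ 2)
      ≤ K ^ 2 * (N.factorial / c ^ N * Real.exp (c * ‖x‖ ^ 2))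
          * Real.exp (-(2 * c) * ‖x‖ ^ 2) := by gcongr
    _ = K ^ 2 * (N.factorial / c ^ N) * Real.exp (-c * ‖x‖ ^ 2) := by
      rw [← h4]
      ring

open Classical in
/-- The coherent state of the initial orbit as an element of `L²(ℝ²)`; for `E > 0` the function
is square integrable, see `memLp_coherentFun`, and the second case does not occur. -/
def coherentState (N : ℕ) (E : ℝ) : L2 :=
  if h : MemLp (coherentFun N E) 2 (volume : Measure Plane) then h.toLp _ else 0

theorem coherentState_ae_eq (N : ℕ) {E : ℝ} (hE : 0 < E) :
    coherentState N E =ᵐ[volume] coherentFun N E := by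
  rw [coherentState, dif_pos (memLp_coherentFun N hE)]
  exact MemLp.coeFn_toLp _

/-! ### Unitary operators on `L²(ℝ²)` -/

/-- The value at `x` of the phase `exp ((i / 2ħ) x · Q x)` of a quadratic form `Q`. -/
def chirpFun (ħ : ℝ) (Q : Matrix (Fin 2) (Fin 2) ℝ) (x : Plane) : ℂ :=
  Complex.exp (((1 / (2 * ħ) * inner ℝ x (Matrix.toEuclideanCLM (𝕜 := ℝ) Q x) : ℝ) : ℂ)
    * Complex.I)

theorem norm_chirpFun (ħ : ℝ) (Q : Matrix (Fin 2) (Fin 2) ℝ) (x : Plane) :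
    ‖chirpFun ħ Q x‖ = 1 := Complex.norm_exp_ofReal_mul_I _

theorem chirpFun_neg_mul (ħ : ℝ) (Q : Matrix (Fin 2) (Fin 2) ℝ) (x : Plane) :
    chirpFun ħ (-Q) x * chirpFun ħ Q x = 1 := by
  rw [chirpFun, chirpFun, ← Complex.exp_add]
  simp [inner_neg_right]

theorem continuous_chirpFun (ħ : ℝ) (Q : Matrix (Fin 2) (Fin 2) ℝ) :
    Continuous (chirpFun ħ Q) := by
  unfold chirpFun
  fun_prop

theorem memLp_chirp_mul (ħ : ℝ) (Q : Matrix (Fin 2) (Fin 2) ℝ) {f : Plane → ℂ}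
    (hf : MemLp f 2 volume) : MemLp (fun x => chirpFun ħ Q x * f x) 2 volume :=
  hf.of_le ((continuous_chirpFun ħ Q).aestronglyMeasurable.mul hf.1)
    (Filter.Eventually.of_forall fun x => by simp [norm_chirpFun])

/-- The unitary operator `f ↦ exp ((i / 2ħ) x · Q x) f` on `L²(ℝ²)`. -/
def chirp (ħ : ℝ) (Q : Matrix (Fin 2) (Fin 2) ℝ) : L2 ≃ₗᵢ[ℂ] L2 where
  toFun f := (memLp_chirp_mul ħ Q (Lp.memLp f)).toLp _
  invFun f := (memLp_chirp_mul ħ (-Q) (Lp.memLp f)).toLp _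
  map_add' f g := by
    rw [← MemLp.toLp_add]
    apply MemLp.toLp_congr
    filter_upwards [Lp.coeFn_add f g] with x hx
    simp only [hx, Pi.add_apply, mul_add]
  map_smul' c f := by
    rw [RingHom.id_apply, ← MemLp.toLp_const_smul]
    apply MemLp.toLp_congr
    filter_upwards [Lp.coeFn_smul c f] with x hx
    simp only [hx, Pi.smul_apply, smul_eq_mul, mul_left_comm]
  left_inv f := by
    refine (MemLp.toLp_congr _ (Lp.memLp f) ?_).trans (Lp.toLp_coeFn f _)
    filter_upwards [(memLp_chirp_mul ħ Q (Lp.memLp f)).coeFn_toLp] with x hx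
    rw [hx, ← mul_assoc, chirpFun_neg_mul, one_mul]
  right_inv f := by
    refine (MemLp.toLp_congr _ (Lp.memLp f) ?_).trans (Lp.toLp_coeFn f _)
    filter_upwards [(memLp_chirp_mul ħ (-Q) (Lp.memLp f)).coeFn_toLp] with x hx
    rw [hx, ← mul_assoc, mul_comm (chirpFun ħ Q x), chirpFun_neg_mul, one_mul]
  norm_map' f := by
    refine (Lp.norm_toLp _ (memLp_chirp_mul ħ Q (Lp.memLp f))).trans
      ((congrArg ENNReal.toReal ?_).trans (Lp.norm_def f).symm)
    exact eLpNorm_congr_norm_ae (Filter.Eventually.of_forall fun x => by simp [norm_chirpFun])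

theorem chirp_ae_eq (ħ : ℝ) (Q : Matrix (Fin 2) (Fin 2) ℝ) (f : L2) :
    chirp ħ Q f =ᵐ[volume] fun x => chirpFun ħ Q x * f x :=
  MemLp.coeFn_toLp (memLp_chirp_mul ħ Q (Lp.memLp f))

theorem map_toEuclideanCLM (L : Matrix (Fin 2) (Fin 2) ℝ) (hL : L.det ≠ 0) :
    Measure.map (Matrix.toEuclideanCLM (𝕜 := ℝ) L) (volume : Measure Plane)
      = ENNReal.ofReal |L.det|⁻¹ • (volume : Measure Plane) := by
  have hd : LinearMap.det (Matrix.toEuclideanCLM (𝕜 := ℝ) L : Plane →ₗ[ℝ] Plane) = L.det := by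
    rw [Matrix.coe_toEuclideanCLM_eq_toEuclideanLin, Matrix.toEuclideanLin,
      Matrix.toLpLin_eq_toLin, LinearMap.det_toLin]
  have h := Measure.map_linearMap_addHaar_eq_smul_addHaar (volume : Measure Plane)
    (f := (Matrix.toEuclideanCLM (𝕜 := ℝ) L : Plane →ₗ[ℝ] Plane)) (by rwa [hd])
  rw [hd, abs_inv] at h
  exact h

theorem quasiMeasurePreserving_toEuclideanCLM (L : Matrix (Fin 2) (Fin 2) ℝ) (hL : L.det ≠ 0) :
    Measure.QuasiMeasurePreserving (Matrix.toEuclideanCLM (𝕜 := ℝ) L)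
      (volume : Measure Plane) volume :=
  ⟨(Matrix.toEuclideanCLM (𝕜 := ℝ) L).continuous.measurable, by
    rw [map_toEuclideanCLM L hL]
    exact Measure.smul_absolutelyContinuous⟩

theorem eLpNorm_dilation (L : Matrix (Fin 2) (Fin 2) ℝ) (hL : L.det ≠ 0) {f : Plane → ℂ}
    (hf : MemLp f 2 volume) :
    eLpNorm (fun x => ((Real.sqrt |L.det| : ℝ) : ℂ) * f (Matrix.toEuclideanCLM (𝕜 := ℝ) L x))
      2 volume = eLpNorm f 2 volume := by
  have h1 : eLpNorm (fun x => f (Matrix.toEuclideanCLM (𝕜 := ℝ) L x)) 2 volume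
      = ENNReal.ofReal (Real.sqrt |L.det|⁻¹) * eLpNorm f 2 volume := by
    have hm := map_toEuclideanCLM L hL
    have hf' : AEStronglyMeasurable f
        (Measure.map (Matrix.toEuclideanCLM (𝕜 := ℝ) L) (volume : Measure Plane)) := by
      rw [hm]
      exact hf.1.mono_ac Measure.smul_absolutelyContinuous
    have h2 := eLpNorm_map_measure (p := 2) hf'
      (Matrix.toEuclideanCLM (𝕜 := ℝ) L).continuous.measurable.aemeasurable
    rw [hm, eLpNorm_smul_measure_of_ne_top (by norm_num)] at h2
    refine h2.symm.trans ?_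
    rw [Real.sqrt_eq_rpow, ← ENNReal.ofReal_rpow_of_nonneg (by positivity) (by norm_num)]
    simp
  have h3 : (fun x => ((Real.sqrt |L.det| : ℝ) : ℂ) * f (Matrix.toEuclideanCLM (𝕜 := ℝ) L x))
      = ((Real.sqrt |L.det| : ℝ) : ℂ) • fun x => f (Matrix.toEuclideanCLM (𝕜 := ℝ) L x) := rfl
  rw [h3, eLpNorm_const_smul, h1, ← mul_assoc]
  have h4 : ‖((Real.sqrt |L.det| : ℝ) : ℂ)‖ₑ = ENNReal.ofReal (Real.sqrt |L.det|) := by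
    rw [← ofReal_norm, Complex.norm_real, Real.norm_of_nonneg (Real.sqrt_nonneg _)]
  have h5 : 0 < |L.det| := abs_pos.mpr hL
  rw [h4, ← ENNReal.ofReal_mul (Real.sqrt_nonneg _), ← Real.sqrt_mul (abs_nonneg _),
    mul_inv_cancel₀ h5.ne', Real.sqrt_one, ENNReal.ofReal_one, one_mul]

theorem memLp_dilation (L : Matrix (Fin 2) (Fin 2) ℝ) (hL : L.det ≠ 0) {f : Plane → ℂ}
    (hf : MemLp f 2 volume) :
    MemLp (fun x => ((Real.sqrt |L.det| : ℝ) : ℂ) * f (Matrix.toEuclideanCLM (𝕜 := ℝ) L x))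
      2 volume :=
  ⟨(hf.1.comp_quasiMeasurePreserving (quasiMeasurePreserving_toEuclideanCLM L hL)).const_mul _,
    (eLpNorm_dilation L hL hf).trans_lt hf.2⟩

theorem toEuclideanCLM_inv_apply (L : Matrix (Fin 2) (Fin 2) ℝ) (hL : L.det ≠ 0) (x : Plane) :
    Matrix.toEuclideanCLM (𝕜 := ℝ) L (Matrix.toEuclideanCLM (𝕜 := ℝ) L⁻¹ x) = x := by
  have h : Matrix.toEuclideanCLM (𝕜 := ℝ) L * Matrix.toEuclideanCLM (𝕜 := ℝ) L⁻¹ = 1 := by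
    rw [← map_mul, Matrix.mul_nonsing_inv L (Ne.isUnit hL), map_one]
  exact congrArg (fun T : Plane →L[ℝ] Plane => T x) h

theorem det_inv_ne_zero (L : Matrix (Fin 2) (Fin 2) ℝ) (hL : L.det ≠ 0) : L⁻¹.det ≠ 0 := by
  rw [Matrix.det_nonsing_inv, Ring.inverse_eq_inv']
  exact inv_ne_zero hL

theorem sqrt_det_mul_sqrt_det_inv (L : Matrix (Fin 2) (Fin 2) ℝ) (hL : L.det ≠ 0) :
    ((Real.sqrt |L.det| : ℝ) : ℂ) * ((Real.sqrt |L⁻¹.det| : ℝ) : ℂ) = 1 := by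
  rw [Matrix.det_nonsing_inv, Ring.inverse_eq_inv', ← Complex.ofReal_mul,
    ← Real.sqrt_mul (abs_nonneg _), ← abs_mul, mul_inv_cancel₀ hL]
  simp

/-- The unitary operator `f ↦ |det L|^(1/2) f (L x)` on `L²(ℝ²)`, for an invertible `L`. -/
def dilationOfDet (L : Matrix (Fin 2) (Fin 2) ℝ) (hL : L.det ≠ 0) : L2 ≃ₗᵢ[ℂ] L2 where
  toFun f := (memLp_dilation L hL (Lp.memLp f)).toLp _
  invFun f := (memLp_dilation L⁻¹ (det_inv_ne_zero L hL) (Lp.memLp f)).toLp _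
  map_add' f g := by
    rw [← MemLp.toLp_add]
    apply MemLp.toLp_congr
    filter_upwards [(quasiMeasurePreserving_toEuclideanCLM L hL).ae (Lp.coeFn_add f g)] with x hx
    simp only [hx, Pi.add_apply, mul_add]
  map_smul' c f := by
    rw [RingHom.id_apply, ← MemLp.toLp_const_smul]
    apply MemLp.toLp_congr
    filter_upwards [(quasiMeasurePreserving_toEuclideanCLM L hL).ae (Lp.coeFn_smul c f)]
      with x hx
    simp only [hx, Pi.smul_apply, smul_eq_mul, mul_left_comm]
  left_inv f := by
    refine (MemLp.toLp_congr _ (Lp.memLp f) ?_).trans (Lp.toLp_coeFn f _)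
    filter_upwards [(quasiMeasurePreserving_toEuclideanCLM L⁻¹ (det_inv_ne_zero L hL)).ae
      (memLp_dilation L hL (Lp.memLp f)).coeFn_toLp] with x hx
    rw [hx, toEuclideanCLM_inv_apply L hL, ← mul_assoc,
      mul_comm ((Real.sqrt |L⁻¹.det| : ℝ) : ℂ), sqrt_det_mul_sqrt_det_inv L hL, one_mul]
  right_inv f := by
    refine (MemLp.toLp_congr _ (Lp.memLp f) ?_).trans (Lp.toLp_coeFn f _)
    filter_upwards [(quasiMeasurePreserving_toEuclideanCLM L hL).ae
      (memLp_dilation L⁻¹ (det_inv_ne_zero L hL) (Lp.memLp f)).coeFn_toLp] with x hx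
    have h := toEuclideanCLM_inv_apply L⁻¹ (det_inv_ne_zero L hL) x
    rw [Matrix.nonsing_inv_nonsing_inv L (Ne.isUnit hL)] at h
    rw [hx, h, ← mul_assoc, sqrt_det_mul_sqrt_det_inv L hL, one_mul]
  norm_map' f := by
    refine (Lp.norm_toLp _ (memLp_dilation L hL (Lp.memLp f))).trans
      ((congrArg ENNReal.toReal ?_).trans (Lp.norm_def f).symm)
    exact eLpNorm_dilation L hL (Lp.memLp f)

open Classical in
/-- The unitary operator `f ↦ |det L|^(1/2) f (L x)` on `L²(ℝ²)`; the identity, by convention,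
if `L` is not invertible. -/
def dilation (L : Matrix (Fin 2) (Fin 2) ℝ) : L2 ≃ₗᵢ[ℂ] L2 :=
  if hL : L.det ≠ 0 then dilationOfDet L hL else LinearIsometryEquiv.refl ℂ L2

theorem dilation_ae_eq (L : Matrix (Fin 2) (Fin 2) ℝ) (hL : L.det ≠ 0) (f : L2) :
    dilation L f =ᵐ[volume] fun x =>
      ((Real.sqrt |L.det| : ℝ) : ℂ) * f (Matrix.toEuclideanCLM (𝕜 := ℝ) L x) := by
  rw [dilation, dif_pos hL]
  exact MemLp.coeFn_toLp (memLp_dilation L hL (Lp.memLp f))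

/-! ### The group `SU(2)` and the metaplectic representation -/

/-- The special unitary group `SU(2)`. -/
abbrev SU2 : Type := Matrix.specialUnitaryGroup (Fin 2) ℂ

/-- The real part `A` of `U = A + iB`. -/
def rePart (U : SU2) : Matrix (Fin 2) (Fin 2) ℝ := (U : Matrix (Fin 2) (Fin 2) ℂ).map Complex.re

/-- The imaginary part `B` of `U = A + iB`. -/
def imPart (U : SU2) : Matrix (Fin 2) (Fin 2) ℝ := (U : Matrix (Fin 2) (Fin 2) ℂ).map Complex.im

open Classical in
/-- The metaplectic representation of `SU(2) ⊂ Sp(4, ℝ)` on `L²(ℝ²)` with semiclassical parameter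
`ħ > 0`. A phase space point `(x, ξ)` is identified with `x + iξ ∈ ℂ²`, so that `U = A + iB` is the
linear symplectic map `(x, ξ) ↦ (Ax - Bξ, Bx + Aξ)`.
For `U ∈ SU(2)` the matrix `B` is real symmetric and traceless, hence zero or invertible.

* If `B = 0`, then `U = A` is a rotation of `ℝ²` and `(μ(U) f)(x) = f (A⁻¹ x)`.
* Otherwise `μ(U)` is the quadratic Fourier transform
  `(μ(U) f)(x) = (2πħ)⁻¹ |det B|^(-1/2) ∫ exp ((i/ħ) S(x, y)) f(y) dy`,
  `S(x, y) = -(1/2) x · A B⁻¹ x + y · B⁻¹ x - (1/2) y · B⁻¹ A y`,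
  where `S` is the generating function of the symplectic map `U`, in the sense that
  `(x, ∂S/∂x) = U (y, -∂S/∂y)`. Here it is written as multiplication by a quadratic phase after a
  linear change of variables after the Fourier transform `∫ exp (-2πi y · w) g(y) dy` after
  multiplication by a quadratic phase, which gives its value on all of `L²(ℝ²)`.

The sign of the metaplectic operator is the one which makes `U ↦ μ(U)` a strongly continuous
homomorphism; as `B` has signature `(1, 1)`, no additional phase appears. -/
def metaplectic (ħ : ℝ) (U : SU2) : L2 ≃ₗᵢ[ℂ] L2 :=
  if imPart U = 0 then dilation (rePart U)⁻¹
  else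
    (((chirp ħ (-((imPart U)⁻¹ * rePart U))).trans
      (Lp.fourierTransformₗᵢ Plane ℂ)).trans
      (dilation (-(2 * Real.pi * ħ)⁻¹ • (imPart U)⁻¹))).trans
      (chirp ħ (-(rePart U * (imPart U)⁻¹)))

/-! ### Haar measure on `SU(2)` -/

instance : MeasurableSpace SU2 := borel SU2

instance : BorelSpace SU2 := ⟨rfl⟩

instance : IsTopologicalGroup SU2 where
  continuous_mul := continuous_mul
  continuous_inv := by
    refine Continuous.subtype_mk (f := fun U : SU2 => star (U : Matrix (Fin 2) (Fin 2) ℂ)) ?_ _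
    exact continuous_star.comp continuous_subtype_val

instance : CompactSpace SU2 := by
  refine (isCompact_iff_compactSpace
    (s := (Matrix.specialUnitaryGroup (Fin 2) ℂ : Set (Matrix (Fin 2) (Fin 2) ℂ)))).mp ?_
  have hK : IsCompact
      (Set.univ.pi fun _ : Fin 2 => Set.univ.pi fun _ : Fin 2 => Metric.closedBall (0 : ℂ) 1) :=
    isCompact_univ_pi fun _ => isCompact_univ_pi fun _ => isCompact_closedBall _ _
  refine IsCompact.of_isClosed_subset (s := (Set.univ.pi fun _ : Fin 2 =>
    Set.univ.pi fun _ : Fin 2 => Metric.closedBall (0 : ℂ) 1 : Set (Matrix (Fin 2) (Fin 2) ℂ)))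
    hK ?_ ?_
  · have h : {M : Matrix (Fin 2) (Fin 2) ℂ | M * star M = 1} ∩ {M | M.det = 1}
        = (Matrix.specialUnitaryGroup (Fin 2) ℂ : Set (Matrix (Fin 2) (Fin 2) ℂ)) := by
      ext M
      rw [SetLike.mem_coe, Matrix.mem_specialUnitaryGroup_iff, Matrix.mem_unitaryGroup_iff]
      rfl
    rw [← h]
    exact (isClosed_eq (continuous_id.mul continuous_star) continuous_const).inter
      (isClosed_eq (Continuous.matrix_det continuous_id) continuous_const)
  · intro M hM i _ j _
    rw [mem_closedBall_zero_iff]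
    exact entry_norm_bound_of_unitary (Matrix.specialUnitaryGroup_le_unitaryGroup hM) i j

/-- The Haar measure of `SU(2)`, of total mass `1`. -/
def haarSU2 : Measure SU2 := Measure.haarMeasure ⊤

instance : haarSU2.IsHaarMeasure := by
  unfold haarSU2
  infer_instance

instance : IsProbabilityMeasure haarSU2 :=
  ⟨by simpa [haarSU2] using
    Measure.haarMeasure_self (K₀ := (⊤ : TopologicalSpace.PositiveCompacts SU2))⟩

/-! ### The space of orbits and the Fubini-Study measure -/

/-- The complex projective line. The non-constant orbits of the classical oscillator on an energy
surface `|x|² + |ξ|² = 2E` are the circles `{e^{-it} z}`, `z = x + iξ`; the orbit of `z` is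
identified with the point `[z]` of the projective line. -/
abbrev CP1 : Type := Projectivization ℂ (Fin 2 → ℂ)

/-- The quotient `σ`-algebra of the Borel `σ`-algebra of `ℂ² \ {0}`. -/
instance : MeasurableSpace CP1 :=
  MeasurableSpace.map (fun v : {v : Fin 2 → ℂ // v ≠ 0} => Projectivization.mk' ℂ v) inferInstance

theorem chart_ne_zero (w : ℂ) : (![1, w] : Fin 2 → ℂ) ≠ 0 := fun h => by
  simpa using congrFun h 0

/-- The affine chart `w ↦ [1 : w]` of the projective line; it misses one point. -/
def chart (w : ℂ) : CP1 := Projectivization.mk ℂ ![1, w] (chart_ne_zero w)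

theorem measurable_chart : Measurable chart := by
  have h1 : Measurable fun w : ℂ =>
      (⟨![1, w], chart_ne_zero w⟩ : {v : Fin 2 → ℂ // v ≠ 0}) := by
    refine Measurable.subtype_mk (measurable_pi_iff.mpr fun i => ?_)
    fin_cases i
    · exact measurable_const
    · exact measurable_id
  have h2 : Measurable
      (fun v : {v : Fin 2 → ℂ // v ≠ 0} => (Projectivization.mk' ℂ v : CP1)) := fun _ hs => hs
  exact h2.comp h1

/-- The Fubini-Study measure of the projective line normalized to total mass `1`; in the affine
chart `w ↦ [1 : w]` it is `π⁻¹ (1 + |w|²)⁻² dw` with `dw` the Lebesgue measure of `ℂ`, and the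
point which the chart misses is a null set. -/
def fubiniStudy : Measure CP1 :=
  Measure.map chart
    ((volume : Measure ℂ).withDensity fun w =>
      ENNReal.ofReal (1 / (Real.pi * (1 + ‖w‖ ^ 2) ^ 2)))

/-- The point `x + iξ` of `ℂ²` given by a point `(x, ξ)` of phase space. -/
def complexPoint (p : Plane × Plane) : Fin 2 → ℂ := fun j => (p.1 j : ℂ) + Complex.I * (p.2 j : ℂ)

/-- The initial orbit `t ↦ √E (cos t, sin t, -sin t, cos t)` in phase space. -/
def gammaZeroCurve (E t : ℝ) : Plane × Plane :=
  (!₂[Real.sqrt E * Real.cos t, Real.sqrt E * Real.sin t],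
    !₂[-(Real.sqrt E * Real.sin t), Real.sqrt E * Real.cos t])

/-- The initial orbit as a point of the projective line. -/
def gammaZero : CP1 := Projectivization.mk ℂ ![1, Complex.I] (chart_ne_zero Complex.I)

theorem complexPoint_gammaZeroCurve (E t : ℝ) :
    complexPoint (gammaZeroCurve E t)
      = ((Real.sqrt E : ℂ) * Complex.exp (-(t : ℂ) * Complex.I)) • ![1, Complex.I] := by
  have h : Complex.exp (-(t : ℂ) * Complex.I) = Complex.cos t - Complex.sin t * Complex.I := by
    rw [Complex.exp_mul_I, Complex.cos_neg, Complex.sin_neg]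
    ring
  funext j
  rw [h]
  fin_cases j
  · simp [complexPoint, gammaZeroCurve]
    ring
  · simp [complexPoint, gammaZeroCurve]
    linear_combination ((Real.sqrt E : ℂ) * Complex.sin t) * Complex.I_mul_I

/-- The inclusion of `SU(2)` into `SL(2, ℂ)`, through which `SU(2)` acts on the projective line
by `U • [z] = [U z]`. -/
def toSL (U : SU2) : Matrix.SpecialLinearGroup (Fin 2) ℂ := ⟨U, U.2.2⟩

/-- `SU(2)` acts transitively on the space of orbits. -/
theorem exists_toSL_smul_gammaZero (γ : CP1) : ∃ U : SU2, toSL U • gammaZero = γ := by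
  induction γ using Projectivization.ind with
  | h v hv =>
    have hn : 0 < Complex.normSq (v 0) + Complex.normSq (v 1) := by
      by_contra hcon
      apply hv
      have h0 := Complex.normSq_nonneg (v 0)
      have h1 := Complex.normSq_nonneg (v 1)
      have h2 : v 0 = 0 := Complex.normSq_eq_zero.mp (by linarith)
      have h3 : v 1 = 0 := Complex.normSq_eq_zero.mp (by linarith)
      funext j
      fin_cases j
      · exact h2
      · exact h3
    set s : ℝ := 2 * (Complex.normSq (v 0) + Complex.normSq (v 1)) with hs
    set k : ℝ := (Real.sqrt s)⁻¹ with hk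
    have hs0 : 0 < s := by positivity
    have hk0 : k ≠ 0 := inv_ne_zero (Real.sqrt_pos.mpr hs0).ne'
    have hks : k ^ 2 * s = 1 := by
      rw [hk, inv_pow, Real.sq_sqrt hs0.le, inv_mul_cancel₀ hs0.ne']
    have hksC : (k : ℂ) ^ 2 * (2 * (v 0 * star (v 0) + v 1 * star (v 1))) = 1 := by
      have h := congrArg (fun r : ℝ => (r : ℂ)) hks
      simp only [hs, Complex.ofReal_mul, Complex.ofReal_pow, Complex.ofReal_add,
        ← Complex.mul_conj] at h
      simpa using h
    set p : ℂ := k * (v 0 + Complex.I * star (v 1)) with hp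
    set q : ℂ := k * (v 1 - Complex.I * star (v 0)) with hq
    have hps : star p = k * (star (v 0) - Complex.I * v 1) := by
      rw [hp]
      simp [sub_eq_add_neg]
    have hqs : star q = k * (star (v 1) + Complex.I * v 0) := by
      rw [hq]
      simp
    have hpq : p * star p + q * star q = 1 := by
      rw [hps, hqs, hp, hq]
      linear_combination hksC - (k : ℂ) ^ 2 * (v 1 * star (v 1) + v 0 * star (v 0)) * Complex.I_sq
    have hmem : !![p, -star q; q, star p] ∈ Matrix.specialUnitaryGroup (Fin 2) ℂ := by
      rw [Matrix.mem_specialUnitaryGroup_iff, Matrix.mem_unitaryGroup_iff]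
      constructor
      · ext i j
        fin_cases i <;> fin_cases j <;>
          simp [Matrix.mul_apply, Fin.sum_univ_two, Matrix.star_apply] <;>
          simp only [← starRingEnd_apply] at * <;> first | linear_combination hpq | ring
      · rw [Matrix.det_fin_two_of]
        linear_combination hpq
    refine ⟨⟨_, hmem⟩, ?_⟩
    rw [gammaZero, Projectivization.smul_mk, Projectivization.mk_eq_mk_iff']
    refine ⟨2 * k, ?_⟩
    have hact : toSL ⟨_, hmem⟩ • (![1, Complex.I] : Fin 2 → ℂ)
        = !![p, -star q; q, star p].mulVec ![1, Complex.I] := rfl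
    rw [hact]
    funext j
    fin_cases j
    · simp only [Matrix.mulVec, dotProduct, Fin.sum_univ_two]
      simp only [Pi.smul_apply, smul_eq_mul, Matrix.of_apply, Fin.zero_eta, Matrix.cons_val_zero,
        Matrix.cons_val_one]
      rw [hqs, hp]
      linear_combination (k : ℂ) * v 0 * Complex.I_sq
    · simp only [Matrix.mulVec, dotProduct, Fin.sum_univ_two]
      simp only [Pi.smul_apply, smul_eq_mul, Matrix.of_apply, Fin.mk_one, Matrix.cons_val_zero,
        Matrix.cons_val_one]
      rw [hps, hq]
      linear_combination (k : ℂ) * v 1 * Complex.I_sq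

/-- `ψ ∈ L²(ℝ²)` is, up to a phase factor, the coherent state `μ(U) φ` of the orbit `γ`, where `φ`
is the coherent state of the initial orbit at energy `E = ħ (N + 1)` and `U ∈ SU(2)` maps the
initial orbit to `γ`. -/
def IsCoherentStateOf (ħ : ℝ) (N : ℕ) (γ : CP1) (ψ : L2) : Prop :=
  ∃ U : SU2, toSL U • gammaZero = γ ∧
    ∃ c : ℂ, ‖c‖ = 1 ∧ ψ = c • metaplectic ħ U (coherentState N (ħ * (N + 1)))

theorem exists_isCoherentStateOf (ħ : ℝ) (N : ℕ) (γ : CP1) :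
    ∃ ψ, IsCoherentStateOf ħ N γ ψ := by
  obtain ⟨U, hU⟩ := exists_toSL_smul_gammaZero γ
  exact ⟨_, U, hU, 1, by simp, rfl⟩

end

end OrbitalCoherent

/-! For `v ∈ ℂ²` the Hermite function `h_N(v) = (v·x - ħ v·∇)^N exp(-|x|²/2ħ)` is a homogeneous
polynomial of degree `N` in `v`. The canonical commutation relations give `⟨h_N(u), h_N(v)⟩ = C
(ū·v)^N` with `C` independent of `u` and `v`, so these functions span a copy of the symmetric power
`Sym^N ℂ²`.

This span is the whole eigenspace (`eigenspace_eq_span`). An eigenfunction `f` is orthogonal to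
every `h_M(v)` with `M ≠ N`, because the eigenvalues differ. If it is also orthogonal to all
`h_N(v)`, then all integrals of `f` against polynomials times the Gaussian vanish; summing the
exponential series kills the Fourier transform of the Gaussian times `f`, so `f = 0`.

Each factor of `μ(U)` (chirp, Fourier transform, dilation) acts linearly on positions and momenta,
and together they turn the raising operator of `v` into that of `Uv` and lowering operators into
lowering operators. Hence `μ(U)` fixes the Gaussian up to a phase, and `μ(U) h_N(v) = c h_N(Uv)`
with `|c| = 1` (`metaplectic_hermiteL2`). Phases cancel in rank one operators, so the homomorphism
property of `μ` plays no role. The initial coherent state is a multiple of `h_N` at the isotropic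
vector `(1, i)`.

Both formulas thus become one statement about unit vectors `v` of `ℂ²` distributed by a measure
(`projector_eq_integral_lineProj`): the mean of `conj(v₀^k v₁^(N-k)) v₀^l v₁^(N-l)` must be `δ_kl /
((N+1) binom(N,k))`. On `SU(2)` this follows from left invariance under diagonal phases and real
rotations (`integral_moment_haarSU2`); on the projective line from rotation of the chart and a
radial integral (`integral_chart_moment`). -/

namespace OrbitalCoherent

noncomputable section

/-! ### Oscillating and Gaussian factors on Schwartz space -/

theorem iteratedDeriv_cexp_ofReal_mul_I (n : ℕ) :
    iteratedDeriv n (fun t : ℝ => Complex.exp (t * Complex.I))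
      = fun t : ℝ => Complex.I ^ n * Complex.exp (t * Complex.I) := by
  induction n with
  | zero => simp
  | succ n ih =>
    rw [iteratedDeriv_succ, ih]
    funext t
    have h : HasDerivAt (fun t : ℝ => Complex.I ^ n * Complex.exp (t * Complex.I))
        (Complex.I ^ n * (Complex.exp (t * Complex.I) * (1 * Complex.I))) t :=
      ((Complex.ofRealCLM.hasDerivAt.mul_const Complex.I).cexp).const_mul _
    rw [h.deriv]
    ring

theorem hasTemperateGrowth_cexp_ofReal_mul_I :
    Function.HasTemperateGrowth (fun t : ℝ => Complex.exp (t * Complex.I)) := by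
  refine ⟨Complex.contDiff_exp.comp (Complex.ofRealCLM.contDiff.mul contDiff_const),
    fun n => ⟨0, 1, fun t => ?_⟩⟩
  rw [norm_iteratedFDeriv_eq_norm_iteratedDeriv, iteratedDeriv_cexp_ofReal_mul_I]
  simp [Complex.norm_exp_ofReal_mul_I]

theorem hasTemperateGrowth_chirpFun (ħ : ℝ) (Q : Matrix (Fin 2) (Fin 2) ℝ) :
    Function.HasTemperateGrowth (chirpFun ħ Q) := by
  have h : Function.HasTemperateGrowth
      (fun x : Plane => 1 / (2 * ħ) * inner ℝ x (Matrix.toEuclideanCLM (𝕜 := ℝ) Q x)) := by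
    refine (Function.HasTemperateGrowth.const _).mul ?_
    exact ContinuousLinearMap.bilinear_hasTemperateGrowth (𝕜 := ℝ) (innerSL ℝ)
      Function.HasTemperateGrowth.id' (ContinuousLinearMap.hasTemperateGrowth _)
  exact hasTemperateGrowth_cexp_ofReal_mul_I.comp h

/-- A polynomially bounded factor is absorbed by a Gaussian. -/
theorem exists_one_add_pow_mul_gaussian_le (k : ℕ) {c : ℝ} (hc : 0 < c) :
    ∃ M : ℝ, ∀ r : ℝ, 0 ≤ r → (1 + r) ^ k * Real.exp (-c * r ^ 2) ≤ M := by
  set d : ℝ := c / 2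
  have hd : 0 < d := by positivity
  refine ⟨k.factorial * Real.exp (1 / (2 * c) + 1) , fun r hr => ?_⟩
  have h1 := Real.pow_div_factorial_le_exp (x := 1 + r) (by positivity) k
  rw [div_le_iff₀ (by positivity)] at h1
  have h2 : 1 + r - c * r ^ 2 ≤ 1 / (2 * c) + 1 := by
    have : 1 / (2 * c) - r + c * r ^ 2 = (c * (r - 1 / (2 * c)) ^ 2) + 1 / (4 * c) := by
      field_simp
      ring
    have h3 : 0 ≤ (c * (r - 1 / (2 * c)) ^ 2) + 1 / (4 * c) := by positivity
    linarith
  calc (1 + r) ^ k * Real.exp (-c * r ^ 2)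
      ≤ (Real.exp (1 + r) * k.factorial) * Real.exp (-c * r ^ 2) := by gcongr
    _ = k.factorial * Real.exp (1 + r - c * r ^ 2) := by
      rw [mul_comm (Real.exp (1 + r)), mul_assoc, ← Real.exp_add]
      congr 2
      ring
    _ ≤ _ := by gcongr

/-- The Faà di Bruno bound for `exp ∘ q` with `q` quadratic leaves a factor `exp q` times a power of
`1 + ‖x‖`, which the Gaussian absorbs. -/
theorem gaussian_decay {c : ℝ} (hc : 0 < c) (k n : ℕ) :
    ∃ C : ℝ, ∀ x : Plane, ‖x‖ ^ k *
      ‖iteratedFDeriv ℝ n (fun x : Plane => ((Real.exp (-c * ‖x‖ ^ 2) : ℝ) : ℂ)) x‖ ≤ C := by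
  have hq : Function.HasTemperateGrowth (fun x : Plane => -c * ‖x‖ ^ 2) :=
    (Function.HasTemperateGrowth.const _).mul (Function.hasTemperateGrowth_norm_sq _)
  obtain ⟨m, B, hB0, hB⟩ := hq.norm_iteratedFDeriv_le_uniform n
  obtain ⟨M, hM⟩ := exists_one_add_pow_mul_gaussian_le (k + m * n) hc
  refine ⟨n.factorial * (1 + B) ^ n * M, fun x => ?_⟩
  have h1 : ‖iteratedFDeriv ℝ n (fun x : Plane => ((Real.exp (-c * ‖x‖ ^ 2) : ℝ) : ℂ)) x‖
      = ‖iteratedFDeriv ℝ n (Real.exp ∘ fun x : Plane => -c * ‖x‖ ^ 2) x‖ :=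
    Complex.ofRealLI.norm_iteratedFDeriv_comp_left (n := n) (i := n) (x := x)
      ((Real.contDiff_exp.comp (hq.1.of_le (by exact_mod_cast le_top))).contDiffAt) le_rfl
  have h2 : ‖iteratedFDeriv ℝ n (Real.exp ∘ fun x : Plane => -c * ‖x‖ ^ 2) x‖
      ≤ n.factorial * Real.exp (-c * ‖x‖ ^ 2) * ((1 + B) * (1 + ‖x‖) ^ m) ^ n := by
    refine norm_iteratedFDeriv_comp_le (N := n) Real.contDiff_exp
      (hq.1.of_le (by exact_mod_cast le_top)) le_rfl x (fun i _ => ?_) (fun i hi hin => ?_)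
    · rw [norm_iteratedFDeriv_eq_norm_iteratedDeriv, iteratedDeriv_eq_iterate,
        Real.iter_deriv_exp, Real.norm_of_nonneg (Real.exp_pos _).le]
    -- The base is enlarged from `B` to `1 + B` to be at least `1`, so that it is bounded by its own
    -- `i`-th power.
    · have h1 : (1 : ℝ) ≤ (1 + B) * (1 + ‖x‖) ^ m :=
        one_le_mul_of_one_le_of_one_le (by linarith)
          (one_le_pow₀ (by linarith [norm_nonneg x]))
      calc _ ≤ B * (1 + ‖x‖) ^ m := hB i hin x
        _ ≤ (1 + B) * (1 + ‖x‖) ^ m := by gcongr; linarith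
        _ ≤ _ := le_self_pow₀ h1 (by omega)
  rw [h1]
  calc _ ≤ (1 + ‖x‖) ^ k *
        (n.factorial * Real.exp (-c * ‖x‖ ^ 2) * ((1 + B) * (1 + ‖x‖) ^ m) ^ n) := by
        gcongr
        linarith
    _ = n.factorial * (1 + B) ^ n *
        ((1 + ‖x‖) ^ (k + m * n) * Real.exp (-c * ‖x‖ ^ 2)) := by
        rw [mul_pow, ← pow_mul, pow_add]
        ring
    _ ≤ _ := by
        gcongr
        exact hM _ (norm_nonneg x)

/-- The Gaussian `exp (-|x|² / 2ħ)` as a Schwartz function. -/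
def ground {ħ : ℝ} (hħ : 0 < ħ) : 𝓢(Plane, ℂ) where
  toFun x := ((Real.exp (-(1 / (2 * ħ)) * ‖x‖ ^ 2) : ℝ) : ℂ)
  smooth' := by
    refine Complex.ofRealCLM.contDiff.comp (Real.contDiff_exp.comp ?_)
    exact contDiff_const.mul (contDiff_norm_sq ℝ)
  decay' k n := gaussian_decay (by positivity) k n

theorem ground_apply {ħ : ℝ} (hħ : 0 < ħ) (x : Plane) :
    ground hħ x = ((Real.exp (-(1 / (2 * ħ)) * ‖x‖ ^ 2) : ℝ) : ℂ) := rfl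

/-! ### First order operators with affine symbols -/

/-- The linear form `x ↦ a · x` with complex coefficients. -/
def linForm (a : Fin 2 → ℂ) : Plane →L[ℝ] ℂ :=
  a 0 • (Complex.ofRealCLM ∘L EuclideanSpace.proj (0 : Fin 2))
    + a 1 • (Complex.ofRealCLM ∘L EuclideanSpace.proj (1 : Fin 2))

theorem linForm_apply (a : Fin 2 → ℂ) (x : Plane) :
    linForm a x = a 0 * (x 0 : ℂ) + a 1 * (x 1 : ℂ) := by
  simp [linForm]

theorem hasTemperateGrowth_linForm (a : Fin 2 → ℂ) : Function.HasTemperateGrowth (linForm a) :=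
  (linForm a).hasTemperateGrowth

open LineDeriv in
/-- The first order operator `f ↦ (a · x) f + b · ∇f` on Schwartz functions. -/
def phaseOp (a b : Fin 2 → ℂ) : 𝓢(Plane, ℂ) →L[ℂ] 𝓢(Plane, ℂ) :=
  SchwartzMap.smulLeftCLM ℂ (linForm a)
    + (b 0 • lineDerivOpCLM ℂ 𝓢(Plane, ℂ) (EuclideanSpace.single (0 : Fin 2) (1 : ℝ))
      + b 1 • lineDerivOpCLM ℂ 𝓢(Plane, ℂ) (EuclideanSpace.single (1 : Fin 2) (1 : ℝ)))

/-- The complexified directional derivative `b · ∇f (x)`. -/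
def gradForm (b : Fin 2 → ℂ) (f : Plane → ℂ) (x : Plane) : ℂ :=
  b 0 * fderiv ℝ f x (EuclideanSpace.single (0 : Fin 2) (1 : ℝ))
    + b 1 * fderiv ℝ f x (EuclideanSpace.single (1 : Fin 2) (1 : ℝ))

theorem phaseOp_apply (a b : Fin 2 → ℂ) (f : 𝓢(Plane, ℂ)) (x : Plane) :
    phaseOp a b f x = linForm a x * f x + gradForm b f x := by
  simp only [phaseOp, gradForm, _root_.add_apply, _root_.smul_apply,
    LineDeriv.lineDerivOpCLM_apply, smul_eq_mul, SchwartzMap.lineDerivOp_apply_eq_fderiv]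
  rw [SchwartzMap.smulLeftCLM_apply_apply (hasTemperateGrowth_linForm a), smul_eq_mul]

end

end OrbitalCoherent

namespace OrbitalCoherent

noncomputable section

theorem linForm_zero : linForm 0 = 0 := by
  ext x
  simp [linForm_apply]

theorem gradForm_zero (f : Plane → ℂ) (x : Plane) : gradForm 0 f x = 0 := by
  simp [gradForm]

theorem gradForm_linForm (b a : Fin 2 → ℂ) (x : Plane) :
    gradForm b (linForm a) x = b ⬝ᵥ a := by
  simp [gradForm, linForm_apply, dotProduct, Fin.sum_univ_two]

theorem gradForm_mul (b : Fin 2 → ℂ) {f g : Plane → ℂ} {x : Plane}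
    (hf : DifferentiableAt ℝ f x) (hg : DifferentiableAt ℝ g x) :
    gradForm b (fun y => f y * g y) x = f x * gradForm b g x + gradForm b f x * g x := by
  have h : fderiv ℝ (fun y => f y * g y) x = f x • fderiv ℝ g x + g x • fderiv ℝ f x :=
    fderiv_fun_mul hf hg
  simp only [gradForm, h, _root_.add_apply, _root_.smul_apply, smul_eq_mul]
  ring

theorem phaseOp_zero_right_apply (a : Fin 2 → ℂ) (f : 𝓢(Plane, ℂ)) (x : Plane) :
    phaseOp a 0 f x = linForm a x * f x := by
  rw [phaseOp_apply, gradForm_zero, add_zero]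

theorem phaseOp_zero_left_apply (b : Fin 2 → ℂ) (f : 𝓢(Plane, ℂ)) (x : Plane) :
    phaseOp 0 b f x = gradForm b f x := by
  rw [phaseOp_apply, linForm_zero]
  simp

theorem phaseOp_add (a b a' b' : Fin 2 → ℂ) :
    phaseOp (a + a') (b + b') = phaseOp a b + phaseOp a' b' := by
  ext f x
  simp only [phaseOp_apply, linForm_apply, gradForm, Pi.add_apply, _root_.add_apply]
  ring

theorem phaseOp_smul (c : ℂ) (a b : Fin 2 → ℂ) :
    phaseOp (c • a) (c • b) = c • phaseOp a b := by
  ext f x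
  simp only [phaseOp_apply, linForm_apply, gradForm, Pi.smul_apply, _root_.smul_apply,
    smul_eq_mul]
  ring

theorem phaseOp_eq_add (a b : Fin 2 → ℂ) : phaseOp a b = phaseOp a 0 + phaseOp 0 b := by
  rw [← phaseOp_add, add_zero, zero_add]

theorem lineDerivOp_comm (a b : Plane) (f : 𝓢(Plane, ℂ)) :
    LineDeriv.lineDerivOp a (LineDeriv.lineDerivOp b f)
      = LineDeriv.lineDerivOp b (LineDeriv.lineDerivOp a f) := by
  ext x
  have key (m n : Plane) : LineDeriv.lineDerivOp m (LineDeriv.lineDerivOp n f) x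
      = fderiv ℝ (fderiv ℝ f) x m n := by
    rw [SchwartzMap.lineDerivOp_apply_eq_fderiv]
    have h : (LineDeriv.lineDerivOp n f : Plane → ℂ) = fun y => fderiv ℝ f y n :=
      funext fun y => SchwartzMap.lineDerivOp_apply_eq_fderiv n f y
    have hd : DifferentiableAt ℝ (fderiv ℝ f) x :=
      ((f.smooth 2).fderiv_right (m := 1) (by norm_num)).differentiable one_ne_zero x
    rw [h, fderiv_clm_apply hd (differentiableAt_const n)]
    simp
  rw [key, key]
  exact ((f.smooth 2).contDiffAt.isSymmSndFDerivAt (by simp)) a b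

theorem phaseOp_zero_left_comm (b d : Fin 2 → ℂ) (f : 𝓢(Plane, ℂ)) :
    phaseOp 0 b (phaseOp 0 d f) = phaseOp 0 d (phaseOp 0 b f) := by
  have h (b : Fin 2 → ℂ) (f : 𝓢(Plane, ℂ)) : phaseOp 0 b f
      = b 0 • LineDeriv.lineDerivOp (EuclideanSpace.single (0 : Fin 2) (1 : ℝ)) f
        + b 1 • LineDeriv.lineDerivOp (EuclideanSpace.single (1 : Fin 2) (1 : ℝ)) f := by
    ext x
    simp [phaseOp_zero_left_apply, gradForm, SchwartzMap.lineDerivOp_apply_eq_fderiv]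
  simp only [h, LineDeriv.lineDerivOp_add, LineDeriv.lineDerivOp_smul]
  rw [lineDerivOp_comm (EuclideanSpace.single (0 : Fin 2) (1 : ℝ))
    (EuclideanSpace.single (1 : Fin 2) (1 : ℝ)) f]
  module

theorem phaseOp_zero_right_comm (a c : Fin 2 → ℂ) (f : 𝓢(Plane, ℂ)) :
    phaseOp a 0 (phaseOp c 0 f) = phaseOp c 0 (phaseOp a 0 f) := by
  ext x
  simp only [phaseOp_zero_right_apply]
  ring

theorem phaseOp_leibniz (b c : Fin 2 → ℂ) (f : 𝓢(Plane, ℂ)) :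
    phaseOp 0 b (phaseOp c 0 f) = phaseOp c 0 (phaseOp 0 b f) + (b ⬝ᵥ c) • f := by
  ext x
  have h : (phaseOp c 0 f : Plane → ℂ) = fun y => linForm c y * f y :=
    funext fun y => phaseOp_zero_right_apply c f y
  rw [phaseOp_zero_left_apply, h, gradForm_mul b (linForm c).differentiableAt f.differentiableAt,
    gradForm_linForm, _root_.add_apply, phaseOp_zero_right_apply, phaseOp_zero_left_apply,
    _root_.smul_apply, smul_eq_mul]

/-- The canonical commutation relations. -/
theorem phaseOp_comm (a b c d : Fin 2 → ℂ) (f : 𝓢(Plane, ℂ)) :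
    phaseOp a b (phaseOp c d f) = phaseOp c d (phaseOp a b f) + (b ⬝ᵥ c - a ⬝ᵥ d) • f := by
  rw [phaseOp_eq_add a b, phaseOp_eq_add c d]
  simp only [_root_.add_apply, map_add]
  rw [phaseOp_leibniz b c, phaseOp_leibniz d a, phaseOp_zero_left_comm b d,
    phaseOp_zero_right_comm a c, dotProduct_comm d a]
  module

open SchwartzMap in
theorem integrable_mul_schwartz (f g : 𝓢(Plane, ℂ)) :
    Integrable (fun x => f x * g x) (volume : Measure Plane) := by
  have h : (fun x => f x * g x) = smulLeftCLM ℂ f g := by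
    funext x
    rw [smulLeftCLM_apply_apply f.hasTemperateGrowth, smul_eq_mul]
  rw [h]
  exact SchwartzMap.integrable _

/-- Integration by parts for first order operators. -/
theorem integral_phaseOp_mul (a b : Fin 2 → ℂ) (f g : 𝓢(Plane, ℂ)) :
    ∫ x, phaseOp a b f x * g x = ∫ x, f x * phaseOp a (-b) g x := by
  have key (m : Plane) : ∫ x, fderiv ℝ f x m * g x = - ∫ x, f x * fderiv ℝ g x m := by
    have := SchwartzMap.integral_mul_lineDerivOp_right_eq_neg_left (μ := volume) f g m
    simp only [SchwartzMap.lineDerivOp_apply_eq_fderiv] at this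
    rw [this, neg_neg]
  have i1 (f g : 𝓢(Plane, ℂ)) (m : Plane) : Integrable (fun x => fderiv ℝ f x m * g x) := by
    simpa only [SchwartzMap.lineDerivOp_apply_eq_fderiv] using
      integrable_mul_schwartz (LineDeriv.lineDerivOp m f) g
  have i2 (m : Plane) : Integrable (fun x => f x * fderiv ℝ g x m) := by
    simpa only [mul_comm] using i1 g f m
  have i3 : Integrable (fun x => linForm a x * f x * g x) := by
    simpa only [phaseOp_zero_right_apply] using integrable_mul_schwartz (phaseOp a 0 f) g
  have e1 : ∫ x, phaseOp a b f x * g x = (∫ x, linForm a x * f x * g x)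
      + (b 0 * ∫ x, fderiv ℝ f x (EuclideanSpace.single (0 : Fin 2) (1 : ℝ)) * g x)
      + (b 1 * ∫ x, fderiv ℝ f x (EuclideanSpace.single (1 : Fin 2) (1 : ℝ)) * g x) := by
    rw [← integral_const_mul, ← integral_const_mul, ← integral_add i3 ((i1 f g _).const_mul _),
      ← integral_add (i3.fun_add ((i1 f g _).const_mul _)) ((i1 f g _).const_mul _)]
    congr 1
    funext x
    rw [phaseOp_apply, gradForm]
    ring
  have e2 : ∫ x, f x * phaseOp a (-b) g x = (∫ x, linForm a x * f x * g x)
      + (-b 0 * ∫ x, f x * fderiv ℝ g x (EuclideanSpace.single (0 : Fin 2) (1 : ℝ)))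
      + (-b 1 * ∫ x, f x * fderiv ℝ g x (EuclideanSpace.single (1 : Fin 2) (1 : ℝ))) := by
    rw [← integral_const_mul, ← integral_const_mul, ← integral_add i3 ((i2 _).const_mul _),
      ← integral_add (i3.fun_add ((i2 _).const_mul _)) ((i2 _).const_mul _)]
    congr 1
    funext x
    rw [phaseOp_apply, gradForm]
    simp only [Pi.neg_apply]
    ring
  rw [e1, e2, key, key]
  ring

/-! ### Ladder operators and Hermite functions -/

/-- The creation operator `v · x - ħ v · ∇`. -/
def raise (ħ : ℝ) (v : Fin 2 → ℂ) : 𝓢(Plane, ℂ) →L[ℂ] 𝓢(Plane, ℂ) := phaseOp v (-((ħ : ℂ) • v))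

/-- The annihilation operator `v · x + ħ v · ∇`. -/
def lower (ħ : ℝ) (v : Fin 2 → ℂ) : 𝓢(Plane, ℂ) →L[ℂ] 𝓢(Plane, ℂ) := phaseOp v ((ħ : ℂ) • v)

theorem lower_raise (ħ : ℝ) (u v : Fin 2 → ℂ) (f : 𝓢(Plane, ℂ)) :
    lower ħ u (raise ħ v f) = raise ħ v (lower ħ u f) + (2 * ħ * (u ⬝ᵥ v)) • f := by
  rw [lower, raise, phaseOp_comm]
  congr 2
  simp
  ring

theorem raise_comm (ħ : ℝ) (u v : Fin 2 → ℂ) (f : 𝓢(Plane, ℂ)) :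
    raise ħ u (raise ħ v f) = raise ħ v (raise ħ u f) := by
  rw [raise, raise, phaseOp_comm]
  simp

theorem raise_add (ħ : ℝ) (u v : Fin 2 → ℂ) : raise ħ (u + v) = raise ħ u + raise ħ v := by
  rw [raise, smul_add, neg_add, phaseOp_add]
  rfl

theorem raise_smul (ħ : ℝ) (c : ℂ) (v : Fin 2 → ℂ) : raise ħ (c • v) = c • raise ħ v := by
  rw [raise, smul_comm, ← smul_neg, phaseOp_smul]
  rfl

variable {ħ : ℝ} (hħ : 0 < ħ)

theorem gradForm_ground (b : Fin 2 → ℂ) (x : Plane) :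
    gradForm b (ground hħ) x = -(1 / ħ) * linForm b x * ground hħ x := by
  have h : HasFDerivAt (ground hħ : Plane → ℂ)
      (Complex.ofRealCLM ∘L (Real.exp (-(1 / (2 * ħ)) * ‖x‖ ^ 2) •
        ((-(1 / (2 * ħ))) • (2 • (innerSL ℝ x))))) x :=
    Complex.ofRealCLM.hasFDerivAt.comp x
      (((hasStrictFDerivAt_norm_sq x).hasFDerivAt.const_mul (-(1 / (2 * ħ)))).exp)
  rw [gradForm, h.fderiv, linForm_apply, ground_apply]
  simp [innerSL_apply_apply, EuclideanSpace.inner_single_right]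
  have : (ħ : ℂ) ≠ 0 := by exact_mod_cast hħ.ne'
  field_simp
  ring

theorem lower_ground (v : Fin 2 → ℂ) : lower ħ v (ground hħ) = 0 := by
  have : (ħ : ℂ) ≠ 0 := by exact_mod_cast hħ.ne'
  ext x
  rw [lower, phaseOp_apply, gradForm_ground, linForm_apply, linForm_apply]
  simp
  field_simp
  ring

/-- The function `(v · x - ħ v · ∇)^N exp (-|x|² / 2ħ)`. -/
def hermite (N : ℕ) (v : Fin 2 → ℂ) : 𝓢(Plane, ℂ) := (raise ħ v ^ N) (ground hħ)

theorem hermite_zero (v : Fin 2 → ℂ) : hermite hħ 0 v = ground hħ := by simp [hermite]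

theorem hermite_succ (N : ℕ) (v : Fin 2 → ℂ) :
    hermite hħ (N + 1) v = raise ħ v (hermite hħ N v) := by
  rw [hermite, pow_succ']
  rfl

theorem hermite_smul (N : ℕ) (c : ℂ) (v : Fin 2 → ℂ) :
    hermite hħ N (c • v) = c ^ N • hermite hħ N v := by
  rw [hermite, raise_smul, smul_pow]
  rfl

/-- Moving the lowering operator past each of the `N + 1` raising operators costs the scalar
commutator `2ħ (u·v)`; what remains annihilates the Gaussian. -/
theorem lower_hermite_succ (N : ℕ) (u v : Fin 2 → ℂ) :
    lower ħ u (hermite hħ (N + 1) v) = (2 * ħ * (u ⬝ᵥ v) * (N + 1)) • hermite hħ N v := by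
  induction N with
  | zero => rw [hermite_succ, lower_raise, hermite_zero, lower_ground]; simp
  | succ N ih =>
    rw [hermite_succ, lower_raise, ih, map_smul, ← hermite_succ, ← add_smul]
    congr 1
    push_cast
    ring

/-- For the bilinear pairing, without conjugation, `raise ħ u` and `lower ħ u` are transposes of
each other, so the raising operators on the left are moved one by one to the right. -/
theorem integral_hermite_mul_hermite (N : ℕ) (u v : Fin 2 → ℂ) :
    ∫ x, hermite hħ N u x * hermite hħ N v x
      = (2 * ħ) ^ N * N.factorial * (u ⬝ᵥ v) ^ N * ∫ x, ground hħ x * ground hħ x := by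
  induction N with
  | zero => simp [hermite_zero]
  | succ N ih =>
    have h := integral_phaseOp_mul u (-((ħ : ℂ) • u)) (hermite hħ N u) (hermite hħ (N + 1) v)
    rw [neg_neg] at h
    change ∫ x, raise ħ u (hermite hħ N u) x * hermite hħ (N + 1) v x
      = ∫ x, hermite hħ N u x * lower ħ u (hermite hħ (N + 1) v) x at h
    rw [hermite_succ, h, lower_hermite_succ]
    simp only [_root_.smul_apply, smul_eq_mul, mul_left_comm (hermite hħ N u _)]
    rw [integral_const_mul, ih, Nat.factorial_succ]
    push_cast
    ring

theorem integral_ground_mul_ground :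
    ∫ x, ground hħ x * ground hħ x = (Real.pi * ħ : ℂ) := by
  have h := GaussianFourier.integral_cexp_neg_mul_sq_norm_add (V := Plane) (b := ((1 / ħ : ℝ) : ℂ))
    (by simpa using hħ) 0 0
  have hh : (ħ : ℂ) ≠ 0 := by exact_mod_cast hħ.ne'
  convert h using 1
  · congr 1
    funext x
    rw [ground_apply, ← Complex.ofReal_mul, ← Real.exp_add, Complex.ofReal_exp]
    congr 1
    simp
    field_simp
    ring
  · simp

/-- Complex conjugation of the Hermite functions. -/
theorem star_hermite (N : ℕ) (v : Fin 2 → ℂ) (x : Plane) :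
    star (hermite hħ N v x) = hermite hħ N (star v) x := by
  -- The point must vary: the induction step differentiates the conjugation identity.
  induction N generalizing x with
  | zero =>
    simp only [hermite_zero, ground_apply]
    exact Complex.conj_ofReal _
  | succ N ih =>
    have h (m : Plane) : fderiv ℝ (hermite hħ N (star v)) x m
        = star (fderiv ℝ (hermite hħ N v) x m) := by
      have : (hermite hħ N (star v) : Plane → ℂ) = fun y => Complex.conjCLE (hermite hħ N v y) :=
        funext fun y => (ih y).symm
      rw [this]
      have h2 := (Complex.conjCLE.hasFDerivAt.comp x
        (hermite hħ N v).differentiableAt.hasFDerivAt).fderiv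
      change fderiv ℝ (fun y => Complex.conjCLE (hermite hħ N v y)) x = _ at h2
      rw [h2]
      rfl
    rw [hermite_succ, hermite_succ, raise, raise, phaseOp_apply, phaseOp_apply, ← ih, gradForm,
      gradForm, h, h, linForm_apply, linForm_apply]
    simp

/-- The functions `(x₁ - ħ ∂₁)^k (x₂ - ħ ∂₂)^(N - k) exp (-|x|² / 2ħ)`. -/
def hermiteBasis (N k : ℕ) : 𝓢(Plane, ℂ) :=
  (raise ħ ![1, 0] ^ k) ((raise ħ ![0, 1] ^ (N - k)) (ground hħ))

/-- Raising operators commute, so the binomial theorem applies. The formula makes the dependence on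
`v` polynomial, which later yields continuity in `v`, finite dimension of the span, and the matrix
coefficients `moment`. -/
theorem hermite_eq_sum (N : ℕ) (v : Fin 2 → ℂ) :
    hermite hħ N v = ∑ k ∈ Finset.range (N + 1),
      (v 0 ^ k * v 1 ^ (N - k) * (N.choose k : ℂ)) • hermiteBasis hħ N k := by
  have hv : v = v 0 • ![1, 0] + v 1 • ![0, 1] := by
    funext j
    fin_cases j <;> simp
  have hc : Commute (v 0 • raise ħ ![1, 0]) (v 1 • raise ħ ![0, 1]) := by
    refine (Commute.smul_left ?_ _).smul_right _
    ext1 f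
    exact raise_comm ħ _ _ f
  rw [hermite]
  conv_lhs => rw [hv]
  rw [raise_add, raise_smul, raise_smul, hc.add_pow]
  rw [_root_.sum_apply]
  refine Finset.sum_congr rfl fun k _ => ?_
  rw [smul_pow, smul_pow, hermiteBasis, smul_mul_smul_comm, ← nsmul_eq_mul',
    ← Nat.cast_smul_eq_nsmul ℂ, smul_smul, mul_comm]
  rfl

/-- For an isotropic direction the Hermite function is a power times the Gaussian. -/
theorem hermite_isotropic (N : ℕ) (v : Fin 2 → ℂ) (hv : v ⬝ᵥ v = 0) (x : Plane) :
    hermite hħ N v x = (2 * linForm v x) ^ N * ground hħ x := by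
  have hh : (ħ : ℂ) ≠ 0 := by exact_mod_cast hħ.ne'
  induction N generalizing x with
  | zero => simp [hermite_zero]
  | succ N ih =>
    have hf : (hermite hħ N v : Plane → ℂ) = fun y => (2 * linForm v y) ^ N * ground hħ y :=
      funext ih
    have hl : DifferentiableAt ℝ (fun y => (2 * linForm v y)) x :=
      (linForm v).differentiableAt.const_mul 2
    -- Since `v·∇(v·x) = v·v = 0`, the derivative along `v` sees only the Gaussian and returns a
    -- second copy of `v·x`; hence the factor `2`.
    have hp : gradForm v (fun y => (2 * linForm v y) ^ N) x = 0 := by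
      have h1 : fderiv ℝ (fun y => (2 * linForm v y) ^ N) x
          = (N • (2 * linForm v x) ^ (N - 1)) • ((2 : ℂ) • (linForm v : Plane →L[ℝ] ℂ)) :=
        (((linForm v).hasFDerivAt (x := x)).const_mul (2 : ℂ) |>.pow N).fderiv
      have h2 : gradForm v (linForm v) x = 0 := by rw [gradForm_linForm, hv]
      simp only [gradForm, ContinuousLinearMap.fderiv] at h2
      simp only [gradForm, h1, _root_.smul_apply, smul_eq_mul]
      linear_combination ((N • (2 * linForm v x) ^ (N - 1)) * 2) * h2
    have hs : gradForm (-((ħ : ℂ) • v)) (hermite hħ N v) x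
        = -ħ * gradForm v (hermite hħ N v) x := by
      simp only [gradForm, Pi.neg_apply, Pi.smul_apply, smul_eq_mul]
      ring
    rw [hermite_succ, raise, phaseOp_apply, hs, hf,
      gradForm_mul v (hl.fun_pow N) (ground hħ).differentiableAt, hp, gradForm_ground]
    field_simp
    ring

end

end OrbitalCoherent

namespace OrbitalCoherent

noncomputable section

/-! ### The eigenspace of the oscillator -/

/-- The number operator `½ ∑ᵢ (xᵢ - ħ ∂ᵢ) (xᵢ + ħ ∂ᵢ)`. -/
def numberOp (ħ : ℝ) : 𝓢(Plane, ℂ) →L[ℂ] 𝓢(Plane, ℂ) :=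
  (1 / 2 : ℂ) • (raise ħ ![1, 0] ∘L lower ħ ![1, 0] + raise ħ ![0, 1] ∘L lower ħ ![0, 1])

theorem numberOp_apply (ħ : ℝ) (ψ : 𝓢(Plane, ℂ)) :
    numberOp ħ ψ = (1 / 2 : ℂ) • (raise ħ ![1, 0] (lower ħ ![1, 0] ψ)
      + raise ħ ![0, 1] (lower ħ ![0, 1] ψ)) := rfl

theorem raise_lower_self (ħ : ℝ) (v : Fin 2 → ℂ) (ψ : 𝓢(Plane, ℂ)) :
    raise ħ v (lower ħ v ψ) = phaseOp v 0 (phaseOp v 0 ψ)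
      - (ħ : ℂ) ^ 2 • phaseOp 0 v (phaseOp 0 v ψ) - ((ħ : ℂ) * (v ⬝ᵥ v)) • ψ := by
  have h1 : phaseOp 0 ((ħ : ℂ) • v) = (ħ : ℂ) • phaseOp 0 v := by
    rw [← phaseOp_smul, smul_zero]
  have h2 : phaseOp 0 (-((ħ : ℂ) • v)) = (-(ħ : ℂ)) • phaseOp 0 v := by
    rw [← phaseOp_smul, smul_zero, neg_smul]
  rw [raise, lower, phaseOp_eq_add v ((ħ : ℂ) • v), phaseOp_eq_add v (-((ħ : ℂ) • v)), h1, h2]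
  simp only [_root_.add_apply, _root_.smul_apply, map_add, map_smul]
  rw [phaseOp_leibniz]
  module

theorem laplacian_eq_phaseOp (ψ : 𝓢(Plane, ℂ)) :
    Δ ψ = phaseOp 0 ![1, 0] (phaseOp 0 ![1, 0] ψ) + phaseOp 0 ![0, 1] (phaseOp 0 ![0, 1] ψ) := by
  have h0 (f : 𝓢(Plane, ℂ)) : phaseOp 0 ![1, 0] f
      = LineDeriv.lineDerivOp (EuclideanSpace.single (0 : Fin 2) (1 : ℝ)) f := by
    ext x
    simp [phaseOp_zero_left_apply, gradForm, SchwartzMap.lineDerivOp_apply_eq_fderiv]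
  have h1 (f : 𝓢(Plane, ℂ)) : phaseOp 0 ![0, 1] f
      = LineDeriv.lineDerivOp (EuclideanSpace.single (1 : Fin 2) (1 : ℝ)) f := by
    ext x
    simp [phaseOp_zero_left_apply, gradForm, SchwartzMap.lineDerivOp_apply_eq_fderiv]
  rw [SchwartzMap.laplacian_eq_sum (EuclideanSpace.basisFun (Fin 2) ℝ), Fin.sum_univ_two]
  simp only [h0, h1, EuclideanSpace.basisFun_apply]

theorem hasTemperateGrowth_half_norm_sq :
    Function.HasTemperateGrowth (fun x : Plane => ((‖x‖ ^ 2 / 2 : ℝ) : ℂ)) := by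
  have h : Function.HasTemperateGrowth (fun x : Plane => (1 / 2 : ℝ) * ‖x‖ ^ 2) :=
    (Function.HasTemperateGrowth.const _).mul (Function.hasTemperateGrowth_norm_sq _)
  have h2 := Function.HasTemperateGrowth.comp Complex.ofRealCLM.hasTemperateGrowth h
  have h3 : (fun x : Plane => ((‖x‖ ^ 2 / 2 : ℝ) : ℂ))
      = Complex.ofRealCLM ∘ fun x : Plane => (1 / 2 : ℝ) * ‖x‖ ^ 2 := by
    funext x
    rw [Function.comp_apply, Complex.ofRealCLM_apply, div_eq_inv_mul, one_div]
  rwa [h3]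

theorem half_norm_sq_smul (ψ : 𝓢(Plane, ℂ)) :
    SchwartzMap.smulLeftCLM ℂ (fun x : Plane => ((‖x‖ ^ 2 / 2 : ℝ) : ℂ)) ψ
      = (1 / 2 : ℂ) • (phaseOp ![1, 0] 0 (phaseOp ![1, 0] 0 ψ)
        + phaseOp ![0, 1] 0 (phaseOp ![0, 1] 0 ψ)) := by
  ext x
  rw [SchwartzMap.smulLeftCLM_apply_apply hasTemperateGrowth_half_norm_sq]
  simp only [_root_.smul_apply, _root_.add_apply, phaseOp_zero_right_apply, linForm_apply,
    smul_eq_mul, EuclideanSpace.real_norm_sq_eq, Fin.sum_univ_two]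
  push_cast
  simp
  ring

/-- The oscillator is its own transpose, so it moves onto the test function. Its factorization into
ladder operators leaves the zero point energy `ħ/2` for each of the two dimensions. -/
theorem oscillator_apply_apply (ħ : ℝ) (T : 𝓢'(Plane, ℂ)) (ψ : 𝓢(Plane, ℂ)) :
    oscillator ħ T ψ = T (numberOp ħ ψ + (ħ : ℂ) • ψ) := by
  have h : numberOp ħ ψ + (ħ : ℂ) • ψ = ((-(ħ ^ 2 / 2) : ℝ) : ℂ) • Δ ψ
      + SchwartzMap.smulLeftCLM ℂ (fun x : Plane => ((‖x‖ ^ 2 / 2 : ℝ) : ℂ)) ψ := by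
    rw [half_norm_sq_smul, laplacian_eq_phaseOp, numberOp_apply, raise_lower_self,
      raise_lower_self]
    simp only [Matrix.cons_dotProduct_cons, Matrix.dotProduct_of_isEmpty]
    push_cast
    module
  rw [h, map_add, map_smul, ← TemperedDistribution.laplacian_apply_apply]
  simp only [oscillator, _root_.add_apply, _root_.smul_apply,
    TemperedDistribution.laplacianCLM_apply, TemperedDistribution.smulLeftCLM_apply_apply]

/-- The zero point energy cancels the `+1` in `ħ(N + 1)`, leaving a weak eigenvalue equation for the
number operator. -/
theorem mem_eigenspace_iff_integral (ħ : ℝ) (N : ℕ) (f : L2) :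
    f ∈ eigenspace ħ N ↔ ∀ ψ : 𝓢(Plane, ℂ),
      ∫ x, numberOp ħ ψ x * f x = (ħ * N : ℂ) * ∫ x, ψ x * f x := by
  have h1 (ψ : 𝓢(Plane, ℂ)) : (f : 𝓢'(Plane, ℂ)) ψ = ∫ x, ψ x * f x :=
    Lp.toTemperedDistribution_apply f ψ
  have h2 : f ∈ eigenspace ħ N ↔ ∀ ψ : 𝓢(Plane, ℂ),
      oscillator ħ (f : 𝓢'(Plane, ℂ)) ψ = ((ħ * (N + 1) : ℝ) : ℂ) * (f : 𝓢'(Plane, ℂ)) ψ := by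
    rw [eigenspace, LinearMap.mem_ker]
    simp only [ContinuousLinearMap.coe_coe, ContinuousLinearMap.comp_apply, _root_.sub_apply,
      sub_eq_zero]
    rw [DFunLike.ext_iff]
    rfl
  rw [h2]
  refine forall_congr' fun ψ => ?_
  rw [oscillator_apply_apply, map_add, map_smul, h1, h1, smul_eq_mul]
  push_cast
  constructor <;> intro h <;> linear_combination h

section

variable {ħ : ℝ} (hħ : 0 < ħ)

theorem numberOp_hermite (N : ℕ) (v : Fin 2 → ℂ) :
    numberOp ħ (hermite hħ N v) = (ħ * N : ℂ) • hermite hħ N v := by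
  cases N with
  | zero => simp [numberOp_apply, hermite_zero, lower_ground]
  | succ N =>
    have hv : v = v 0 • ![1, 0] + v 1 • ![0, 1] := by
      funext j
      fin_cases j <;> simp
    rw [numberOp_apply, lower_hermite_succ, lower_hermite_succ, map_smul, map_smul,
      hermite_succ]
    -- Lowering along `eᵢ` produces the factor `vᵢ`, and `∑ vᵢ raise(eᵢ)` reassembles to `raise(v)`.
    conv_rhs => rw [hv, raise_add, raise_smul, raise_smul, ← hv]
    simp only [dotProduct, Fin.sum_univ_two, Matrix.cons_val_zero, Matrix.cons_val_one,
      _root_.add_apply, _root_.smul_apply]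
    push_cast
    module

theorem integral_numberOp_mul (f g : 𝓢(Plane, ℂ)) :
    ∫ x, numberOp ħ f x * g x = ∫ x, f x * numberOp ħ g x := by
  have key (v : Fin 2 → ℂ) : ∫ x, raise ħ v (lower ħ v f) x * g x
      = ∫ x, f x * raise ħ v (lower ħ v g) x := by
    have h1 := integral_phaseOp_mul v (-((ħ : ℂ) • v)) (lower ħ v f) g
    have h2 := integral_phaseOp_mul v ((ħ : ℂ) • v) f (lower ħ v g)
    rw [neg_neg] at h1
    exact h1.trans h2
  have e1 : ∫ x, numberOp ħ f x * g x = (1 / 2 : ℂ) *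
      ((∫ x, raise ħ ![1, 0] (lower ħ ![1, 0] f) x * g x)
        + ∫ x, raise ħ ![0, 1] (lower ħ ![0, 1] f) x * g x) := by
    rw [← integral_add (integrable_mul_schwartz _ _) (integrable_mul_schwartz _ _),
      ← integral_const_mul]
    congr 1
    funext x
    simp only [numberOp_apply, _root_.smul_apply, _root_.add_apply, smul_eq_mul]
    ring
  have e2 : ∫ x, f x * numberOp ħ g x = (1 / 2 : ℂ) *
      ((∫ x, f x * raise ħ ![1, 0] (lower ħ ![1, 0] g) x)
        + ∫ x, f x * raise ħ ![0, 1] (lower ħ ![0, 1] g) x) := by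
    rw [← integral_add (integrable_mul_schwartz _ _) (integrable_mul_schwartz _ _),
      ← integral_const_mul]
    congr 1
    funext x
    simp only [numberOp_apply, _root_.smul_apply, _root_.add_apply, smul_eq_mul]
    ring
  rw [e1, e2, key, key]

/-- The Hermite function as an element of `L²(ℝ²)`. -/
def hermiteL2 (N : ℕ) (v : Fin 2 → ℂ) : L2 := (hermite hħ N v).toLp 2

theorem integral_mul_toLp (ψ g : 𝓢(Plane, ℂ)) :
    ∫ x, ψ x * (g.toLp 2 : L2) x = ∫ x, ψ x * g x := by
  refine integral_congr_ae ?_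
  filter_upwards [g.coeFn_toLp 2 volume] with x hx
  rw [hx]

theorem hermiteL2_mem_eigenspace (N : ℕ) (v : Fin 2 → ℂ) :
    hermiteL2 hħ N v ∈ eigenspace ħ N := by
  rw [mem_eigenspace_iff_integral]
  intro ψ
  rw [hermiteL2, integral_mul_toLp, integral_mul_toLp, integral_numberOp_mul, numberOp_hermite,
    ← integral_const_mul]
  congr 1
  funext x
  rw [_root_.smul_apply, smul_eq_mul]
  ring

theorem inner_hermiteL2 (N : ℕ) (v : Fin 2 → ℂ) (f : L2) :
    inner ℂ (hermiteL2 hħ N v) f = ∫ x, hermite hħ N (star v) x * f x := by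
  rw [L2.inner_def]
  refine integral_congr_ae ?_
  filter_upwards [(hermite hħ N v).coeFn_toLp 2 volume] with x hx
  rw [hermiteL2, hx, ← star_hermite, RCLike.inner_apply, mul_comm]
  rfl

/-- Hermite functions of another degree are annihilated by an eigenfunction. -/
theorem integral_hermite_mul_eq_zero {M N : ℕ} (hMN : M ≠ N) (v : Fin 2 → ℂ) {f : L2}
    (hf : f ∈ eigenspace ħ N) : ∫ x, hermite hħ M v x * f x = 0 := by
  have h := (mem_eigenspace_iff_integral ħ N f).mp hf (hermite hħ M v)
  rw [numberOp_hermite] at h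
  simp only [_root_.smul_apply, smul_eq_mul, mul_assoc] at h
  simp only [integral_const_mul] at h
  have h1 : ((ħ : ℂ) * (M - N)) * ∫ x, hermite hħ M v x * f x = 0 := by
    linear_combination h
  refine (mul_eq_zero.mp h1).resolve_left (mul_ne_zero (by exact_mod_cast hħ.ne') ?_)
  rw [sub_ne_zero]
  exact_mod_cast hMN

/-! ### Completeness of the Hermite functions -/

/-- Multiplication by `v·x` is half the sum of `raise ħ v` and `lower ħ v`, and both preserve the
span of the Hermite functions in the direction `v`. -/
theorem phaseOp_pow_ground_mem_span (v : Fin 2 → ℂ) (m : ℕ) :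
    (phaseOp v 0 ^ m) (ground hħ)
      ∈ Submodule.span ℂ (Set.range fun M : ℕ => hermite hħ M v) := by
  induction m with
  | zero => exact Submodule.subset_span ⟨0, by simp [hermite_zero]⟩
  | succ m ih =>
    have hX : phaseOp v 0 = (1 / 2 : ℂ) • (raise ħ v + lower ħ v) := by
      rw [raise, lower, ← phaseOp_add, ← phaseOp_smul, neg_add_cancel, smul_zero]
      congr 1
      module
    rw [pow_succ', mul_apply_eq_comp]
    generalize (phaseOp v 0 ^ m) (ground hħ) = g at ih
    induction ih using Submodule.span_induction with
    | mem g hg =>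
      obtain ⟨M, rfl⟩ := hg
      rw [hX, _root_.smul_apply, _root_.add_apply]
      refine Submodule.smul_mem _ _ (Submodule.add_mem _ ?_ ?_)
      · exact Submodule.subset_span ⟨M + 1, hermite_succ hħ M v⟩
      · cases M with
        | zero =>
          simp only [hermite_zero, lower_ground]
          exact Submodule.zero_mem _
        | succ M =>
          simp only [lower_hermite_succ]
          exact Submodule.smul_mem _ _ (Submodule.subset_span ⟨M, rfl⟩)
    | zero => rw [map_zero]; exact Submodule.zero_mem _
    | add a b _ _ ha hb => rw [map_add]; exact Submodule.add_mem _ ha hb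
    | smul c a _ ha => rw [map_smul]; exact Submodule.smul_mem _ _ ha

theorem phaseOp_pow_ground_apply (v : Fin 2 → ℂ) (m : ℕ) (x : Plane) :
    (phaseOp v 0 ^ m) (ground hħ) x = linForm v x ^ m * ground hħ x := by
  induction m with
  | zero => simp
  | succ m ih =>
    rw [pow_succ', mul_apply_eq_comp, phaseOp_zero_right_apply, ih]
    ring

theorem integral_linForm_pow_mul (v : Fin 2 → ℂ) {f : L2}
    (hf : ∀ M, ∫ x, hermite hħ M v x * f x = 0) (m : ℕ) :
    ∫ x, linForm v x ^ m * ground hħ x * f x = 0 := by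
  simp only [← phaseOp_pow_ground_apply]
  have h (ψ : 𝓢(Plane, ℂ)) : (f : 𝓢'(Plane, ℂ)) ψ = ∫ x, ψ x * f x :=
    Lp.toTemperedDistribution_apply f ψ
  rw [← h]
  have hmem := phaseOp_pow_ground_mem_span hħ v m
  have hle : Submodule.span ℂ (Set.range fun M : ℕ => hermite hħ M v)
      ≤ LinearMap.ker (f : 𝓢'(Plane, ℂ)).toLinearMap := by
    rw [Submodule.span_le]
    rintro _ ⟨M, rfl⟩
    exact (h _).trans (hf M)
  exact hle hmem

theorem integrable_exp_mul_ground_mul (C : ℝ) (f : L2) :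
    Integrable (fun x => Real.exp (C * ‖x‖) * (‖ground hħ x‖ * ‖f x‖)) := by
  -- Completing the square, `exp(C‖x‖)` times the Gaussian is at most `exp(ħC²)` times the wider
  -- Gaussian of parameter `2ħ`. The latter is still in `L²`, so its product with `f` is integrable.
  have hc : 0 < 2 * ħ := by positivity
  have hg : MemLp (fun x => ‖ground hc x‖) 2 (volume : Measure Plane) :=
    ((ground hc).memLp 2 volume).norm
  have h := (hg.integrable_mul (Lp.memLp f).norm).const_mul (Real.exp (ħ * C ^ 2))
  refine h.mono' ?_ (Filter.Eventually.of_forall fun x => ?_)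
  · refine AEStronglyMeasurable.mul ?_ ((ground hħ).continuous.norm.aestronglyMeasurable.mul
      (Lp.aestronglyMeasurable f).norm)
    fun_prop
  · rw [Real.norm_of_nonneg (by positivity)]
    simp only [Pi.mul_apply, ← mul_assoc]
    refine mul_le_mul_of_nonneg_right ?_ (norm_nonneg _)
    rw [ground_apply, ground_apply, Complex.norm_real, Complex.norm_real,
      Real.norm_of_nonneg (Real.exp_pos _).le, Real.norm_of_nonneg (Real.exp_pos _).le,
      ← Real.exp_add, ← Real.exp_add, Real.exp_le_exp]
    have : ħ * C ^ 2 + -(1 / (2 * (2 * ħ))) * ‖x‖ ^ 2 - (C * ‖x‖ + -(1 / (2 * ħ)) * ‖x‖ ^ 2)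
        = (1 / (4 * ħ)) * (2 * ħ * C - ‖x‖) ^ 2 := by
      field_simp
      ring
    have h2 : 0 ≤ (1 / (4 * ħ)) * (2 * ħ * C - ‖x‖) ^ 2 := by positivity
    linarith

/-- The exponential series is integrated term by term; the norms of its terms add up to at most
`exp(‖v‖‖x‖)`, which the Gaussian dominates. -/
theorem integral_exp_linForm_mul (v : Fin 2 → ℂ) {f : L2}
    (hf : ∀ M, ∫ x, hermite hħ M v x * f x = 0) :
    ∫ x, Complex.exp (linForm v x) * (ground hħ x * f x) = 0 := by
  have hsum : HasSum (fun m : ℕ => ∫ x, ((m.factorial : ℂ)⁻¹ * linForm v x ^ m)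
      * (ground hħ x * f x)) (∫ x, Complex.exp (linForm v x) * (ground hħ x * f x)) := by
    have hexp (x : Plane) : HasSum (fun m : ℕ => ‖linForm v x‖ ^ m / m.factorial
        * (‖ground hħ x‖ * ‖f x‖)) (Real.exp ‖linForm v x‖ * (‖ground hħ x‖ * ‖f x‖)) := by
      rw [Real.exp_eq_exp_ℝ]
      exact (NormedSpace.expSeries_div_hasSum_exp (𝔸 := ℝ) ‖linForm v x‖).mul_right _
    refine hasSum_integral_of_dominated_convergence
      (fun m x => ‖linForm v x‖ ^ m / m.factorial * (‖ground hħ x‖ * ‖f x‖))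
      (fun m => ?_) (fun m => Filter.Eventually.of_forall fun x => ?_)
      (Filter.Eventually.of_forall fun x => (hexp x).summable) ?_
      (Filter.Eventually.of_forall fun x => ?_)
    · refine AEStronglyMeasurable.mul ?_ ((ground hħ).continuous.aestronglyMeasurable.mul
        (Lp.aestronglyMeasurable f))
      fun_prop
    · rw [norm_mul, norm_mul, norm_mul, norm_inv, norm_pow, RCLike.norm_natCast, div_eq_inv_mul]
    · simp only [(hexp _).tsum_eq]
      refine (integrable_exp_mul_ground_mul hħ ‖linForm v‖ f).mono' ?_
        (Filter.Eventually.of_forall fun x => ?_)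
      · refine AEStronglyMeasurable.mul ?_ ((ground hħ).continuous.norm.aestronglyMeasurable.mul
          (Lp.aestronglyMeasurable f).norm)
        fun_prop
      · rw [Real.norm_of_nonneg (by positivity)]
        gcongr
        exact (linForm v).le_opNorm x
    · rw [Complex.exp_eq_exp_ℂ]
      refine HasSum.mul_right _ ?_
      simpa only [div_eq_inv_mul] using
        NormedSpace.expSeries_div_hasSum_exp (𝔸 := ℂ) (linForm v x)
  have hzero (m : ℕ) : ∫ x, ((m.factorial : ℂ)⁻¹ * linForm v x ^ m) * (ground hħ x * f x) = 0 := by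
    have := integral_linForm_pow_mul hħ v hf m
    simp only [mul_assoc] at this ⊢
    rw [integral_const_mul, this, mul_zero]
  simp only [hzero] at hsum
  exact hsum.unique hasSum_zero

/-- An integrable function with vanishing Fourier transform vanishes almost everywhere. -/
theorem ae_eq_zero_of_fourier_eq_zero {g : Plane → ℂ} (hg : Integrable g)
    (h : ∀ w : Plane, FourierTransform.fourier g w = 0) : ∀ᵐ x, g x = 0 := by
  refine ae_eq_zero_of_integral_contDiff_smul_eq_zero hg.locallyIntegrable fun φ hφ hc => ?_
  have hc' : HasCompactSupport (Complex.ofRealCLM ∘ φ) := hc.comp_left rfl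
  have hφ' : ContDiff ℝ (⊤ : ℕ∞) (Complex.ofRealCLM ∘ φ) := Complex.ofRealCLM.contDiff.comp hφ
  -- Every test function is the Fourier transform of a Schwartz function `ψ`, so the pairing of `Φ`
  -- with `g` equals that of `ψ` with the vanishing transform of `g`.
  set Φ : 𝓢(Plane, ℂ) := hc'.toSchwartzMap hφ' with hΦ
  set ψ : 𝓢(Plane, ℂ) := FourierTransformInv.fourierInv Φ with hψ
  have hΦψ : FourierTransform.fourier ψ = Φ := FourierTransform.fourier_fourierInv_eq Φ
  have key := VectorFourier.integral_fourierIntegral_smul_eq_flip (μ := volume) (ν := volume)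
    (L := innerₗ Plane) Real.continuous_fourierChar (by exact continuous_inner)
    ψ.integrable hg
  rw [flip_innerₗ] at key
  have h1 : (VectorFourier.fourierIntegral Real.fourierChar volume (innerₗ Plane) ψ) = Φ := by
    rw [← hΦψ]
    rfl
  have h2 : (VectorFourier.fourierIntegral Real.fourierChar volume (innerₗ Plane) g) = 0 :=
    funext h
  rw [h1, h2] at key
  simp only [Pi.zero_apply, smul_zero, integral_zero] at key
  rw [← key]
  rfl

/-- Complex directions are essential: `v = -2πi w` turns `exp(v·x)` into the Fourier kernel. The
Gaussian times `f` then vanishes almost everywhere, and the Gaussian has no zeros. -/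
theorem eq_zero_of_integral_hermite_mul {f : L2}
    (hf : ∀ M v, ∫ x, hermite hħ M v x * f x = 0) : f = 0 := by
  have hint : Integrable (fun x => ground hħ x * f x) (volume : Measure Plane) :=
    ((ground hħ).memLp 2 volume).integrable_mul (Lp.memLp f)
  have hF (w : Plane) : FourierTransform.fourier (fun x => ground hħ x * f x) w = 0 := by
    rw [Real.fourier_eq']
    refine (integral_congr_ae (Filter.Eventually.of_forall fun x => ?_)).trans
      (integral_exp_linForm_mul hħ (fun j => -(2 * Real.pi * Complex.I) * w j)
        fun M => hf M _)
    simp only [smul_eq_mul, linForm_apply]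
    congr 2
    rw [PiLp.inner_apply, Fin.sum_univ_two]
    simp
    ring
  rw [Lp.eq_zero_iff_ae_eq_zero]
  filter_upwards [ae_eq_zero_of_fourier_eq_zero hint hF] with x hx
  refine (mul_eq_zero.mp hx).resolve_left ?_
  rw [ground_apply]
  exact_mod_cast (Real.exp_pos _).ne'

theorem eq_zero_of_mem_eigenspace {N : ℕ} {f : L2} (hf : f ∈ eigenspace ħ N)
    (h : ∀ v, inner ℂ (hermiteL2 hħ N v) f = 0) : f = 0 := by
  refine eq_zero_of_integral_hermite_mul hħ fun M v => ?_
  rcases eq_or_ne M N with rfl | hMN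
  · simpa [inner_hermiteL2] using h (star v)
  · exact integral_hermite_mul_eq_zero hħ hMN v hf

end

end

end OrbitalCoherent

namespace OrbitalCoherent

noncomputable section

/-! ### The metaplectic operators on Schwartz space -/

/-- The complexification of a real matrix, acting on `ℂ²`. -/
abbrev complexify (Q : Matrix (Fin 2) (Fin 2) ℝ) : Matrix (Fin 2) (Fin 2) ℂ :=
  Q.map Complex.ofReal

theorem chirpS_toLp (ħ : ℝ) (Q : Matrix (Fin 2) (Fin 2) ℝ) (f : 𝓢(Plane, ℂ)) :
    (SchwartzMap.smulLeftCLM ℂ (chirpFun ħ Q) f).toLp 2 = chirp ħ Q (f.toLp 2 : L2) := by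
  refine Lp.ext ?_
  filter_upwards [(SchwartzMap.smulLeftCLM ℂ (chirpFun ħ Q) f).coeFn_toLp 2 volume,
    chirp_ae_eq ħ Q (f.toLp 2), f.coeFn_toLp 2 volume] with x h1 h2 h3
  rw [h1, h2, h3, SchwartzMap.smulLeftCLM_apply_apply (hasTemperateGrowth_chirpFun ħ Q),
    smul_eq_mul]

theorem toEuclideanCLM_apply_zero (L : Matrix (Fin 2) (Fin 2) ℝ) (x : Plane) :
    Matrix.toEuclideanCLM (𝕜 := ℝ) L x 0 = L 0 0 * x 0 + L 0 1 * x 1 := by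
  simp [Matrix.mulVec, dotProduct, Fin.sum_univ_two]

theorem toEuclideanCLM_apply_one (L : Matrix (Fin 2) (Fin 2) ℝ) (x : Plane) :
    Matrix.toEuclideanCLM (𝕜 := ℝ) L x 1 = L 1 0 * x 0 + L 1 1 * x 1 := by
  simp [Matrix.mulVec, dotProduct, Fin.sum_univ_two]

theorem gradForm_chirpFun (ħ : ℝ) {Q : Matrix (Fin 2) (Fin 2) ℝ} (hQ : Q 1 0 = Q 0 1)
    (b : Fin 2 → ℂ) (x : Plane) :
    gradForm b (chirpFun ħ Q) x
      = (Complex.I / ħ) * linForm ((complexify Q).mulVec b) x * chirpFun ħ Q x := by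
  have h := (Complex.ofRealCLM.hasFDerivAt.comp x (((hasFDerivAt_id x).inner ℝ
    (Matrix.toEuclideanCLM (𝕜 := ℝ) Q).hasFDerivAt).const_mul
      (1 / (2 * ħ)))).mul_const Complex.I |>.cexp
  change HasFDerivAt (chirpFun ħ Q) _ x at h
  rw [gradForm, h.fderiv, linForm_apply]
  have e (u v : Plane) : inner ℝ u v = u 0 * v 0 + u 1 * v 1 := by
    rw [PiLp.inner_apply, Fin.sum_univ_two]
    simp [mul_comm]
  have hc : Complex.exp ((Complex.ofRealCLM ∘ fun y : Plane =>
      1 / (2 * ħ) * inner ℝ (id y) (Matrix.toEuclideanCLM (𝕜 := ℝ) Q y)) x * Complex.I)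
      = chirpFun ħ Q x := rfl
  rw [hc]
  simp only [_root_.smul_apply, ContinuousLinearMap.comp_apply, Complex.ofRealCLM_apply,
    smul_eq_mul, fderivInnerCLM_apply, ContinuousLinearMap.prod_apply, id_eq, e,
    toEuclideanCLM_apply_zero, toEuclideanCLM_apply_one, ContinuousLinearMap.id_apply,
    complexify, Matrix.mulVec, dotProduct, Fin.sum_univ_two, Matrix.map_apply, hQ]
  simp
  ring

/-- A quadratic phase acts as a shear: positions are fixed and `∇` becomes `∇ - (i/ħ)Qx`. Symmetry
of `Q` makes `Qx` the gradient of `x·Qx/2`. -/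
theorem chirpS_phaseOp (ħ : ℝ) {Q : Matrix (Fin 2) (Fin 2) ℝ} (hQ : Q 1 0 = Q 0 1)
    (a b : Fin 2 → ℂ) (f : 𝓢(Plane, ℂ)) :
    SchwartzMap.smulLeftCLM ℂ (chirpFun ħ Q) (phaseOp a b f)
      = phaseOp (a - (Complex.I / ħ) • (complexify Q).mulVec b) b
        (SchwartzMap.smulLeftCLM ℂ (chirpFun ħ Q) f) := by
  ext x
  have h : (SchwartzMap.smulLeftCLM ℂ (chirpFun ħ Q) f : Plane → ℂ)
      = fun y => chirpFun ħ Q y * f y := by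
    funext y
    rw [SchwartzMap.smulLeftCLM_apply_apply (hasTemperateGrowth_chirpFun ħ Q), smul_eq_mul]
  rw [SchwartzMap.smulLeftCLM_apply_apply (hasTemperateGrowth_chirpFun ħ Q), smul_eq_mul,
    phaseOp_apply, phaseOp_apply, h,
    gradForm_mul b ((hasTemperateGrowth_chirpFun ħ Q).1.differentiable (by simp) x)
      f.differentiableAt, gradForm_chirpFun ħ hQ]
  simp only [linForm_apply, Pi.sub_apply, Pi.smul_apply, smul_eq_mul]
  ring

/-- An invertible matrix as a linear automorphism of the plane. -/
def planeEquiv (L : Matrix (Fin 2) (Fin 2) ℝ) (hL : L.det ≠ 0) : Plane ≃L[ℝ] Plane :=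
  ContinuousLinearEquiv.equivOfInverse (Matrix.toEuclideanCLM (𝕜 := ℝ) L)
    (Matrix.toEuclideanCLM (𝕜 := ℝ) L⁻¹)
    (fun x => by
      have h := toEuclideanCLM_inv_apply L⁻¹ (det_inv_ne_zero L hL) x
      rwa [Matrix.nonsing_inv_nonsing_inv L (Ne.isUnit hL)] at h)
    (toEuclideanCLM_inv_apply L hL)

/-- The dilation `f ↦ |det L|^(1/2) f (L x)` on Schwartz space. -/
def dilationS (L : Matrix (Fin 2) (Fin 2) ℝ) (hL : L.det ≠ 0) :
    𝓢(Plane, ℂ) →L[ℂ] 𝓢(Plane, ℂ) :=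
  ((Real.sqrt |L.det| : ℝ) : ℂ) •
    SchwartzMap.compCLMOfContinuousLinearEquiv ℂ (planeEquiv L hL)

theorem dilationS_apply (L : Matrix (Fin 2) (Fin 2) ℝ) (hL : L.det ≠ 0) (f : 𝓢(Plane, ℂ))
    (x : Plane) : dilationS L hL f x
      = ((Real.sqrt |L.det| : ℝ) : ℂ) * f (Matrix.toEuclideanCLM (𝕜 := ℝ) L x) := rfl

theorem dilationS_toLp (L : Matrix (Fin 2) (Fin 2) ℝ) (hL : L.det ≠ 0) (f : 𝓢(Plane, ℂ)) :
    (dilationS L hL f).toLp 2 = dilation L (f.toLp 2 : L2) := by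
  refine Lp.ext ?_
  filter_upwards [(dilationS L hL f).coeFn_toLp 2 volume, dilation_ae_eq L hL (f.toLp 2),
    (quasiMeasurePreserving_toEuclideanCLM L hL).ae (f.coeFn_toLp 2 volume)] with x h1 h2 h3
  rw [h1, h2, h3, dilationS_apply]

/-- This is the chain rule; putting `Lb` on the left avoids the inverse of `L`. -/
theorem dilationS_phaseOp (L : Matrix (Fin 2) (Fin 2) ℝ) (hL : L.det ≠ 0) (a b : Fin 2 → ℂ)
    (f : 𝓢(Plane, ℂ)) :
    dilationS L hL (phaseOp a ((complexify L).mulVec b) f)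
      = phaseOp ((complexify L).transpose.mulVec a) b (dilationS L hL f) := by
  ext x
  set k : ℂ := ((Real.sqrt |L.det| : ℝ) : ℂ) with hk
  have hd (m : Plane) : fderiv ℝ (dilationS L hL f) x m
      = k * fderiv ℝ f (Matrix.toEuclideanCLM (𝕜 := ℝ) L x)
          (Matrix.toEuclideanCLM (𝕜 := ℝ) L m) := by
    have h : HasFDerivAt (dilationS L hL f)
        (k • ((fderiv ℝ f (Matrix.toEuclideanCLM (𝕜 := ℝ) L x)) ∘L
          (Matrix.toEuclideanCLM (𝕜 := ℝ) L))) x :=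
      ((f.differentiableAt.hasFDerivAt).comp x
        (Matrix.toEuclideanCLM (𝕜 := ℝ) L).hasFDerivAt).const_mul k
    rw [h.fderiv]
    rfl
  have h0 : Matrix.toEuclideanCLM (𝕜 := ℝ) L (EuclideanSpace.single 0 1)
      = L 0 0 • EuclideanSpace.single 0 1 + L 1 0 • EuclideanSpace.single 1 1 := by
    ext j
    fin_cases j
    · simp [Matrix.mulVec, dotProduct]
    · simp [Matrix.mulVec, dotProduct]
  have h1 : Matrix.toEuclideanCLM (𝕜 := ℝ) L (EuclideanSpace.single 1 1)
      = L 0 1 • EuclideanSpace.single 0 1 + L 1 1 • EuclideanSpace.single 1 1 := by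
    ext j
    fin_cases j
    · simp [Matrix.mulVec, dotProduct]
    · simp [Matrix.mulVec, dotProduct]
  rw [dilationS_apply, phaseOp_apply, phaseOp_apply, dilationS_apply, gradForm, gradForm, hd, hd,
    h0, h1, map_add, map_add, map_smul, map_smul, map_smul, map_smul, linForm_apply,
    linForm_apply, toEuclideanCLM_apply_zero, toEuclideanCLM_apply_one]
  simp only [Matrix.mulVec, dotProduct, Fin.sum_univ_two, Matrix.map_apply,
    Matrix.transpose_apply, Complex.real_smul]
  push_cast
  ring

/-- The Fourier transform exchanges positions and derivatives; the constants belong to the kernel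
`exp(-2πi x·w)`. -/
theorem fourier_phaseOp (a b : Fin 2 → ℂ) (f : 𝓢(Plane, ℂ)) :
    FourierTransform.fourier (phaseOp a b f)
      = phaseOp ((2 * Real.pi * Complex.I) • b) ((Complex.I / (2 * Real.pi)) • a)
        (FourierTransform.fourier f) := by
  have hpi : (Real.pi : ℂ) ≠ 0 := by exact_mod_cast Real.pi_ne_zero
  set e : Fin 2 → Plane := fun j => EuclideanSpace.single j 1 with he
  have hinner (j : Fin 2) : (fun x : Plane => inner ℝ x (e j)) = fun x => x j := by
    funext x
    simp [he, EuclideanSpace.inner_single_right]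
  have htg (j : Fin 2) : Function.HasTemperateGrowth (fun x : Plane => x j) := by
    rw [← hinner j]
    exact Function.hasTemperateGrowth_inner_left _
  set X : Fin 2 → 𝓢(Plane, ℂ) → 𝓢(Plane, ℂ) := fun j =>
    SchwartzMap.smulLeftCLM ℂ (fun x : Plane => x j) with hX
  have hXa (j : Fin 2) (g : 𝓢(Plane, ℂ)) (x : Plane) : X j g x = x j * g x := by
    simp only [hX]
    rw [SchwartzMap.smulLeftCLM_apply_apply (htg j), Complex.real_smul]
  have hop (a b : Fin 2 → ℂ) (g : 𝓢(Plane, ℂ)) : phaseOp a b g = a 0 • X 0 g + a 1 • X 1 g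
      + (b 0 • LineDeriv.lineDerivOp (e 0) g + b 1 • LineDeriv.lineDerivOp (e 1) g) := by
    ext x
    simp only [phaseOp_apply, gradForm, linForm_apply, _root_.add_apply, _root_.smul_apply, hXa,
      SchwartzMap.lineDerivOp_apply_eq_fderiv, smul_eq_mul, he]
    ring
  have hder (j : Fin 2) : FourierTransform.fourier (LineDeriv.lineDerivOp (e j) f)
      = (2 * Real.pi * Complex.I) • X j (FourierTransform.fourier f) := by
    rw [SchwartzMap.fourier_lineDerivOp_eq, hinner]
  have hmul (j : Fin 2) : FourierTransform.fourier (X j f) = (Complex.I / (2 * Real.pi)) •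
      LineDeriv.lineDerivOp (e j) (FourierTransform.fourier f) := by
    rw [SchwartzMap.lineDerivOp_fourier_eq, hinner, FourierTransform.fourier_smul, smul_smul]
    have : Complex.I / (2 * Real.pi) * -(2 * Real.pi * Complex.I) = 1 := by
      field_simp
      simp
    rw [this, one_smul]
  rw [hop, hop]
  simp only [FourierTransform.fourier_add, FourierTransform.fourier_smul, hder, hmul,
    Pi.smul_apply, smul_eq_mul]
  module

end

end OrbitalCoherent

/-! ### Covariance of the ladder operators under the metaplectic operators. -/

namespace OrbitalCoherent

noncomputable section

/-- Both matrices are the inverse of `U`, as `det U = 1`. Comparing entries gives the form with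
columns `(p, q)` and `(-q̄, p̄)`, hence four real parameters on the unit sphere. -/
theorem SU2_star_eq_adjugate (U : SU2) :
    star (U : Matrix (Fin 2) (Fin 2) ℂ) = (U : Matrix (Fin 2) (Fin 2) ℂ).adjugate := by
  obtain ⟨hU, hdet⟩ := Matrix.mem_specialUnitaryGroup_iff.mp U.2
  have h1 : star (U : Matrix (Fin 2) (Fin 2) ℂ) * U = 1 := (Matrix.mem_unitaryGroup_iff').mp hU
  have h2 := Matrix.mul_adjugate (U : Matrix (Fin 2) (Fin 2) ℂ)
  rw [hdet, one_smul] at h2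
  calc star (U : Matrix (Fin 2) (Fin 2) ℂ)
      = star (U : Matrix (Fin 2) (Fin 2) ℂ) * (U * (U : Matrix (Fin 2) (Fin 2) ℂ).adjugate) := by
        rw [h2, mul_one]
    _ = _ := by rw [← mul_assoc, h1, one_mul]

theorem SU2_apply_one_one (U : SU2) : U.1 1 1 = star (U.1 0 0) := by
  have h := congrFun (congrFun (SU2_star_eq_adjugate U) 0) 0
  rw [Matrix.adjugate_fin_two] at h
  exact h.symm

theorem SU2_apply_zero_one (U : SU2) : U.1 0 1 = -star (U.1 1 0) := by
  have h := congrFun (congrFun (SU2_star_eq_adjugate U) 0) 1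
  rw [Matrix.adjugate_fin_two] at h
  have h' : star (U.1 1 0) = -U.1 0 1 := h
  rw [h', neg_neg]

theorem rePart_eq (U : SU2) :
    rePart U = !![(U.1 0 0).re, -(U.1 1 0).re; (U.1 1 0).re, (U.1 0 0).re] := by
  ext i j
  fin_cases i <;> fin_cases j <;>
    simp [rePart, SU2_apply_one_one, SU2_apply_zero_one]

theorem imPart_eq (U : SU2) :
    imPart U = !![(U.1 0 0).im, (U.1 1 0).im; (U.1 1 0).im, -(U.1 0 0).im] := by
  ext i j
  fin_cases i <;> fin_cases j <;>
    simp [imPart, SU2_apply_one_one, SU2_apply_zero_one]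

theorem SU2_sum_sq (U : SU2) :
    (U.1 0 0).re ^ 2 + (U.1 1 0).re ^ 2 + (U.1 0 0).im ^ 2 + (U.1 1 0).im ^ 2 = 1 := by
  have h := (Matrix.mem_specialUnitaryGroup_iff.mp U.2).2
  rw [Matrix.det_fin_two, SU2_apply_one_one, SU2_apply_zero_one] at h
  have h' := congrArg Complex.re h
  simp at h'
  linarith

theorem mulVec_apply_zero {R : Type*} [NonUnitalNonAssocSemiring R]
    (M : Matrix (Fin 2) (Fin 2) R) (v : Fin 2 → R) :
    M.mulVec v 0 = M 0 0 * v 0 + M 0 1 * v 1 := by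
  rw [Matrix.mulVec, dotProduct, Fin.sum_univ_two]

theorem mulVec_apply_one {R : Type*} [NonUnitalNonAssocSemiring R]
    (M : Matrix (Fin 2) (Fin 2) R) (v : Fin 2 → R) :
    M.mulVec v 1 = M 1 0 * v 0 + M 1 1 * v 1 := by
  rw [Matrix.mulVec, dotProduct, Fin.sum_univ_two]

/-- The metaplectic operators preserve Schwartz space and transform the position and momentum
operators as `U` transforms the coordinates of phase space. -/
theorem exists_schwartz_metaplectic {ħ : ℝ} (hħ : 0 < ħ) (U : SU2) :
    ∃ S : 𝓢(Plane, ℂ) →L[ℂ] 𝓢(Plane, ℂ),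
      (∀ f, (S f).toLp 2 = metaplectic ħ U (f.toLp 2 : L2)) ∧
      -- The sign `ε = 1` gives the raising operators with `w = Uv`, and `ε = -1` the lowering
      -- operators with `w = Ūv`; one computation covers both.
      ∀ ε : ℂ, ε ^ 2 = 1 → ∀ v w : Fin 2 → ℂ,
        w = (complexify (rePart U) + (ε * Complex.I) • complexify (imPart U)).mulVec v → ∀ f,
        S (phaseOp v (-(ε * ħ) • v) f) = phaseOp w (-(ε * ħ) • w) (S f) := by
  have hhc : (ħ : ℂ) ≠ 0 := by exact_mod_cast hħ.ne'
  have hpi : (Real.pi : ℂ) ≠ 0 := by exact_mod_cast Real.pi_ne_zero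
  have hsum := SU2_sum_sq U
  by_cases hB : imPart U = 0
  · have hA := rePart_eq U
    have hB' := hB
    rw [imPart_eq] at hB'
    have hs : (U.1 0 0).im = 0 := congrFun (congrFun hB' 0) 0
    have ht : (U.1 1 0).im = 0 := congrFun (congrFun hB' 0) 1
    rw [hs, ht] at hsum
    generalize (U.1 0 0).re = c at *
    generalize (U.1 1 0).re = d at *
    have hdet : (rePart U).det = 1 := by
      rw [hA, Matrix.det_fin_two_of]
      linarith
    have hL : (rePart U)⁻¹ = !![c, d; -d, c] := by
      rw [Matrix.inv_def, hdet, hA, Matrix.adjugate_fin_two_of]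
      simp
    have hL0 : ((rePart U)⁻¹).det ≠ 0 := by
      rw [hL, Matrix.det_fin_two_of]
      intro h
      linarith
    refine ⟨dilationS (rePart U)⁻¹ hL0, fun f => ?_, fun ε _ v w hw f => ?_⟩
    · rw [dilationS_toLp, metaplectic, if_pos hB]
    · have hcd : (c : ℂ) ^ 2 + (d : ℂ) ^ 2 = 1 := by
        have : c ^ 2 + d ^ 2 = 1 := by linarith
        exact_mod_cast this
      have hw0 : w 0 = c * v 0 - d * v 1 := by
        rw [hw, hA, hB]
        simp [Matrix.mulVec, dotProduct, Fin.sum_univ_two]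
        ring
      have hw1 : w 1 = d * v 0 + c * v 1 := by
        rw [hw, hA, hB]
        simp [Matrix.mulVec, dotProduct, Fin.sum_univ_two]
      have h1 : -(ε * ħ) • v = (complexify (rePart U)⁻¹).mulVec (-(ε * ħ) • w) := by
        rw [hL]
        funext j
        fin_cases j
        · simp [Matrix.mulVec, dotProduct, Fin.sum_univ_two, hw0, hw1]
          linear_combination (ε * ħ * v 0) * hcd
        · simp [Matrix.mulVec, dotProduct, Fin.sum_univ_two, hw0, hw1]
          linear_combination (ε * ħ * v 1) * hcd
      have h2 : (complexify (rePart U)⁻¹).transpose.mulVec v = w := by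
        rw [hL]
        funext j
        fin_cases j
        · simp [Matrix.mulVec, dotProduct, Fin.sum_univ_two, hw0]
          ring
        · simp [Matrix.mulVec, dotProduct, Fin.sum_univ_two, hw1]
      rw [h1, dilationS_phaseOp, h2]
  · have hA := rePart_eq U
    have hBe := imPart_eq U
    generalize (U.1 0 0).re = c at *
    generalize (U.1 1 0).re = d at *
    generalize (U.1 0 0).im = s at *
    generalize (U.1 1 0).im = t at *
    -- `k = -det B`, which vanishes only for `B = 0`.
    set k : ℝ := s ^ 2 + t ^ 2 with hk
    have hk0 : k ≠ 0 := by
      intro h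
      apply hB
      have hs : s = 0 := by nlinarith [sq_nonneg s, sq_nonneg t]
      have ht : t = 0 := by nlinarith [sq_nonneg s, sq_nonneg t]
      rw [hBe, hs, ht]
      ext i j
      fin_cases i <;> fin_cases j <;> simp
    have hdet : (imPart U).det = -k := by
      rw [hBe, Matrix.det_fin_two_of]
      ring
    have hBi : (imPart U)⁻¹ = !![s / k, t / k; t / k, -(s / k)] := by
      rw [Matrix.inv_def, hdet, hBe, Matrix.adjugate_fin_two_of, Ring.inverse_eq_inv']
      ext i j
      fin_cases i <;> fin_cases j <;> simp <;> field_simp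
    set Q₁ := -((imPart U)⁻¹ * rePart U) with hQ₁
    set L := -(2 * Real.pi * ħ)⁻¹ • (imPart U)⁻¹ with hL
    set Q₂ := -(rePart U * (imPart U)⁻¹) with hQ₂
    have hQ₁' : Q₁ = !![-((s * c + t * d) / k), (s * d - t * c) / k;
        (s * d - t * c) / k, (s * c + t * d) / k] := by
      rw [hQ₁, hBi, hA]
      ext i j
      fin_cases i <;> fin_cases j <;> simp <;> ring
    have hQ₂' : Q₂ = !![-((s * c - t * d) / k), -((s * d + t * c) / k);
        -((s * d + t * c) / k), (s * c - t * d) / k] := by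
      rw [hQ₂, hBi, hA]
      ext i j
      fin_cases i <;> fin_cases j <;> simp <;> ring
    have hL' : L = !![-(2 * Real.pi * ħ)⁻¹ * (s / k), -(2 * Real.pi * ħ)⁻¹ * (t / k);
        -(2 * Real.pi * ħ)⁻¹ * (t / k), (2 * Real.pi * ħ)⁻¹ * (s / k)] := by
      rw [hL, hBi]
      ext i j
      fin_cases i <;> fin_cases j <;> simp
    have hL0 : L.det ≠ 0 := by
      rw [hL, Matrix.det_smul]
      refine mul_ne_zero (pow_ne_zero _ (neg_ne_zero.mpr (inv_ne_zero (by positivity)))) ?_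
      exact det_inv_ne_zero _ (by rw [hdet]; exact neg_ne_zero.mpr hk0)
    refine ⟨(SchwartzMap.smulLeftCLM ℂ (chirpFun ħ Q₂)) ∘L (dilationS L hL0) ∘L
      (FourierTransform.fourierCLM ℂ 𝓢(Plane, ℂ)) ∘L
      (SchwartzMap.smulLeftCLM ℂ (chirpFun ħ Q₁)), fun f => ?_, fun ε hε v w hw f => ?_⟩
    · simp only [ContinuousLinearMap.comp_apply, FourierTransform.fourierCLM_apply]
      rw [chirpS_toLp, dilationS_toLp, ← SchwartzMap.toLp_fourier_eq, chirpS_toLp, metaplectic,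
        if_neg hB]
      rfl
    · have hkc : (k : ℂ) ≠ 0 := by exact_mod_cast hk0
      have hkd : (k : ℂ) = s ^ 2 + t ^ 2 := by rw [hk]; push_cast; ring
      have hsumc : (c : ℂ) ^ 2 + d ^ 2 + k = 1 := by
        have : c ^ 2 + d ^ 2 + k = 1 := by linarith
        exact_mod_cast this
      have hw0 : w 0 = (c + ε * Complex.I * s) * v 0 + (-d + ε * Complex.I * t) * v 1 := by
        rw [hw, hA, hBe]
        simp [Matrix.mulVec, dotProduct, Fin.sum_univ_two]
      have hw1 : w 1 = (d + ε * Complex.I * t) * v 0 + (c - ε * Complex.I * s) * v 1 := by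
        rw [hw, hA, hBe, mulVec_apply_one]
        simp only [Matrix.add_apply, Matrix.smul_apply, Matrix.map_apply, Matrix.of_apply,
          Matrix.cons_val_zero, Matrix.cons_val_one, Matrix.cons_val', smul_eq_mul]
        push_cast
        ring
      simp only [ContinuousLinearMap.comp_apply, FourierTransform.fourierCLM_apply]
      rw [chirpS_phaseOp ħ (by rw [hQ₁']; simp), fourier_phaseOp]
      -- The dilation rule needs the derivative coefficient in the form `L b`. This identity
      -- provides it, and `b` is already the final coefficient `-εħ w`.
      have h1 : (Complex.I / (2 * Real.pi)) •
            (v - (Complex.I / ħ) • (complexify Q₁).mulVec (-(ε * ħ) • v))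
          = (complexify L).mulVec (-(ε * ħ) • w) := by
        rw [hL', hQ₁']
        funext j
        fin_cases j
        · simp only [Pi.smul_apply, smul_eq_mul, Pi.sub_apply, Matrix.map_apply, Matrix.of_apply,
          Matrix.cons_val_zero, Matrix.cons_val_one, Matrix.cons_val', Fin.zero_eta,
          mulVec_apply_zero, hw0, hw1]
          push_cast
          field_simp
          linear_combination (Complex.I * v 0) * hkd - (Complex.I * (s ^ 2 + t ^ 2) * v 0) * hε
            - (ε * (v 0 * (s * c + t * d) - (s * d - c * t) * v 1)) * Complex.I_sq
        · simp only [Pi.smul_apply, smul_eq_mul, Pi.sub_apply, Matrix.map_apply, Matrix.of_apply,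
          Matrix.cons_val_zero, Matrix.cons_val_one, Matrix.cons_val', Fin.mk_one,
          mulVec_apply_one, hw0, hw1]
          push_cast
          field_simp
          linear_combination (Complex.I * v 1) * hkd - (Complex.I * (s ^ 2 + t ^ 2) * v 1) * hε
            - (ε * (-((s * d - t * c) * v 0) - v 1 * (s * c + d * t))) * Complex.I_sq
      rw [h1, dilationS_phaseOp, chirpS_phaseOp ħ (by rw [hQ₂']; simp)]
      -- The derivative coefficients now agree. Equality of the position coefficients comes from
      -- `|p|² + |q|² = 1` for the first column of `U`, in the form `hsumc`.
      congr 2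
      rw [hL', hQ₂']
      funext j
      fin_cases j
      · simp only [Pi.smul_apply, smul_eq_mul, Pi.sub_apply, Matrix.map_apply, Matrix.of_apply,
          Matrix.cons_val_zero, Matrix.cons_val_one, Matrix.cons_val', Fin.zero_eta,
          Matrix.transpose_apply, mulVec_apply_zero, hw0, hw1]
        push_cast
        field_simp
        linear_combination (-Complex.I * ε * (s * v 0 + t * v 1)) * hsumc
          - (ε ^ 2 * (s ^ 2 + t ^ 2) * (c * v 0 - d * v 1)) * Complex.I_sq
          + ((s ^ 2 + t ^ 2) * (c * v 0 - d * v 1)) * hε - (c * v 0 - d * v 1) * hkd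
      · simp only [Pi.smul_apply, smul_eq_mul, Pi.sub_apply, Matrix.map_apply, Matrix.of_apply,
          Matrix.cons_val_zero, Matrix.cons_val_one, Matrix.cons_val', Fin.mk_one,
          Matrix.transpose_apply, mulVec_apply_one, hw0, hw1]
        push_cast
        field_simp
        linear_combination (-Complex.I * ε * (t * v 0 - s * v 1)) * hsumc
          - (ε ^ 2 * (s ^ 2 + t ^ 2) * (d * v 0 + c * v 1)) * Complex.I_sq
          + ((s ^ 2 + t ^ 2) * (d * v 0 + c * v 1)) * hε - (d * v 0 + c * v 1) * hkd

end

end OrbitalCoherent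

/-! ### Hermite functions in `L²(ℝ²)` and the action of the metaplectic operators on them. -/

namespace OrbitalCoherent

noncomputable section

section

variable {ħ : ℝ} (hħ : 0 < ħ)

/-- The common kernel of the annihilation operators is spanned by the Gaussian. -/
theorem eq_smul_ground_of_lower {f : 𝓢(Plane, ℂ)} (hf : ∀ v, lower ħ v f = 0) :
    ∃ c : ℂ, f = c • ground hħ := by
  have hhc : (ħ : ℂ) ≠ 0 := by exact_mod_cast hħ.ne'
  -- `g` is the reciprocal of the Gaussian. The lowering equations say `∇f = -(x/ħ) f`, so `f g` has
  -- zero derivative and is constant.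
  set g : Plane → ℂ := fun x => ((Real.exp (1 / (2 * ħ) * ‖x‖ ^ 2) : ℝ) : ℂ) with hg
  have hgd (x : Plane) : HasFDerivAt g
      (Complex.ofRealCLM ∘L (Real.exp (1 / (2 * ħ) * ‖x‖ ^ 2) •
        ((1 / (2 * ħ)) • (2 • (innerSL ℝ x))))) x :=
    Complex.ofRealCLM.hasFDerivAt.comp x
      (((hasStrictFDerivAt_norm_sq x).hasFDerivAt.const_mul (1 / (2 * ħ))).exp)
  have hgg (b : Fin 2 → ℂ) (x : Plane) : gradForm b g x = 1 / ħ * linForm b x * g x := by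
    rw [gradForm, (hgd x).fderiv, linForm_apply, hg]
    simp [innerSL_apply_apply, EuclideanSpace.inner_single_right]
    field_simp
  have hfg (b : Fin 2 → ℂ) (x : Plane) : gradForm b f x = -(1 / ħ) * linForm b x * f x := by
    have h := DFunLike.congr_fun (hf b) x
    rw [lower, phaseOp_apply, _root_.zero_apply] at h
    have h2 : gradForm ((ħ : ℂ) • b) f x = ħ * gradForm b f x := by
      simp only [gradForm, Pi.smul_apply, smul_eq_mul]
      ring
    rw [h2] at h
    field_simp
    linear_combination h
  have hdiff : Differentiable ℝ (fun x => f x * g x) := fun x =>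
    f.differentiableAt.mul (hgd x).differentiableAt
  have hgrad (b : Fin 2 → ℂ) (x : Plane) : gradForm b (fun x => f x * g x) x = 0 := by
    rw [gradForm_mul b f.differentiableAt (hgd x).differentiableAt, hgg, hfg]
    ring
  have hzero (x : Plane) : fderiv ℝ (fun x => f x * g x) x = 0 := by
    ext m
    have hm : m = m 0 • EuclideanSpace.single (0 : Fin 2) (1 : ℝ)
        + m 1 • EuclideanSpace.single (1 : Fin 2) (1 : ℝ) := by
      ext j
      fin_cases j <;> simp
    rw [hm, map_add, map_smul, map_smul]
    have h := hgrad ![(m 0 : ℂ), (m 1 : ℂ)] x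
    simpa [gradForm] using h
  refine ⟨f 0, ?_⟩
  ext x
  have h := is_const_of_fderiv_eq_zero hdiff hzero x 0
  have hg0 : g 0 = 1 := by simp [hg]
  have hgx : g x * ground hħ x = 1 := by
    rw [hg, ground_apply, ← Complex.ofReal_mul, ← Real.exp_add]
    simp
  simp only [hg0, mul_one] at h
  rw [_root_.smul_apply, smul_eq_mul]
  linear_combination (-f x) * hgx + ground hħ x * h

theorem inner_hermiteL2_hermiteL2 (N : ℕ) (u v : Fin 2 → ℂ) :
    inner ℂ (hermiteL2 hħ N u) (hermiteL2 hħ N v)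
      = (2 * ħ) ^ N * N.factorial * (Real.pi * ħ) * (star u ⬝ᵥ v) ^ N := by
  rw [inner_hermiteL2, hermiteL2, integral_mul_toLp, integral_hermite_mul_hermite,
    integral_ground_mul_ground]
  ring

theorem norm_sq_hermiteL2 (N : ℕ) (v : Fin 2 → ℂ) :
    ‖hermiteL2 hħ N v‖ ^ 2 = (2 * ħ) ^ N * N.factorial * (Real.pi * ħ)
      * (Complex.normSq (v 0) + Complex.normSq (v 1)) ^ N := by
  have h := inner_self_eq_norm_sq_to_K (𝕜 := ℂ) (hermiteL2 hħ N v)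
  rw [inner_hermiteL2_hermiteL2] at h
  have h2 : star v ⬝ᵥ v = ((Complex.normSq (v 0) + Complex.normSq (v 1) : ℝ) : ℂ) := by
    rw [dotProduct, Fin.sum_univ_two, Complex.ofReal_add, Complex.normSq_eq_conj_mul_self,
      Complex.normSq_eq_conj_mul_self]
    rfl
  rw [h2] at h
  have h3 : ((RCLike.ofReal ‖hermiteL2 hħ N v‖ : ℂ)) = ((‖hermiteL2 hħ N v‖ : ℝ) : ℂ) := rfl
  rw [h3] at h
  exact_mod_cast h.symm

theorem hermiteL2_smul (N : ℕ) (c : ℂ) (v : Fin 2 → ℂ) :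
    hermiteL2 hħ N (c • v) = c ^ N • hermiteL2 hħ N v := by
  rw [hermiteL2, hermite_smul]
  exact map_smul (SchwartzMap.toLpCLM ℂ ℂ 2 volume) _ _

theorem hermiteL2_eq_sum (N : ℕ) (v : Fin 2 → ℂ) :
    hermiteL2 hħ N v = ∑ k ∈ Finset.range (N + 1),
      (v 0 ^ k * v 1 ^ (N - k) * (N.choose k : ℂ)) • ((hermiteBasis hħ N k).toLp 2 : L2) := by
  rw [hermiteL2, hermite_eq_sum]
  refine (map_sum (SchwartzMap.toLpCLM ℂ ℂ 2 volume) _ _).trans ?_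
  refine Finset.sum_congr rfl fun k _ => ?_
  exact map_smul (SchwartzMap.toLpCLM ℂ ℂ 2 volume) _ _

theorem continuous_hermiteL2 (N : ℕ) : Continuous (hermiteL2 hħ N) := by
  have h : hermiteL2 hħ N = fun v => ∑ k ∈ Finset.range (N + 1),
      (v 0 ^ k * v 1 ^ (N - k) * (N.choose k : ℂ)) • ((hermiteBasis hħ N k).toLp 2 : L2) :=
    funext (hermiteL2_eq_sum hħ N)
  rw [h]
  fun_prop

theorem complexify_rePart_add_imPart (U : SU2) :
    complexify (rePart U) + ((1 : ℂ) * Complex.I) • complexify (imPart U) = U.1 := by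
  ext i j
  simp only [Matrix.add_apply, Matrix.smul_apply, Matrix.map_apply, rePart, imPart, smul_eq_mul,
    one_mul]
  rw [mul_comm]
  exact Complex.re_add_im _

theorem complexify_rePart_sub_imPart (U : SU2) :
    complexify (rePart U) + ((-1 : ℂ) * Complex.I) • complexify (imPart U) = U.1.map star := by
  ext i j
  simp only [Matrix.add_apply, Matrix.smul_apply, Matrix.map_apply, rePart, imPart, smul_eq_mul]
  apply Complex.ext <;> simp

theorem map_star_mul_transpose (U : SU2) : U.1.map star * U.1.transpose = 1 := by
  have h : U.1 * star U.1 = 1 :=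
    (Matrix.mem_unitaryGroup_iff).mp (Matrix.mem_specialUnitaryGroup_iff.mp U.2).1
  have h2 := congrArg Matrix.transpose h
  rwa [Matrix.transpose_mul, Matrix.transpose_one] at h2

/-- Up to a phase factor, the metaplectic operators act on the Hermite functions through the
action of `SU(2)` on `ℂ²`. -/
theorem metaplectic_hermiteL2 (U : SU2) : ∃ c : ℂ, ‖c‖ = 1 ∧ ∀ N v,
    metaplectic ħ U (hermiteL2 hħ N v) = c • hermiteL2 hħ N (U.1.mulVec v) := by
  obtain ⟨S, hS, hop⟩ := exists_schwartz_metaplectic hħ U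
  have hraise (v : Fin 2 → ℂ) (f : 𝓢(Plane, ℂ)) :
      S (raise ħ v f) = raise ħ (U.1.mulVec v) (S f) := by
    have h := hop 1 (by norm_num) v (U.1.mulVec v) (by rw [complexify_rePart_add_imPart]) f
    simp only [one_mul, neg_smul] at h
    exact h
  -- As `Ū Uᵀ = 1`, every lowering operator is the image of another one, which kills the Gaussian.
  -- So the image of the Gaussian is again a multiple of it.
  have hlower (w : Fin 2 → ℂ) : lower ħ w (S (ground hħ)) = 0 := by
    have h := hop (-1) (by norm_num) (U.1.transpose.mulVec w) w (by
      rw [complexify_rePart_sub_imPart, Matrix.mulVec_mulVec, map_star_mul_transpose,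
        Matrix.one_mulVec]) (ground hħ)
    simp only [neg_mul, one_mul, neg_neg] at h
    change S (lower ħ _ _) = lower ħ _ _ at h
    rw [← h, lower_ground, map_zero]
  obtain ⟨c, hc⟩ := eq_smul_ground_of_lower hħ hlower
  have hherm (N : ℕ) (v : Fin 2 → ℂ) :
      S (hermite hħ N v) = c • hermite hħ N (U.1.mulVec v) := by
    induction N with
    | zero => rw [hermite_zero, hermite_zero, hc]
    | succ N ih => rw [hermite_succ, hraise, ih, map_smul, hermite_succ]
  have hmeta (N : ℕ) (v : Fin 2 → ℂ) :
      metaplectic ħ U (hermiteL2 hħ N v) = c • hermiteL2 hħ N (U.1.mulVec v) := by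
    rw [hermiteL2, ← hS, hherm]
    exact map_smul (SchwartzMap.toLpCLM ℂ ℂ 2 volume) _ _
  refine ⟨c, ?_, hmeta⟩
  -- In degree `0` the Hermite function does not depend on the direction, so the isometry property
  -- forces `‖c‖ = 1`.
  have h0 : hermiteL2 hħ 0 (U.1.mulVec 0) = hermiteL2 hħ 0 0 := by
    rw [hermiteL2, hermite_zero, hermiteL2, hermite_zero]
  have h1 := congrArg norm (hmeta 0 0)
  rw [LinearIsometryEquiv.norm_map, norm_smul, h0] at h1
  have h2 : ‖hermiteL2 hħ 0 0‖ ≠ 0 := by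
    have h := norm_sq_hermiteL2 hħ 0 0
    intro h3
    rw [h3] at h
    simp [hħ.ne'] at h
  exact (mul_eq_right₀ h2).mp h1.symm

/-- The coherent state of the initial orbit is a Hermite function in an isotropic direction. -/
theorem exists_coherentState_eq (N : ℕ) : ∃ κ : ℝ,
    coherentState N (ħ * (N + 1)) = (κ : ℂ) • hermiteL2 hħ N ![1, Complex.I] ∧
      -- Here `2^N = (|1|² + |i|²)^N`, so the identity says that the coherent state has norm one.
      κ ^ 2 * 2 ^ N = ((2 * ħ) ^ N * N.factorial * (Real.pi * ħ))⁻¹ := by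
  have hE : 0 < ħ * (N + 1) := by positivity
  set K : ℝ := (N + 1 : ℝ) ^ ((N + 1 : ℝ) / 2) /
    ((ħ * (N + 1)) ^ ((N + 1 : ℝ) / 2) * Real.sqrt (Real.pi * (N.factorial : ℝ))) with hK
  have hK2 : K ^ 2 = (ħ ^ (N + 1) * (Real.pi * N.factorial))⁻¹ := by
    have hp (x : ℝ) (hx : 0 ≤ x) : (x ^ ((N + 1 : ℝ) / 2)) ^ 2 = x ^ (N + 1) := by
      rw [← Real.rpow_natCast, ← Real.rpow_mul hx]
      push_cast
      rw [div_mul_cancel₀ _ two_ne_zero]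
      exact_mod_cast Real.rpow_natCast x (N + 1)
    rw [hK, div_pow, mul_pow, hp _ (by positivity), hp _ (by positivity),
      Real.sq_sqrt (by positivity), mul_pow]
    field_simp
  -- The factor `2^N` offsets the one in `hermite_isotropic`. With `E = ħ(N + 1)` the exponential is
  -- exactly the Gaussian of parameter `ħ`.
  refine ⟨K / 2 ^ N, ?_, ?_⟩
  · refine Lp.ext ?_
    filter_upwards [coherentState_ae_eq N hE, (hermite hħ N ![1, Complex.I]).coeFn_toLp 2 volume,
      Lp.coeFn_smul (((K / 2 ^ N : ℝ) : ℂ)) (hermiteL2 hħ N ![1, Complex.I])] with x h1 h2 h3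
    have hiso : (![1, Complex.I] : Fin 2 → ℂ) ⬝ᵥ ![1, Complex.I] = 0 := by
      simp [dotProduct, Fin.sum_univ_two]
    have hexp : -((N + 1 : ℝ) / (2 * (ħ * (N + 1)))) = -(1 / (2 * ħ)) := by
      field_simp
    rw [h1, h3, Pi.smul_apply, hermiteL2, h2, hermite_isotropic hħ N _ hiso, coherentFun, ← hK,
      hexp, ground_apply, linForm_apply, smul_eq_mul, mul_pow]
    simp only [Matrix.cons_val_zero, Matrix.cons_val_one, one_mul]
    push_cast
    field_simp
  · rw [div_pow, hK2]
    field_simp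
    ring

end

end

end OrbitalCoherent

/-! ### Reduction of the resolution of the projector to moments of unit vectors. -/

namespace OrbitalCoherent

noncomputable section

section

variable {ħ : ℝ} (hħ : 0 < ħ)

/-- The eigenspace is spanned by the Hermite functions of one degree. -/
theorem eigenspace_eq_span (N : ℕ) :
    eigenspace ħ N = Submodule.span ℂ (Set.range (hermiteL2 hħ N)) := by
  set W := Submodule.span ℂ (Set.range (hermiteL2 hħ N)) with hW
  have hle : W ≤ eigenspace ħ N := by
    rw [hW, Submodule.span_le]
    rintro _ ⟨v, rfl⟩
    exact hermiteL2_mem_eigenspace hħ N v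
  -- Finite dimension provides the orthogonal projection onto the span; the remainder of an
  -- eigenfunction is then orthogonal to all `h_N(v)` and vanishes.
  have hfin : FiniteDimensional ℂ W := by
    set V := Submodule.span ℂ
      (Set.range fun k : Fin (N + 1) => ((hermiteBasis hħ N k).toLp 2 : L2)) with hV
    have hVfin : FiniteDimensional ℂ V := FiniteDimensional.span_of_finite ℂ (Set.finite_range _)
    refine Submodule.finiteDimensional_of_le (S₂ := V) ?_
    rw [hW, Submodule.span_le]
    rintro _ ⟨v, rfl⟩
    rw [hermiteL2_eq_sum]
    refine Submodule.sum_mem _ fun k hk => Submodule.smul_mem _ _ (Submodule.subset_span ?_)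
    exact ⟨⟨k, Finset.mem_range.mp hk⟩, rfl⟩
  refine le_antisymm (fun f hf => ?_) hle
  have h0 : f - W.starProjection f = 0 := by
    refine eq_zero_of_mem_eigenspace hħ
      (Submodule.sub_mem _ hf (hle (W.starProjection_apply_mem f))) fun v => ?_
    rw [← inner_conj_symm, W.starProjection_inner_eq_zero _ _ (Submodule.subset_span ⟨v, rfl⟩),
      map_zero]
  rw [sub_eq_zero.mp h0]
  exact W.starProjection_apply_mem f

/-- The squared norm of the Hermite functions of degree `N` in unit directions. -/
def hermiteNormSq (ħ : ℝ) (N : ℕ) : ℝ := (2 * ħ) ^ N * N.factorial * (Real.pi * ħ)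

/-- The projector onto the line of the Hermite function in a unit direction. -/
def lineProj (N : ℕ) (v : Fin 2 → ℂ) : L2 →L[ℂ] L2 :=
  ((hermiteNormSq ħ N)⁻¹ : ℂ) •
    InnerProductSpace.rankOne ℂ (hermiteL2 hħ N v) (hermiteL2 hħ N v)

theorem lineProj_apply (N : ℕ) (v : Fin 2 → ℂ) (f : L2) :
    lineProj hħ N v f = ((hermiteNormSq ħ N)⁻¹ : ℂ) •
      (inner ℂ (hermiteL2 hħ N v) f : ℂ) • hermiteL2 hħ N v := rfl

theorem continuous_lineProj (N : ℕ) : Continuous (lineProj hħ N) := by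
  have h : Continuous fun v => InnerProductSpace.rankOne ℂ (hermiteL2 hħ N v) (hermiteL2 hħ N v) :=
    (((ContinuousLinearMap.smulRightL ℂ L2 L2).continuous.comp
      ((innerSL ℂ (E := L2)).continuous.comp (continuous_hermiteL2 hħ N))).clm_apply
        (continuous_hermiteL2 hħ N))
  exact h.const_smul ((hermiteNormSq ħ N)⁻¹ : ℂ)

theorem hermiteNormSq_pos {ħ : ℝ} (hħ : 0 < ħ) (N : ℕ) : 0 < hermiteNormSq ħ N := by
  unfold hermiteNormSq
  positivity

theorem norm_lineProj (N : ℕ) (v : Fin 2 → ℂ) :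
    ‖lineProj hħ N v‖ = (Complex.normSq (v 0) + Complex.normSq (v 1)) ^ N := by
  have h := (hermiteNormSq_pos hħ N).ne'
  rw [lineProj, norm_smul, InnerProductSpace.norm_rankOne, ← sq, norm_sq_hermiteL2, norm_inv,
    Complex.norm_real, Real.norm_of_nonneg (hermiteNormSq_pos hħ N).le]
  change (hermiteNormSq ħ N)⁻¹ * (hermiteNormSq ħ N * _) = _
  rw [← mul_assoc, inv_mul_cancel₀ h, one_mul]

theorem lineProj_smul (N : ℕ) (c : ℂ) (v : Fin 2 → ℂ) :
    lineProj hħ N (c • v) = (Complex.normSq c : ℂ) ^ N • lineProj hħ N v := by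
  ext1 f
  rw [_root_.smul_apply, lineProj_apply, lineProj_apply, hermiteL2_smul, inner_smul_left,
    Complex.normSq_eq_conj_mul_self, mul_pow, map_pow]
  module

/-- A matrix coefficient of the symmetric power of the vector `v`. -/
def moment (N k l : ℕ) (v : Fin 2 → ℂ) : ℂ :=
  star (v 0 ^ k * v 1 ^ (N - k)) * (v 0 ^ l * v 1 ^ (N - l))

theorem continuous_moment (N k l : ℕ) : Continuous (moment N k l) := by
  unfold moment
  fun_prop

theorem norm_moment_le (N k l : ℕ) {v : Fin 2 → ℂ}
    (hv : Complex.normSq (v 0) + Complex.normSq (v 1) = 1) : ‖moment N k l v‖ ≤ 1 := by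
  have h (j : Fin 2) : ‖v j‖ ≤ 1 := by
    have h0 := Complex.normSq_nonneg (v 0)
    have h1 := Complex.normSq_nonneg (v 1)
    rw [← sq_le_one_iff₀ (norm_nonneg _), ← Complex.normSq_eq_norm_sq]
    fin_cases j
    · exact (by linarith : Complex.normSq (v 0) ≤ 1)
    · exact (by linarith : Complex.normSq (v 1) ≤ 1)
  rw [moment, norm_mul, norm_star, norm_mul, norm_mul]
  simp only [norm_pow]
  refine mul_le_one₀ (mul_le_one₀ ?_ (by positivity) ?_) (by positivity)
    (mul_le_one₀ ?_ (by positivity) ?_)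
  all_goals exact pow_le_one₀ (norm_nonneg _) (h _)

/-- Both the inner product `(v̄·u)^N` and `h_N(v)` are expanded by the binomial theorem, which
confines `v` to the scalar `moment`; only scalars remain to be integrated. -/
theorem lineProj_hermiteL2 (N : ℕ) (v u : Fin 2 → ℂ) :
    lineProj hħ N v (hermiteL2 hħ N u)
      = ∑ k ∈ Finset.range (N + 1), ∑ l ∈ Finset.range (N + 1),
        moment N k l v • ((u 0 ^ k * u 1 ^ (N - k) * (N.choose k : ℂ)) • (N.choose l : ℂ) •
          ((hermiteBasis hħ N l).toLp 2 : L2)) := by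
  have h : (hermiteNormSq ħ N : ℂ) ≠ 0 := by exact_mod_cast (hermiteNormSq_pos hħ N).ne'
  have hi : (inner ℂ (hermiteL2 hħ N v) (hermiteL2 hħ N u) : ℂ)
      = hermiteNormSq ħ N * (star (v 0) * u 0 + star (v 1) * u 1) ^ N := by
    rw [inner_hermiteL2_hermiteL2, dotProduct, Fin.sum_univ_two, hermiteNormSq]
    push_cast
    rfl
  rw [lineProj_apply, hi, smul_smul, ← mul_assoc, inv_mul_cancel₀ h, one_mul, add_pow,
    hermiteL2_eq_sum, Finset.sum_smul]
  refine Finset.sum_congr rfl fun k _ => ?_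
  rw [Finset.smul_sum]
  refine Finset.sum_congr rfl fun l _ => ?_
  rw [smul_smul, smul_smul, smul_smul]
  congr 1
  rw [moment, star_mul', star_pow, star_pow]
  ring

/-- A family of unit vectors of `ℂ²` whose symmetric powers satisfy the orthogonality relations
resolves the projector onto the eigenspace. -/
theorem projector_eq_integral_lineProj {X : Type*} [MeasurableSpace X] (m : Measure X)
    [IsFiniteMeasure m] (N : ℕ) {W : X → Fin 2 → ℂ} (hW : AEStronglyMeasurable W m)
    (hunit : ∀ x, Complex.normSq (W x 0) + Complex.normSq (W x 1) = 1)
    (hmom : ∀ k ≤ N, ∀ l ≤ N, ∫ x, moment N k l (W x) ∂m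
      = if k = l then ((N + 1) * (N.choose k) : ℂ)⁻¹ else 0) :
    Integrable (fun x => lineProj hħ N (W x)) m ∧
      projector ħ N = ((N : ℂ) + 1) • ∫ x, lineProj hħ N (W x) ∂m := by
  have hint : Integrable (fun x => lineProj hħ N (W x)) m :=
    Integrable.of_bound ((continuous_lineProj hħ N).comp_aestronglyMeasurable hW) 1
      (Filter.Eventually.of_forall fun x => by
        rw [norm_lineProj, hunit, one_pow])
  have hmint (k l : ℕ) : Integrable (fun x => moment N k l (W x)) m :=
    Integrable.of_bound ((continuous_moment N k l).comp_aestronglyMeasurable hW) 1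
      (Filter.Eventually.of_forall fun x => norm_moment_le N k l (hunit x))
  refine ⟨hint, ?_⟩
  set T : L2 →L[ℂ] L2 := ((N : ℂ) + 1) • ∫ x, lineProj hħ N (W x) ∂m with hT
  have hTapply (f : L2) : T f = ((N : ℂ) + 1) • ∫ x, lineProj hħ N (W x) f ∂m := by
    rw [hT, _root_.smul_apply, ContinuousLinearMap.integral_apply hint]
  have hN : (N : ℂ) + 1 ≠ 0 := by exact_mod_cast N.succ_ne_zero
  -- The off-diagonal moments drop out, and each diagonal one cancels `N + 1` and one of the two
  -- binomial coefficients, leaving the expansion of `h_N(u)`.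
  have hTu (u : Fin 2 → ℂ) : T (hermiteL2 hħ N u) = hermiteL2 hħ N u := by
    rw [hTapply]
    simp only [lineProj_hermiteL2]
    rw [integral_finsetSum _ fun k _ => integrable_finsetSum _ fun l _ =>
      (hmint k l).smul_const _, Finset.smul_sum, hermiteL2_eq_sum]
    refine Finset.sum_congr rfl fun k hk => ?_
    rw [integral_finsetSum _ fun l _ => (hmint k l).smul_const _]
    simp only [integral_smul_const]
    rw [Finset.sum_eq_single_of_mem k hk]
    · rw [hmom k (Finset.mem_range_succ_iff.mp hk) k (Finset.mem_range_succ_iff.mp hk), if_pos rfl]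
      have hc : (N.choose k : ℂ) ≠ 0 := by
        exact_mod_cast (Nat.choose_pos (Finset.mem_range_succ_iff.mp hk)).ne'
      rw [smul_smul, smul_smul, smul_smul]
      congr 1
      field_simp
    · intro l hl hlk
      rw [hmom k (Finset.mem_range_succ_iff.mp hk) l (Finset.mem_range_succ_iff.mp hl),
        if_neg hlk.symm, zero_smul]
  have hTE (g : L2) (hg : g ∈ eigenspace ħ N) : T g = g := by
    rw [eigenspace_eq_span hħ] at hg
    induction hg using Submodule.span_induction with
    | mem g hg =>
      obtain ⟨u, rfl⟩ := hg
      exact hTu u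
    | zero => exact map_zero T
    | add a b _ _ ha hb => rw [map_add, ha, hb]
    | smul c a _ ha => rw [map_smul, ha]
  ext1 f
  set g := (eigenspace ħ N).starProjection f with hg
  -- The component orthogonal to the eigenspace is killed by each integrand separately.
  have h0 : T (f - g) = 0 := by
    rw [hTapply]
    have : ∀ x, lineProj hħ N (W x) (f - g) = 0 := fun x => by
      rw [lineProj_apply, ← inner_conj_symm,
        (eigenspace ħ N).starProjection_inner_eq_zero _ _ (hermiteL2_mem_eigenspace hħ N _),
        map_zero, zero_smul, smul_zero]
    simp only [this, integral_zero, smul_zero]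
  rw [map_sub, sub_eq_zero, hTE g ((eigenspace ħ N).starProjection_apply_mem f)] at h0
  exact h0.symm

/-- The rank one operator of a metaplectic translate of the coherent state. -/
theorem rankOne_metaplectic (N : ℕ) (U : SU2) (c : ℂ) (hc : ‖c‖ = 1) :
    InnerProductSpace.rankOne ℂ (c • metaplectic ħ U (coherentState N (ħ * (N + 1))))
        (c • metaplectic ħ U (coherentState N (ħ * (N + 1))))
      = lineProj hħ N (((Real.sqrt 2)⁻¹ : ℂ) • U.1.mulVec ![1, Complex.I]) := by
  obtain ⟨κ, hκ, hκ2⟩ := exists_coherentState_eq hħ N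
  obtain ⟨d, hd, hmeta⟩ := metaplectic_hermiteL2 hħ U
  have hcc : (starRingEnd ℂ) c * c = 1 := by
    rw [← Complex.normSq_eq_conj_mul_self, Complex.normSq_eq_norm_sq, hc]
    simp
  have hdd : (starRingEnd ℂ) d * d = 1 := by
    rw [← Complex.normSq_eq_conj_mul_self, Complex.normSq_eq_norm_sq, hd]
    simp
  have hsq : (Complex.normSq ((Real.sqrt 2)⁻¹ : ℂ) : ℂ) = 2⁻¹ := by
    rw [map_inv₀, Complex.normSq_ofReal, Real.mul_self_sqrt (by norm_num)]
    simp
  have hκc : (κ : ℂ) ^ 2 = (2⁻¹ : ℂ) ^ N * (hermiteNormSq ħ N : ℂ)⁻¹ := by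
    have h : (κ : ℂ) ^ 2 * 2 ^ N = (hermiteNormSq ħ N : ℂ)⁻¹ := by exact_mod_cast hκ2
    rw [← h, inv_pow]
    field_simp
  rw [lineProj_smul, hsq]
  ext1 f
  rw [_root_.smul_apply, lineProj_apply, InnerProductSpace.rankOne_apply, hκ, map_smul, hmeta,
    inner_smul_left, inner_smul_left, inner_smul_left, Complex.conj_ofReal]
  simp only [smul_smul]
  congr 1
  -- The phases `c` and `d` meet their conjugates, and `κ²` supplies the normalization `2^(-N)` of
  -- the vector `(1, i)/√2`.
  linear_combination (inner ℂ (hermiteL2 hħ N (U.1.mulVec ![1, Complex.I])) f : ℂ) *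
    (hκc + (κ : ℂ) ^ 2 * (hcc * ((starRingEnd ℂ) d * d)) + (κ : ℂ) ^ 2 * hdd)

end

end

end OrbitalCoherent

namespace OrbitalCoherent

noncomputable section

/-! ### Orthogonality relations on `SU(2)` -/

/-- The unit vector to which `U` maps the normalized base point of the initial orbit. -/
def orbitVec (U : SU2) : Fin 2 → ℂ := ((Real.sqrt 2)⁻¹ : ℂ) • U.1.mulVec ![1, Complex.I]

theorem orbitVec_mul (T U : SU2) : orbitVec (T * U) = T.1.mulVec (orbitVec U) := by
  rw [orbitVec, orbitVec, Matrix.mulVec_smul, Matrix.mulVec_mulVec]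
  rfl

theorem continuous_orbitVec : Continuous orbitVec := by
  have h : Continuous fun U : SU2 =>
      (U : Matrix (Fin 2) (Fin 2) ℂ).mulVec (![1, Complex.I] : Fin 2 → ℂ) :=
    continuous_subtype_val.matrix_mulVec continuous_const
  exact h.const_smul ((Real.sqrt 2)⁻¹ : ℂ)

theorem normSq_add_eq_dotProduct (v : Fin 2 → ℂ) :
    ((Complex.normSq (v 0) + Complex.normSq (v 1) : ℝ) : ℂ) = star v ⬝ᵥ v := by
  rw [dotProduct, Fin.sum_univ_two, Complex.ofReal_add, Complex.normSq_eq_conj_mul_self,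
    Complex.normSq_eq_conj_mul_self]
  rfl

theorem normSq_mulVec (U : SU2) (v : Fin 2 → ℂ) :
    Complex.normSq (U.1.mulVec v 0) + Complex.normSq (U.1.mulVec v 1)
      = Complex.normSq (v 0) + Complex.normSq (v 1) := by
  have hU : U.1.conjTranspose * U.1 = 1 :=
    (Matrix.mem_unitaryGroup_iff').mp (Matrix.mem_specialUnitaryGroup_iff.mp U.2).1
  have h : star (U.1.mulVec v) ⬝ᵥ U.1.mulVec v = star v ⬝ᵥ v := by
    rw [Matrix.star_mulVec, Matrix.dotProduct_mulVec, Matrix.vecMul_vecMul, hU, Matrix.vecMul_one]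
  rw [← normSq_add_eq_dotProduct, ← normSq_add_eq_dotProduct] at h
  exact_mod_cast h

theorem normSq_orbitVec (U : SU2) :
    Complex.normSq (orbitVec U 0) + Complex.normSq (orbitVec U 1) = 1 := by
  have h := normSq_mulVec U ![1, Complex.I]
  have h2 : Complex.normSq ((Real.sqrt 2)⁻¹ : ℂ) = 2⁻¹ := by
    rw [map_inv₀, Complex.normSq_ofReal, Real.mul_self_sqrt (by norm_num)]
  simp only [orbitVec, Pi.smul_apply, smul_eq_mul, map_mul, h2]
  rw [← mul_add, h]
  norm_num

/-- The element of `SU(2)` with a given first column. -/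
theorem exists_SU2_of_column {p q : ℂ} (h : p * star p + q * star q = 1) :
    ∃ T : SU2, ∀ v, T.1.mulVec v = ![p * v 0 - star q * v 1, q * v 0 + star p * v 1] := by
  have hmem : !![p, -star q; q, star p] ∈ Matrix.specialUnitaryGroup (Fin 2) ℂ := by
    rw [Matrix.mem_specialUnitaryGroup_iff, Matrix.mem_unitaryGroup_iff]
    constructor
    · ext i j
      fin_cases i <;> fin_cases j <;>
        simp [Matrix.mul_apply, Fin.sum_univ_two, Matrix.star_apply] <;>
        simp only [← starRingEnd_apply] at * <;> first | linear_combination h | ring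
    · rw [Matrix.det_fin_two_of]
      linear_combination h
  refine ⟨⟨_, hmem⟩, fun v => ?_⟩
  funext j
  fin_cases j
  · change Matrix.mulVec _ v 0 = _
    rw [mulVec_apply_zero]
    simp
    ring
  · change Matrix.mulVec _ v 1 = _
    rw [mulVec_apply_one]
    simp

/-- Left invariance of the Haar measure, transported by `orbitVec`. Applied to well chosen `T`, it
replaces Schur's lemma. -/
theorem integral_moment_mulVec (N k l : ℕ) (T : SU2) :
    ∫ U, moment N k l (T.1.mulVec (orbitVec U)) ∂haarSU2
      = ∫ U, moment N k l (orbitVec U) ∂haarSU2 := by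
  simp only [← orbitVec_mul]
  exact integral_mul_left_eq_self (fun U => moment N k l (orbitVec U)) T

theorem integrable_moment (N k l : ℕ) :
    Integrable (fun U => moment N k l (orbitVec U)) haarSU2 :=
  Integrable.of_bound ((continuous_moment N k l).comp continuous_orbitVec).aestronglyMeasurable 1
    (Filter.Eventually.of_forall fun U => norm_moment_le N k l (normSq_orbitVec U))

/-- The effect of a diagonal phase on the moments. -/
theorem moment_phase (N k l : ℕ) (hk : k ≤ N) (hl : l ≤ N) (α β : ℝ) (v : Fin 2 → ℂ) :
    moment N k l ![Complex.exp (α * Complex.I) * v 0, Complex.exp (β * Complex.I) * v 1]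
      = Complex.exp (((α - β) * (l - k) : ℝ) * Complex.I) * moment N k l v := by
  have hstar (t : ℝ) : star (Complex.exp (t * Complex.I)) = Complex.exp (-t * Complex.I) := by
    change (starRingEnd ℂ) _ = _
    rw [← Complex.exp_conj]
    simp
  have e : Complex.exp (((α - β) * (l - k) : ℝ) * Complex.I)
      = Complex.exp (-α * Complex.I) ^ k * Complex.exp (-β * Complex.I) ^ (N - k)
        * (Complex.exp (α * Complex.I) ^ l * Complex.exp (β * Complex.I) ^ (N - l)) := by
    rw [← Complex.exp_nat_mul, ← Complex.exp_nat_mul, ← Complex.exp_nat_mul,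
      ← Complex.exp_nat_mul, ← Complex.exp_add, ← Complex.exp_add, ← Complex.exp_add]
    congr 1
    push_cast [hk, hl]
    ring
  rw [e, moment, moment]
  simp only [Matrix.cons_val_zero, Matrix.cons_val_one, mul_pow, star_mul', star_pow, hstar]
  ring

theorem exp_pi_div_mul {d : ℝ} (hd : d ≠ 0) :
    Complex.exp ((Real.pi / d * d : ℝ) * Complex.I) = -1 := by
  rw [div_mul_cancel₀ _ hd, Complex.exp_pi_mul_I]

theorem integral_moment_eq_zero {N k l : ℕ} (hk : k ≤ N) (hl : l ≤ N) (hkl : k ≠ l) :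
    ∫ U, moment N k l (orbitVec U) ∂haarSU2 = 0 := by
  have hd : (2 * ((l : ℝ) - k)) ≠ 0 := by
    refine mul_ne_zero two_ne_zero (sub_ne_zero.mpr ?_)
    exact_mod_cast hkl.symm
  -- Chosen so that `T = diag(e^{iθ}, e^{-iθ})` multiplies the moment by `e^{2iθ(l-k)} = -1`.
  set θ : ℝ := Real.pi / (2 * ((l : ℝ) - k)) with hθ
  have hst : star (Complex.exp (θ * Complex.I)) = Complex.exp ((-θ : ℝ) * Complex.I) := by
    change (starRingEnd ℂ) _ = _
    rw [← Complex.exp_conj]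
    simp
  obtain ⟨T, hT⟩ := exists_SU2_of_column (p := Complex.exp (θ * Complex.I)) (q := 0) (by
    rw [hst, ← Complex.exp_add]
    simp)
  have h := integral_moment_mulVec N k l T
  have hv (v : Fin 2 → ℂ) : moment N k l (T.1.mulVec v) = -moment N k l v := by
    rw [hT, hst]
    simp only [star_zero, zero_mul, sub_zero, zero_add]
    rw [moment_phase N k l hk hl]
    have : (θ - -θ) * ((l : ℝ) - k) = Real.pi / (2 * ((l : ℝ) - k)) * (2 * ((l : ℝ) - k)) := by
      rw [← hθ]
      ring
    rw [this, exp_pi_div_mul hd]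
    ring
  simp only [hv, integral_neg] at h
  exact self_eq_neg.mp h.symm

theorem moment_top_rotation (N : ℕ) (c s : ℝ) (v : Fin 2 → ℂ) :
    moment N N N ![c * v 0 - s * v 1, s * v 0 + c * v 1]
      = ∑ k ∈ Finset.range (N + 1), ∑ l ∈ Finset.range (N + 1),
        ((c : ℂ) ^ k * (-s) ^ (N - k) * N.choose k * (c ^ l * (-s) ^ (N - l) * N.choose l))
          * moment N k l v := by
  have h1 : ((c : ℂ) * v 0 - s * v 1) ^ N = ∑ l ∈ Finset.range (N + 1),
      (c : ℂ) ^ l * (-s) ^ (N - l) * N.choose l * (v 0 ^ l * v 1 ^ (N - l)) := by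
    rw [sub_eq_add_neg, ← neg_mul, add_pow]
    refine Finset.sum_congr rfl fun l _ => ?_
    rw [mul_pow, mul_pow]
    ring
  have h2 : star (((c : ℂ) * v 0 - s * v 1) ^ N) = ∑ k ∈ Finset.range (N + 1),
      (c : ℂ) ^ k * (-s) ^ (N - k) * N.choose k * star (v 0 ^ k * v 1 ^ (N - k)) := by
    rw [h1, star_sum]
    refine Finset.sum_congr rfl fun k _ => ?_
    simp [mul_comm, mul_left_comm]
  rw [moment]
  simp only [Matrix.cons_val_zero, Matrix.cons_val_one, Nat.sub_self, pow_zero, mul_one]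
  rw [h2, h1, Finset.sum_mul_sum]
  refine Finset.sum_congr rfl fun k _ => Finset.sum_congr rfl fun l _ => ?_
  rw [moment]
  ring

/-- Invariance of the top moment under a real rotation: after expansion, the off-diagonal integrals
vanish and only this relation between the diagonal ones is left. -/
theorem sum_choose_sq_mul_integral_moment (N : ℕ) {c s : ℝ} (h : c ^ 2 + s ^ 2 = 1) :
    ∑ k ∈ Finset.range (N + 1), ((c : ℂ) ^ 2) ^ k * ((s : ℂ) ^ 2) ^ (N - k) * N.choose k ^ 2
        * ∫ U, moment N k k (orbitVec U) ∂haarSU2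
      = ∫ U, moment N N N (orbitVec U) ∂haarSU2 := by
  obtain ⟨T, hT⟩ := exists_SU2_of_column (p := (c : ℂ)) (q := (s : ℂ)) (by
    change (c : ℂ) * (starRingEnd ℂ) c + s * (starRingEnd ℂ) s = 1
    rw [Complex.conj_ofReal, Complex.conj_ofReal, ← sq, ← sq]
    exact_mod_cast h)
  rw [← integral_moment_mulVec N N N T]
  have hT' (v : Fin 2 → ℂ) : T.1.mulVec v = ![c * v 0 - s * v 1, s * v 0 + c * v 1] := by
    have hcs : star (c : ℂ) = c := Complex.conj_ofReal c
    have hss : star (s : ℂ) = s := Complex.conj_ofReal s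
    rw [hT, hcs, hss]
  simp only [hT', moment_top_rotation]
  rw [integral_finsetSum _ fun k _ => integrable_finsetSum _ fun l _ =>
    (integrable_moment N k l).const_mul _]
  refine Finset.sum_congr rfl fun k hk => ?_
  rw [integral_finsetSum _ fun l _ => (integrable_moment N k l).const_mul _]
  simp only [integral_const_mul]
  rw [Finset.sum_eq_single_of_mem k hk]
  · have hs2 : ((s : ℂ) ^ 2) ^ (N - k) = (-(s : ℂ)) ^ (N - k) * (-(s : ℂ)) ^ (N - k) := by
      rw [← mul_pow, neg_mul_neg, sq]
    rw [hs2]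
    ring
  · intro l hl hlk
    rw [integral_moment_eq_zero (Finset.mem_range_succ_iff.mp hk)
      (Finset.mem_range_succ_iff.mp hl) hlk.symm, mul_zero]

/-- With `c² = r/(1+r)` and `s² = 1/(1+r)`, the rotation identity reads `∑ binom(N,k)² I_k r^k =
(1+r)^N I_N` for all `r ≥ 0`. Coefficients of the two polynomials in `r` are then compared. -/
theorem choose_mul_integral_moment {N k : ℕ} (hk : k ≤ N) :
    (N.choose k : ℂ) * ∫ U, moment N k k (orbitVec U) ∂haarSU2
      = ∫ U, moment N N N (orbitVec U) ∂haarSU2 := by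
  set I : ℕ → ℂ := fun k => ∫ U, moment N k k (orbitVec U) ∂haarSU2 with hI
  set P : Polynomial ℂ := ∑ k ∈ Finset.range (N + 1),
    Polynomial.monomial k ((N.choose k : ℂ) ^ 2 * I k - N.choose k * I N) with hP
  have hroot (r : ℝ) (hr : 0 ≤ r) : P.IsRoot (r : ℂ) := by
    have h1r : (1 : ℂ) + r ≠ 0 := by
      have : (1 + r : ℝ) ≠ 0 := by positivity
      exact_mod_cast this
    have hs := sum_choose_sq_mul_integral_moment N
      (c := Real.sqrt (r / (1 + r))) (s := Real.sqrt (1 / (1 + r))) (by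
        rw [Real.sq_sqrt (by positivity), Real.sq_sqrt (by positivity)]
        field_simp
        ring)
    have hc2 : ((Real.sqrt (r / (1 + r)) : ℝ) : ℂ) ^ 2 = r / (1 + r) := by
      rw [← Complex.ofReal_pow, Real.sq_sqrt (by positivity)]
      push_cast
      rfl
    have hs2 : ((Real.sqrt (1 / (1 + r)) : ℝ) : ℂ) ^ 2 = 1 / (1 + r) := by
      rw [← Complex.ofReal_pow, Real.sq_sqrt (by positivity)]
      push_cast
      rfl
    rw [hc2, hs2] at hs
    have hmul : ∑ k ∈ Finset.range (N + 1), (N.choose k : ℂ) ^ 2 * I k * (r : ℂ) ^ k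
        = (1 + r) ^ N * I N := by
      change _ = (1 + (r : ℂ)) ^ N * ∫ U, moment N N N (orbitVec U) ∂haarSU2
      rw [← hs, Finset.mul_sum]
      refine Finset.sum_congr rfl fun k hk => ?_
      have hsplit : (1 + (r : ℂ)) ^ N = (1 + r) ^ k * (1 + r) ^ (N - k) := by
        rw [← pow_add, Nat.add_sub_cancel' (Finset.mem_range_succ_iff.mp hk)]
      rw [hsplit, div_pow, div_pow, one_pow]
      field_simp
      simp only [hI]
      ring
    have hbin : (1 + (r : ℂ)) ^ N = ∑ k ∈ Finset.range (N + 1), (r : ℂ) ^ k * N.choose k := by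
      rw [add_comm, add_pow]
      simp
    rw [Polynomial.IsRoot, hP, Polynomial.eval_finsetSum]
    simp only [Polynomial.eval_monomial]
    rw [hbin, Finset.sum_mul] at hmul
    rw [← sub_eq_zero.mpr hmul, ← Finset.sum_sub_distrib]
    refine Finset.sum_congr rfl fun k _ => ?_
    ring
  have hzero : P = 0 := by
    refine Polynomial.eq_zero_of_infinite_isRoot P ?_
    refine Set.Infinite.mono (s := Complex.ofReal '' Set.Ici 0) ?_ ?_
    · rintro _ ⟨r, hr, rfl⟩
      exact hroot r hr
    · exact (Set.Ici_infinite 0).image Complex.ofReal_injective.injOn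
  have hcoeff := congrArg (fun p => Polynomial.coeff p k) hzero
  simp only [hP, Polynomial.finsetSum_coeff, Polynomial.coeff_monomial, Polynomial.coeff_zero]
    at hcoeff
  rw [Finset.sum_ite_eq' , if_pos (Finset.mem_range_succ_iff.mpr hk)] at hcoeff
  have hc : (N.choose k : ℂ) ≠ 0 := by exact_mod_cast (Nat.choose_pos hk).ne'
  have h2 : (N.choose k : ℂ) * (N.choose k * I k - I N) = 0 := by linear_combination hcoeff
  exact sub_eq_zero.mp ((mul_eq_zero.mp h2).resolve_left hc)

theorem sum_choose_mul_moment (N : ℕ) {v : Fin 2 → ℂ}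
    (hv : Complex.normSq (v 0) + Complex.normSq (v 1) = 1) :
    ∑ k ∈ Finset.range (N + 1), (N.choose k : ℂ) * moment N k k v = 1 := by
  have h : ((Complex.normSq (v 0) : ℂ) + Complex.normSq (v 1)) ^ N = 1 := by
    rw [← Complex.ofReal_add, hv, Complex.ofReal_one, one_pow]
  rw [← h, add_pow]
  refine Finset.sum_congr rfl fun k _ => ?_
  rw [moment, Complex.normSq_eq_conj_mul_self, Complex.normSq_eq_conj_mul_self, mul_pow, mul_pow,
    star_mul', star_pow, star_pow]
  simp only [starRingEnd_apply]
  ring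

/-- The `N + 1` numbers `binom(N,k) I_k` are all equal, and they add up to the integral of `(|v₀|² +
|v₁|²)^N = 1`. -/
theorem integral_moment_haarSU2 (N : ℕ) : ∀ k ≤ N, ∀ l ≤ N,
    ∫ U, moment N k l (orbitVec U) ∂haarSU2
      = if k = l then ((N + 1) * (N.choose k) : ℂ)⁻¹ else 0 := by
  intro k hk l hl
  split_ifs with h
  · subst h
    have hN : ((N : ℂ) + 1) * ∫ U, moment N N N (orbitVec U) ∂haarSU2 = 1 := by
      have h1 : ∫ U, ∑ k ∈ Finset.range (N + 1), (N.choose k : ℂ) * moment N k k (orbitVec U)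
          ∂haarSU2 = 1 := by
        simp [sum_choose_mul_moment N (normSq_orbitVec _)]
      rw [integral_finsetSum _ fun k _ => (integrable_moment N k k).const_mul _] at h1
      simp only [integral_const_mul] at h1
      rw [Finset.sum_congr rfl fun k hk =>
        choose_mul_integral_moment (Finset.mem_range_succ_iff.mp hk)] at h1
      simpa using h1
    rw [← choose_mul_integral_moment hk, ← mul_assoc] at hN
    exact eq_inv_of_mul_eq_one_right hN
  · exact integral_moment_eq_zero hk hl h

end

end OrbitalCoherent

namespace OrbitalCoherent

noncomputable section

/-! ### Orthogonality relations on the projective line -/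

/-- The density of the Fubini-Study measure in the affine chart. -/
def fsDensity (w : ℂ) : ℝ := 1 / (Real.pi * (1 + ‖w‖ ^ 2) ^ 2)

/-- The unit vector over the point `[1 : w]`. -/
def chartVec (w : ℂ) : Fin 2 → ℂ := ((Real.sqrt (1 + ‖w‖ ^ 2))⁻¹ : ℂ) • ![1, w]

theorem fsDensity_nonneg (w : ℂ) : 0 ≤ fsDensity w := by
  unfold fsDensity
  positivity

theorem continuous_fsDensity : Continuous fsDensity := by
  unfold fsDensity
  exact continuous_const.div (by fun_prop) fun w => by positivity

theorem continuous_chartVec : Continuous chartVec := by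
  unfold chartVec
  refine Continuous.smul (f := fun w : ℂ => ((Real.sqrt (1 + ‖w‖ ^ 2))⁻¹ : ℂ)) ?_ ?_
  · refine Continuous.inv₀ (by fun_prop) fun w => ?_
    exact_mod_cast (Real.sqrt_pos.mpr (by positivity : (0 : ℝ) < 1 + ‖w‖ ^ 2)).ne'
  · refine continuous_pi fun j => ?_
    fin_cases j
    · exact continuous_const
    · exact continuous_id

theorem integrable_fsDensity : Integrable fsDensity := by
  have h := integrable_rpow_neg_one_add_norm_sq (E := ℂ) (μ := volume) (r := 4)
    (by rw [Complex.finrank_real_complex]; norm_num)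
  refine (h.const_mul (1 / Real.pi)).congr (Filter.Eventually.of_forall fun w => ?_)
  have h4 : (-(4 : ℝ) / 2) = ((-2 : ℤ) : ℝ) := by norm_num
  simp only [fsDensity, h4, Real.rpow_intCast]
  rw [zpow_neg]
  field_simp

theorem normSq_chartVec (w : ℂ) :
    Complex.normSq (chartVec w 0) + Complex.normSq (chartVec w 1) = 1 := by
  have h : (0 : ℝ) < 1 + ‖w‖ ^ 2 := by positivity
  have h2 : Complex.normSq ((Real.sqrt (1 + ‖w‖ ^ 2))⁻¹ : ℂ) = (1 + ‖w‖ ^ 2)⁻¹ := by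
    rw [map_inv₀, Complex.normSq_ofReal, Real.mul_self_sqrt h.le]
  simp only [chartVec, Pi.smul_apply, smul_eq_mul, map_mul, h2, Matrix.cons_val_zero,
    Matrix.cons_val_one, Complex.normSq_one]
  rw [Complex.normSq_eq_norm_sq]
  field_simp

theorem moment_chartVec (N k l : ℕ) (hk : k ≤ N) (hl : l ≤ N) (w : ℂ) :
    moment N k l (chartVec w)
      = (((1 + ‖w‖ ^ 2) ^ N)⁻¹ : ℝ) * (star (w ^ (N - k)) * w ^ (N - l)) := by
  have h : (0 : ℝ) < 1 + ‖w‖ ^ 2 := by positivity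
  set s : ℂ := ((Real.sqrt (1 + ‖w‖ ^ 2))⁻¹ : ℂ) with hs
  have hss : star s = s := by
    rw [hs, ← Complex.ofReal_inv]
    exact Complex.conj_ofReal _
  have h2 : s ^ 2 = ((1 + ‖w‖ ^ 2)⁻¹ : ℝ) := by
    rw [hs, ← Complex.ofReal_inv, ← Complex.ofReal_pow, inv_pow, Real.sq_sqrt h.le]
  have h3 : (((1 + ‖w‖ ^ 2) ^ N)⁻¹ : ℝ) = s ^ k * s ^ (N - k) * (s ^ l * s ^ (N - l)) := by
    rw [← pow_add, ← pow_add, Nat.add_sub_cancel' hk, Nat.add_sub_cancel' hl, ← mul_pow, ← sq, h2]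
    push_cast
    rw [inv_pow]
  rw [h3, moment, chartVec]
  simp only [Pi.smul_apply, smul_eq_mul, Matrix.cons_val_zero, Matrix.cons_val_one, mul_one,
    mul_pow, star_mul', star_pow, ← hs, hss]
  ring

theorem integral_chart_moment_eq_zero {N k l : ℕ} (hk : k ≤ N) (hl : l ≤ N) (hkl : k ≠ l) :
    ∫ w : ℂ, fsDensity w • moment N k l (chartVec w) = 0 := by
  have hd : ((k : ℝ) - l) ≠ 0 := sub_ne_zero.mpr (by exact_mod_cast hkl)
  -- Rotating `w` by `θ` preserves the density and Lebesgue measure and multiplies the moment by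
  -- `e^{iθ(k-l)} = -1`.
  set θ : ℝ := Real.pi / ((k : ℝ) - l) with hθ
  set u : ℂ := Complex.exp (θ * Complex.I) with hu
  have hun : ‖u‖ = 1 := Complex.norm_exp_ofReal_mul_I θ
  set R : ℂ ≃ₗᵢ[ℝ] ℂ := rotation ⟨u, by simp [Submonoid.unitSphere, hun]⟩ with hR
  have hRw (w : ℂ) : R w = u * w := rotation_apply _ _
  have hfun (w : ℂ) : fsDensity (R w) • moment N k l (chartVec (R w))
      = -(fsDensity w • moment N k l (chartVec w)) := by
    have hnorm : ‖R w‖ = ‖w‖ := R.norm_map w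
    have hvec : chartVec (R w) = ![Complex.exp ((0 : ℝ) * Complex.I) * chartVec w 0,
        Complex.exp (θ * Complex.I) * chartVec w 1] := by
      funext j
      fin_cases j
      · simp [chartVec, hnorm]
      · simp [chartVec, hRw, hu]
        ring
    have e : (0 - θ) * ((l : ℝ) - k) = Real.pi / ((k : ℝ) - l) * ((k : ℝ) - l) := by
      rw [← hθ]
      ring
    rw [hvec, moment_phase N k l hk hl, e, exp_pi_div_mul hd, fsDensity, hnorm, fsDensity]
    rw [neg_one_mul, smul_neg]
  have h := R.measurePreserving.integral_comp R.toHomeomorph.measurableEmbedding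
    (fun w => fsDensity w • moment N k l (chartVec w))
  simp only [hfun, integral_neg] at h
  exact self_eq_neg.mp h.symm

/-- The radial integrals of the diagonal moments. -/
theorem integral_radial (N j : ℕ) (hj : j ≤ N) :
    IntegrableOn (fun r : ℝ => r ^ (2 * j + 1) / (1 + r ^ 2) ^ (N + 2)) (Set.Ioi 0) ∧
      ∫ r in Set.Ioi (0 : ℝ), r ^ (2 * j + 1) / (1 + r ^ 2) ^ (N + 2)
        = (2 * ((N + 1) * N.choose j : ℝ))⁻¹ := by
  have hinv (m : ℕ) : Filter.Tendsto (fun r : ℝ => ((1 + r ^ 2) ^ (m + 1))⁻¹) Filter.atTop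
      (nhds 0) := by
    refine Filter.Tendsto.inv_tendsto_atTop ?_
    refine (Filter.tendsto_pow_atTop m.succ_ne_zero).comp ?_
    exact Filter.tendsto_atTop_add_const_left _ _ (Filter.tendsto_pow_atTop two_ne_zero)
  have hder (m : ℕ) (r : ℝ) : HasDerivAt (fun r : ℝ => ((1 + r ^ 2) ^ (m + 1))⁻¹)
      (-(2 * (m + 1)) * (r / (1 + r ^ 2) ^ (m + 2))) r := by
    have hp : (0 : ℝ) < 1 + r ^ 2 := by positivity
    have h := (((hasDerivAt_pow 2 r).const_add 1).pow (m + 1)).inv (pow_ne_zero _ hp.ne')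
    refine h.congr_deriv ?_
    simp only [Pi.pow_apply, Nat.add_sub_cancel]
    push_cast
    field_simp
    ring
  have hbase (m : ℕ) : IntegrableOn (fun r : ℝ => r / (1 + r ^ 2) ^ (m + 2)) (Set.Ioi 0) := by
    have h := integrableOn_Ioi_deriv_of_nonneg' (a := 0) (l := 0)
      (g := fun r : ℝ => -((1 + r ^ 2) ^ (m + 1))⁻¹)
      (g' := fun r : ℝ => -(-(2 * (m + 1)) * (r / (1 + r ^ 2) ^ (m + 2))))
      (fun r _ => (hder m r).neg) (fun r (hr : 0 < r) => by
        have : 0 ≤ 2 * (m + 1) * (r / (1 + r ^ 2) ^ (m + 2)) := by positivity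
        linarith) (by simpa using (hinv m).neg)
    have h2 := h.const_mul ((2 * (m + 1) : ℝ)⁻¹)
    refine h2.congr (Filter.Eventually.of_forall fun r => ?_)
    field_simp
  have hint (j : ℕ) (hj : j ≤ N) :
      IntegrableOn (fun r : ℝ => r ^ (2 * j + 1) / (1 + r ^ 2) ^ (N + 2)) (Set.Ioi 0) := by
    refine Integrable.mono' (hbase 0) ?_ ?_
    · refine Continuous.aestronglyMeasurable ?_
      exact (by fun_prop : Continuous fun r : ℝ => r ^ (2 * j + 1)).div (by fun_prop)
        fun r => by positivity
    · refine (ae_restrict_iff' measurableSet_Ioi).mpr (Filter.Eventually.of_forall fun r hr => ?_)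
      have hr0 : (0 : ℝ) < r := hr
      rw [Real.norm_of_nonneg (by positivity), zero_add, div_le_div_iff₀ (by positivity)
        (by positivity)]
      -- For `j ≤ N` the integrand is dominated by `r/(1+r²)²`, which has an explicit primitive.
      have h1 : (r ^ 2) ^ j ≤ (1 + r ^ 2) ^ N :=
        (pow_le_pow_left₀ (by positivity) (by linarith) j).trans
          (pow_le_pow_right₀ (by nlinarith) hj)
      calc r ^ (2 * j + 1) * (1 + r ^ 2) ^ 2 = r * (1 + r ^ 2) ^ 2 * (r ^ 2) ^ j := by ring
        _ ≤ r * (1 + r ^ 2) ^ 2 * (1 + r ^ 2) ^ N := by gcongr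
        _ = r * (1 + r ^ 2) ^ (N + 2) := by ring
  refine ⟨hint j hj, ?_⟩
  induction j with
  | zero =>
    have h := integral_Ioi_of_hasDerivAt_of_tendsto' (a := 0) (m := 0)
      (f := fun r : ℝ => ((1 + r ^ 2) ^ (N + 1))⁻¹)
      (fun r _ => hder N r) ((hbase N).const_mul _) (hinv N)
    rw [integral_const_mul] at h
    simp only [mul_zero, zero_add, pow_one, Nat.choose_zero_right, Nat.cast_one, mul_one]
    have hN : (2 * (N + 1) : ℝ) ≠ 0 := by positivity
    refine eq_inv_of_mul_eq_one_left ?_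
    simp at h
    linarith
  | succ j ih =>
    have ih' := ih (by omega)
    -- `G` vanishes at `0` and at infinity, so integrating `G'` gives `(N - j) I_{j+1} = (j + 1)
    -- I_j`, the recursion of the reciprocal binomial coefficients.
    set G : ℝ → ℝ := fun r => r ^ (2 * j + 2) * ((1 + r ^ 2) ^ (N + 1))⁻¹ with hG
    have hGd (r : ℝ) : HasDerivAt G ((2 * (j + 1)) * (r ^ (2 * j + 1) / (1 + r ^ 2) ^ (N + 2))
        - (2 * (N - j)) * (r ^ (2 * (j + 1) + 1) / (1 + r ^ 2) ^ (N + 2))) r := by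
      have hp : (0 : ℝ) < 1 + r ^ 2 := by positivity
      have h := (hasDerivAt_pow (2 * j + 2) r).mul (hder N r)
      refine h.congr_deriv ?_
      have : 2 * j + 2 - 1 = 2 * j + 1 := by omega
      rw [this]
      push_cast
      field_simp
      ring
    have hGt : Filter.Tendsto G Filter.atTop (nhds 0) := by
      refine squeeze_zero' (g := fun r : ℝ => ((1 + r ^ 2) ^ (0 + 1))⁻¹)
        (Filter.Eventually.of_forall fun r => ?_) (Filter.Eventually.of_forall fun r => ?_) (hinv 0)
      · have : r ^ (2 * j + 2) = (r ^ (j + 1)) ^ 2 := by ring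
        simp only [hG, this]
        positivity
      · have hp : (1 : ℝ) ≤ 1 + r ^ 2 := by nlinarith [sq_nonneg r]
        have h1 : (r ^ 2) ^ (j + 1) ≤ (1 + r ^ 2) ^ N :=
          (pow_le_pow_left₀ (by positivity) (by linarith) _).trans (pow_le_pow_right₀ hp hj)
        simp only [hG]
        rw [zero_add, pow_one, ← div_eq_mul_inv, div_le_iff₀ (by positivity),
          pow_succ' (1 + r ^ 2), inv_mul_cancel_left₀ (by positivity)]
        calc r ^ (2 * j + 2) = (r ^ 2) ^ (j + 1) := by ring
          _ ≤ _ := h1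
    have i1 := (hint j (by omega)).const_mul (2 * ((j : ℝ) + 1))
    have i2 := (hint (j + 1) hj).const_mul (2 * ((N : ℝ) - j))
    have h := integral_Ioi_of_hasDerivAt_of_tendsto' (a := 0) (fun r _ => hGd r) (i1.sub i2) hGt
    rw [integral_sub i1 i2, integral_const_mul, integral_const_mul, ih'] at h
    have hG0 : G 0 = 0 := by simp [hG]
    rw [hG0, sub_zero] at h
    have hch : (N.choose (j + 1) : ℝ) * (j + 1) = N.choose j * (N - j) := by
      have := Nat.choose_succ_right_eq N j
      have hjN : j ≤ N := by omega
      have h' := congrArg (fun n : ℕ => (n : ℝ)) this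
      push_cast [hjN] at h'
      exact h'
    have hc0 : (0 : ℝ) < N.choose j := by exact_mod_cast Nat.choose_pos (by omega : j ≤ N)
    have hc1 : (0 : ℝ) < N.choose (j + 1) := by exact_mod_cast Nat.choose_pos hj
    have hNj : (0 : ℝ) < N - j := by
      have : (j : ℝ) + 1 ≤ N := by exact_mod_cast hj
      linarith
    have hj1 : (0 : ℝ) < (j : ℝ) + 1 := by positivity
    set I := ∫ r in Set.Ioi (0 : ℝ), r ^ (2 * (j + 1) + 1) / (1 + r ^ 2) ^ (N + 2)
    refine eq_inv_of_mul_eq_one_left ?_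
    have h3 : 2 * ((N : ℝ) - j) * I * N.choose j * (N + 1) = j + 1 := by
      have h4 : 2 * ((N : ℝ) - j) * I
          = 2 * ((j : ℝ) + 1) * (2 * ((N + 1) * N.choose j : ℝ))⁻¹ := by linarith
      rw [h4]
      field_simp
    have h5 : ((j : ℝ) + 1) * (I * (2 * ((N + 1) * N.choose (j + 1)))) = j + 1 := by
      linear_combination h3 + 2 * I * (N + 1) * hch
    exact (mul_eq_left₀ hj1.ne').mp h5

/-- In polar coordinates the diagonal case is `integral_radial` with `j = N - k`; the angle
contributes `2π`, which cancels the `1/π` of the density and the `1/2` of the radial integral. -/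
theorem integral_chart_moment (N : ℕ) : ∀ k ≤ N, ∀ l ≤ N,
    ∫ w : ℂ, fsDensity w • moment N k l (chartVec w)
      = if k = l then ((N + 1) * (N.choose k) : ℂ)⁻¹ else 0 := by
  intro k hk l hl
  split_ifs with h
  · subst h
    have hf (w : ℂ) : fsDensity w • moment N k k (chartVec w)
        = (((Real.pi)⁻¹ * (‖w‖ ^ (2 * (N - k)) / (1 + ‖w‖ ^ 2) ^ (N + 2)) : ℝ) : ℂ) := by
      have hp : (0 : ℝ) < 1 + ‖w‖ ^ 2 := by positivity
      have hw : star (w ^ (N - k)) * w ^ (N - k) = ((‖w‖ ^ (2 * (N - k)) : ℝ) : ℂ) := by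
        change (starRingEnd ℂ) _ * _ = _
        rw [← Complex.normSq_eq_conj_mul_self, Complex.normSq_eq_norm_sq, norm_pow, ← pow_mul,
          mul_comm]
      rw [moment_chartVec N k k hk hk, hw, fsDensity, Complex.real_smul, ← Complex.ofReal_mul,
        ← Complex.ofReal_mul]
      congr 1
      field_simp
      ring
    simp only [hf]
    rw [integral_complex_ofReal, integral_const_mul, ← Complex.integral_comp_polarCoord_symm,
      polarCoord_target, Measure.volume_eq_prod]
    have hpol : ∀ p : ℝ × ℝ, p ∈ Set.Ioi (0 : ℝ) ×ˢ Set.Ioo (-Real.pi) Real.pi →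
        p.1 • (‖Complex.polarCoord.symm p‖ ^ (2 * (N - k)) /
          (1 + ‖Complex.polarCoord.symm p‖ ^ 2) ^ (N + 2))
        = p.1 ^ (2 * (N - k) + 1) / (1 + p.1 ^ 2) ^ (N + 2) * 1 := by
      intro p hp
      have hp0 : 0 < p.1 := hp.1
      rw [Complex.norm_polarCoord_symm, abs_of_pos hp0, smul_eq_mul]
      ring
    rw [setIntegral_congr_fun (measurableSet_Ioi.prod measurableSet_Ioo) hpol,
      setIntegral_prod_mul (fun r : ℝ => r ^ (2 * (N - k) + 1) / (1 + r ^ 2) ^ (N + 2))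
        (fun _ => (1 : ℝ)), (integral_radial N (N - k) (Nat.sub_le N k)).2]
    have hpi := Real.pi_pos
    have hc : (N.choose k : ℝ) ≠ 0 := by exact_mod_cast (Nat.choose_pos hk).ne'
    have h1 : Real.pi⁻¹ * ((2 * ((N + 1) * N.choose (N - k) : ℝ))⁻¹ *
        ∫ _ in Set.Ioo (-Real.pi) Real.pi, (1 : ℝ)) = ((N + 1) * N.choose k : ℝ)⁻¹ := by
      rw [Nat.choose_symm hk, setIntegral_const, Real.volume_real_Ioo_of_le (by linarith)]
      simp only [smul_eq_mul, mul_one]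
      field_simp
      ring
    rw [h1]
    push_cast
    rfl
  · exact integral_chart_moment_eq_zero hk hl h

end

end OrbitalCoherent

namespace OrbitalCoherent

noncomputable section

/-! ### The resolution of the projector over the projective line -/

/-- The Fubini-Study measure in the affine chart. -/
def fsMeasure : Measure ℂ := volume.withDensity fun w => ENNReal.ofReal (fsDensity w)

instance : IsFiniteMeasure fsMeasure :=
  isFiniteMeasure_withDensity_ofReal integrable_fsDensity.2

theorem fubiniStudy_eq_map : fubiniStudy = fsMeasure.map chart := rfl

theorem integral_fsMeasure_moment (N : ℕ) : ∀ k ≤ N, ∀ l ≤ N,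
    ∫ w, moment N k l (chartVec w) ∂fsMeasure
      = if k = l then ((N + 1) * (N.choose k) : ℂ)⁻¹ else 0 := by
  intro k hk l hl
  rw [← integral_chart_moment N k hk l hl, fsMeasure,
    integral_withDensity_eq_integral_toReal_smul continuous_fsDensity.measurable.ennreal_ofReal
      (Filter.Eventually.of_forall fun _ => ENNReal.ofReal_lt_top)]
  simp only [ENNReal.toReal_ofReal (fsDensity_nonneg _)]

variable {ħ : ℝ} (hħ : 0 < ħ)

/-- The projector onto the line of the Hermite function of `v`, which depends only on the
point `[v]` of the projective line. -/
def normLineProj (N : ℕ) (v : Fin 2 → ℂ) : L2 →L[ℂ] L2 :=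
  (((Complex.normSq (v 0) + Complex.normSq (v 1) : ℝ) : ℂ) ^ N)⁻¹ • lineProj hħ N v

theorem normSq_add_ne_zero {v : Fin 2 → ℂ} (hv : v ≠ 0) :
    Complex.normSq (v 0) + Complex.normSq (v 1) ≠ 0 := by
  intro h
  have h0 := Complex.normSq_nonneg (v 0)
  have h1 := Complex.normSq_nonneg (v 1)
  have h2 : v 0 = 0 := Complex.normSq_eq_zero.mp (by linarith)
  have h3 : v 1 = 0 := Complex.normSq_eq_zero.mp (by linarith)
  refine hv (funext fun j => ?_)
  fin_cases j
  · exact h2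
  · exact h3

theorem normLineProj_smul (N : ℕ) {c : ℂ} (hc : c ≠ 0) (v : Fin 2 → ℂ) :
    normLineProj hħ N (c • v) = normLineProj hħ N v := by
  have hc' : (Complex.normSq c : ℂ) ^ N ≠ 0 :=
    pow_ne_zero _ (by exact_mod_cast (Complex.normSq_pos.mpr hc).ne')
  have hn : ((Complex.normSq ((c • v) 0) + Complex.normSq ((c • v) 1) : ℝ) : ℂ)
      = Complex.normSq c * ((Complex.normSq (v 0) + Complex.normSq (v 1) : ℝ) : ℂ) := by
    simp only [Pi.smul_apply, smul_eq_mul, map_mul]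
    push_cast
    ring
  rw [normLineProj, normLineProj, hn, lineProj_smul, smul_smul, mul_pow, mul_inv,
    mul_right_comm, inv_mul_cancel₀ hc', one_mul]

theorem normLineProj_of_unit (N : ℕ) {v : Fin 2 → ℂ}
    (hv : Complex.normSq (v 0) + Complex.normSq (v 1) = 1) :
    normLineProj hħ N v = lineProj hħ N v := by
  rw [normLineProj, hv, Complex.ofReal_one, one_pow, inv_one, one_smul]

theorem continuous_normLineProj (N : ℕ) :
    Continuous fun v : {v : Fin 2 → ℂ // v ≠ 0} => normLineProj hħ N v := by
  refine Continuous.smul (f := fun v : {v : Fin 2 → ℂ // v ≠ 0} =>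
      (((Complex.normSq (v.1 0) + Complex.normSq (v.1 1) : ℝ) : ℂ) ^ N)⁻¹) ?_
    ((continuous_lineProj hħ N).comp continuous_subtype_val)
  refine Continuous.inv₀ ?_ fun v => pow_ne_zero _ (by exact_mod_cast normSq_add_ne_zero v.2)
  have (j : Fin 2) : Continuous fun v : {v : Fin 2 → ℂ // v ≠ 0} => Complex.normSq (v.1 j) :=
    Complex.continuous_normSq.comp ((continuous_apply j).comp continuous_subtype_val)
  exact (Complex.continuous_ofReal.comp ((this 0).add (this 1))).pow N

/-- All `U` that carry the initial orbit to `[v]` send `(1, i)` to multiples of `v`, and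
`normLineProj` is unchanged by nonzero scalars. So neither `U` nor the phase matters. -/
theorem rankOne_of_isCoherentStateOf (N : ℕ) {v : Fin 2 → ℂ} (hv : v ≠ 0) {ψ : L2}
    (h : IsCoherentStateOf ħ N (Projectivization.mk ℂ v hv) ψ) :
    InnerProductSpace.rankOne ℂ ψ ψ = normLineProj hħ N v := by
  obtain ⟨U, hU, c, hc, rfl⟩ := h
  rw [rankOne_metaplectic hħ N U c hc]
  rw [gammaZero, Projectivization.smul_mk, Projectivization.mk_eq_mk_iff'] at hU
  obtain ⟨a, ha⟩ := hU
  have ha0 : a ≠ 0 := by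
    rintro rfl
    rw [zero_smul] at ha
    have h2 := normSq_mulVec U ![1, Complex.I]
    have h3 : U.1.mulVec ![1, Complex.I] = 0 := ha.symm
    rw [h3] at h2
    norm_num at h2
  have hs : ((Real.sqrt 2)⁻¹ : ℂ) ≠ 0 :=
    inv_ne_zero (by exact_mod_cast (Real.sqrt_pos.mpr two_pos).ne')
  have hvU : orbitVec U = (((Real.sqrt 2)⁻¹ : ℂ) * a) • v := by
    rw [mul_smul, ha]
    rfl
  exact (normLineProj_of_unit hħ N (normSq_orbitVec U)).symm.trans
    (by rw [hvU, normLineProj_smul hħ N (mul_ne_zero hs ha0)])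

/-- The phases may make `φ` itself non-measurable, but the rank one operators pull back to a
continuous function on `ℂ² \ {0}`, and `CP1` carries the quotient `σ`-algebra. -/
theorem stronglyMeasurable_rankOne {ħ : ℝ} (hħ : 0 < ħ) (N : ℕ) {φ : CP1 → L2}
    (hφ : ∀ γ, IsCoherentStateOf ħ N γ (φ γ)) :
    StronglyMeasurable fun γ => InnerProductSpace.rankOne ℂ (φ γ) (φ γ) := by
  borelize (L2 →L[ℂ] L2)
  have hmk (v : {v : Fin 2 → ℂ // v ≠ 0}) :
      InnerProductSpace.rankOne ℂ (φ (Projectivization.mk' ℂ v)) (φ (Projectivization.mk' ℂ v))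
        = normLineProj hħ N v :=
    rankOne_of_isCoherentStateOf hħ N v.2 (hφ _)
  refine stronglyMeasurable_iff_measurable_separable.mpr ⟨fun s hs => ?_, ?_⟩
  · have h := (continuous_normLineProj hħ N).measurable hs
    simp only [← hmk] at h
    exact h
  -- The space of bounded operators is not separable in norm; the range is, as the continuous image
  -- of a separable space.
  · refine (TopologicalSpace.isSeparable_range (continuous_normLineProj hħ N)).mono ?_
    rintro _ ⟨γ, rfl⟩
    induction γ using Projectivization.ind with
    | h v hv => exact ⟨⟨v, hv⟩, (hmk ⟨v, hv⟩).symm⟩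

theorem rankOne_chart (N : ℕ) {φ : CP1 → L2} (hφ : ∀ γ, IsCoherentStateOf ħ N γ (φ γ)) (w : ℂ) :
    InnerProductSpace.rankOne ℂ (φ (chart w)) (φ (chart w)) = lineProj hħ N (chartVec w) := by
  have hs : ((Real.sqrt (1 + ‖w‖ ^ 2))⁻¹ : ℂ) ≠ 0 :=
    inv_ne_zero (by exact_mod_cast (Real.sqrt_pos.mpr (by positivity : 0 < 1 + ‖w‖ ^ 2)).ne')
  rw [rankOne_of_isCoherentStateOf hħ N (chart_ne_zero w) (hφ (chart w)),
    ← normLineProj_of_unit hħ N (normSq_chartVec w), chartVec, normLineProj_smul hħ N hs]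

theorem projector_eq_integral_fubiniStudy {ħ : ℝ} (hħ : 0 < ħ) (N : ℕ) {φ : CP1 → L2}
    (hφ : ∀ γ, IsCoherentStateOf ħ N γ (φ γ)) :
    Integrable (fun γ => InnerProductSpace.rankOne ℂ (φ γ) (φ γ)) fubiniStudy ∧
      projector ħ N
        = ((N : ℂ) + 1) • ∫ γ, InnerProductSpace.rankOne ℂ (φ γ) (φ γ) ∂fubiniStudy := by
  have hmeas := (stronglyMeasurable_rankOne hħ N hφ).aestronglyMeasurable
    (μ := fsMeasure.map chart)
  rw [fubiniStudy_eq_map, integrable_map_measure hmeas measurable_chart.aemeasurable,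
    integral_map measurable_chart.aemeasurable hmeas]
  simp only [Function.comp_def, rankOne_chart hħ N hφ]
  exact projector_eq_integral_lineProj hħ fsMeasure N continuous_chartVec.aestronglyMeasurable
    normSq_chartVec (integral_fsMeasure_moment N)

theorem projector_eq_integral_haarSU2 {ħ : ℝ} (hħ : 0 < ħ) (N : ℕ) :
    Integrable (fun U : SU2 => InnerProductSpace.rankOne ℂ
        (metaplectic ħ U (coherentState N (ħ * (N + 1))))
        (metaplectic ħ U (coherentState N (ħ * (N + 1))))) haarSU2 ∧
      projector ħ N = ((N : ℂ) + 1) • ∫ U : SU2, InnerProductSpace.rankOne ℂ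
        (metaplectic ħ U (coherentState N (ħ * (N + 1))))
        (metaplectic ħ U (coherentState N (ħ * (N + 1)))) ∂haarSU2 := by
  have h (U : SU2) : InnerProductSpace.rankOne ℂ
      (metaplectic ħ U (coherentState N (ħ * (N + 1))))
      (metaplectic ħ U (coherentState N (ħ * (N + 1)))) = lineProj hħ N (orbitVec U) := by
    simpa only [one_smul, orbitVec] using rankOne_metaplectic hħ N U 1 norm_one
  simp only [h]
  exact projector_eq_integral_lineProj hħ haarSU2 N continuous_orbitVec.aestronglyMeasurable
    normSq_orbitVec (integral_moment_haarSU2 N)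

end

end OrbitalCoherent

/-- For every `ħ > 0` and `N`, the projector onto the `ħ (N + 1)`-eigenspace of the oscillator is
`N + 1` times the average over `SU(2)` of the rank one operators of the states `μ(U) φ`, and
`N + 1` times the average over the projective line of the rank one operators of the orbital
coherent states, whatever phase factors are chosen for these. The integrals are Bochner integrals
in the space of bounded operators with the operator norm. -/
theorem proposition3p1 (ħ : ℝ) (hħ : 0 < ħ) (N : ℕ) :
    (MeasureTheory.Integrable
        (fun U : OrbitalCoherent.SU2 =>
          InnerProductSpace.rankOne ℂ
            (OrbitalCoherent.metaplectic ħ U (OrbitalCoherent.coherentState N (ħ * (N + 1))))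
            (OrbitalCoherent.metaplectic ħ U (OrbitalCoherent.coherentState N (ħ * (N + 1)))))
        OrbitalCoherent.haarSU2 ∧
      OrbitalCoherent.projector ħ N =
        ((N : ℂ) + 1) • ∫ U : OrbitalCoherent.SU2,
          InnerProductSpace.rankOne ℂ
            (OrbitalCoherent.metaplectic ħ U (OrbitalCoherent.coherentState N (ħ * (N + 1))))
            (OrbitalCoherent.metaplectic ħ U (OrbitalCoherent.coherentState N (ħ * (N + 1))))
          ∂OrbitalCoherent.haarSU2) ∧
    ∀ φ : OrbitalCoherent.CP1 → OrbitalCoherent.L2,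
      (∀ γ, OrbitalCoherent.IsCoherentStateOf ħ N γ (φ γ)) →
      MeasureTheory.Integrable
          (fun γ => InnerProductSpace.rankOne ℂ (φ γ) (φ γ)) OrbitalCoherent.fubiniStudy ∧
        OrbitalCoherent.projector ħ N =
          ((N : ℂ) + 1) • ∫ γ, InnerProductSpace.rankOne ℂ (φ γ) (φ γ)
            ∂OrbitalCoherent.fubiniStudy := by
  exact ⟨OrbitalCoherent.projector_eq_integral_haarSU2 hħ N,
    fun _ hφ => OrbitalCoherent.projector_eq_integral_fubiniStudy hħ N hφ⟩
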